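/- Let $V$ be an $n$-dimensional vector space over the finite field $\mathbb{F}_q$, and for a subspace $W$ of $V$ let ${W \brack m}$ denote the family of all $m$-dimensional subspaces of $W$. A family $\mathcal{F}\subseteq {V\brack k}$ is called $t$-intersecting if $\dim(F_1\cap F_2)\ge t$ for all $F_1,F_2\in\mathcal{F}$, and almost $t$-intersecting if for each $F\in\mathcal{F}$ there is at most one $F'\in\mathcal{F}$ with $\dim(F\cap F')<t$. Write $\delta$ for the Kronecker delta. Let $n,k,t$ be positive integers with $k\ge t+1\ge 3$ and $$n\ge 2k+t+\delta_{2,q}+\delta_{k,t+1}(1-2t-\delta_{2,q}).$$ Suppose that $\mathcal{F}\subseteq{V\brack k}$ is almost $t$-intersecting but not $t$-intersecting, and that $\mathcal{F}$ has the maximum size among all such families. Then one of the following holds. (i) $(k,q)\ne(t+1,2)$, and there are $U_1,U_2\in{V\brack k}$ and $E\in{U_1\brack t}$ with $U_1\cap U_2\in{E\brack t-1}$ such that $$\mathcal{F}=\left\{F\in{V\brack k}: E\subseteq F,\ \dim(F\cap U_2)\ge t\right\}\cup\{U_1,U_2\}.$$ (ii) $(k,q)\in\{(t+1,2),(t+1,3)\}$,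 and there are $U_1,U_2,U_3,U_4\in{V\brack t+1}$ with $U_1\cap U_2=U_3\cap U_4\in{V\brack t-1}$ and $\dim(U_i\cap U_j)=t$ for all $i\in\{1,2\}$, $j\in\{3,4\}$ such that $$\mathcal{F}=\left\{U_1,\ U_2,\ U_3,\ U_4,\ (U_3\cap U_1)+(U_4\cap U_2),\ (U_4\cap U_1)+(U_3\cap U_2)\right\}.$$ -/

import Mathlib

namespace AlmostIntersecting

/-- The Kronecker delta on natural numbers, with integer values. -/
def delta (a b : ℕ) : ℤ := if a = b then 1 else 0

section

variable {K V : Type*} [Field K] [AddCommGroup V] [Module K V]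

/-- The family of all `m`-dimensional subspaces of the subspace `W` of `V`. -/
def subspacesOf (W : Submodule K V) (m : ℕ) : Set (Submodule K V) :=
  {F | F ≤ W ∧ Module.finrank K F = m}

variable (K V) in
/-- The family of all `m`-dimensional subspaces of `V`. -/
def subspaces (m : ℕ) : Set (Submodule K V) := subspacesOf (⊤ : Submodule K V) m

/-- Any two members of `𝓕` meet in dimension at least `t`. -/
def IsTIntersecting (t : ℕ) (𝓕 : Set (Submodule K V)) : Prop :=
  ∀ F₁ ∈ 𝓕, ∀ F₂ ∈ 𝓕, t ≤ Module.finrank K ↥(F₁ ⊓ F₂)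

/-- For each member `F` of `𝓕` there is at most one member of `𝓕` that meets `F` in dimension
less than `t`. -/
def IsAlmostTIntersecting (t : ℕ) (𝓕 : Set (Submodule K V)) : Prop :=
  ∀ F ∈ 𝓕, {F' ∈ 𝓕 | Module.finrank K ↥(F ⊓ F') < t}.Subsingleton

/-- `𝓕` is an almost `t`-intersecting family of `k`-subspaces which is not `t`-intersecting. -/
def IsProperAlmost (k t : ℕ) (𝓕 : Set (Submodule K V)) : Prop :=
  𝓕 ⊆ subspaces K V k ∧ IsAlmostTIntersecting t 𝓕 ∧ ¬ IsTIntersecting t 𝓕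

/-- `𝓕` has the maximum size among all almost `t`-intersecting families of `k`-subspaces which are
not `t`-intersecting. Over a finite field and in finite dimension all families are finite. -/
def IsMaximumProperAlmost (k t : ℕ) (𝓕 : Set (Submodule K V)) : Prop :=
  IsProperAlmost k t 𝓕 ∧ ∀ 𝓖 : Set (Submodule K V), IsProperAlmost k t 𝓖 → 𝓖.ncard ≤ 𝓕.ncard

/-- The family `𝓗(U₁, U₂, E)`. -/
def familyH (k t : ℕ) (U₁ U₂ E : Submodule K V) : Set (Submodule K V) :=
  {F ∈ subspaces K V k | E ≤ F ∧ t ≤ Module.finrank K ↥(F ⊓ U₂)} ∪ {U₁, U₂}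

/-- The family `𝓖(U₁, U₂, U₃, U₄)`. -/
def familyG (U₁ U₂ U₃ U₄ : Submodule K V) : Set (Submodule K V) :=
  {U₁, U₂, U₃, U₄, (U₃ ⊓ U₁) ⊔ (U₄ ⊓ U₂), (U₄ ⊓ U₁) ⊔ (U₃ ⊓ U₂)}

end

end AlmostIntersecting

/-! Fix `U₁, U₂ ∈ 𝓕` meeting in dimension less than `t`. Each is the only exception of the other, so
every other member meets both in dimension at least `t`. If all other members contain a `t`-space
`E` of `U₁` with `dm (E ⊓ U₂) = t - 1`, then `𝓕` lies inside `familyH`, which is itself admissible,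
and maximality gives equality (`IsBadPair.eq_familyH`). It remains to show that families of any
other shape are too small.

Case `k ≥ t + 2`. Bonferroni bounds `familyH` from below by roughly `[k-t+1]` times the number of
`k`-spaces over a `(t+1)`-space (`le_ncard_star`). Upper bounds come from branching: if `R` meets
some `U ∈ 𝓕` in dimension less than `t`, every member above `R` that reaches `t` with `U` contains
one of `[k-t+1]` spaces one dimension above `R` (`exists_extension_space`); the single possible
exception turns the factor into `theta = [k-t+1] + 1`. Let `m` be the least dimension of a
quasi-cover, a space meeting `U₁`, `U₂` and all but at most one member in dimension at least `t`.
Every space of dimension below `m` can branch. For `m ≥ t + 3` this alone suffices. For `m = t + 1`,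
the `(t+1)`-spaces lying below many members pairwise meet in dimension `t`, hence share their trace
on `U₁` or on `U₂`; a member avoiding that trace cuts their number from `[k-t+1]` to `[k-t]`
(`ncard_le_of_cover_succ`). For `m = t + 2`, either all quasi-covers of that dimension contain `U₁ ⊓
U₂` (`ncard_le_of_covers_contain`), or one of them is spanned by its traces on `U₁` and `U₂`, and
its `t`-subspaces are sorted by the way they meet these traces; most of them allow a third branching
(`IsTransversal.ncard_le`). The resulting inequalities are collected in `Dominates` and proved
separately for `q = 2` and `q ≥ 3`.

Case `k = t + 1`. The members other than `U₁, U₂` are spans `A ⊔ B` with `A`, `B` taken from the `q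
+ 1` `t`-spaces between `U₁ ⊓ U₂` and `U₁`, respectively `U₂`. They form a subset of a grid in which
two cells `t`-intersect exactly when they share a coordinate. Such a subset lies on a line, giving
at most `q + 3` members and `familyH`, or inside a `2 × 2` square, giving at most `6` members and
`familyG`. Comparing `q + 3` with `6` decides. -/

namespace AlmostIntersecting

/-! ### Dimension formulas in the subspace lattice. -/

section Dimension

variable {K V : Type*} [Field K] [AddCommGroup V] [Module K V]

/-- The dimension of a subspace. -/
noncomputable abbrev dm (A : Submodule K V) : ℕ := Module.finrank K A

variable [FiniteDimensional K V] {A B C : Submodule K V}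

lemma dm_mono (h : A ≤ B) : dm A ≤ dm B := Submodule.finrank_mono h

lemma dm_sup_add_inf (A B : Submodule K V) : dm (A ⊔ B) + dm (A ⊓ B) = dm A + dm B :=
  Submodule.finrank_sup_add_finrank_inf_eq A B

lemma eq_of_le_of_dm_le (h : A ≤ B) (h' : dm B ≤ dm A) : A = B :=
  Submodule.eq_of_le_of_finrank_le h h'

lemma dm_lt_of_lt (h : A < B) : dm A < dm B := Submodule.finrank_lt_finrank_of_lt h

lemma dm_sup_span_singleton {v : V} (hv : v ∉ A) : dm (A ⊔ Submodule.span K {v}) = dm A + 1 := by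
  have hv0 : v ≠ 0 := fun h => hv (h ▸ A.zero_mem)
  have h1 := dm_sup_add_inf A (Submodule.span K {v})
  have h2 : A ⊓ Submodule.span K {v} = ⊥ :=
    disjoint_iff.1 ((Submodule.disjoint_span_singleton' hv0).2 hv)
  have h3 : dm (Submodule.span K {v}) = 1 := finrank_span_singleton hv0
  have h4 : dm (⊥ : Submodule K V) = 0 := finrank_bot K V
  rw [h2, h3, h4] at h1
  omega

lemma exists_between_of_dm (h : A ≤ B) {m : ℕ} (h1 : dm A ≤ m) (h2 : m ≤ dm B) :
    ∃ C, A ≤ C ∧ C ≤ B ∧ dm C = m := by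
  induction m, h1 using Nat.le_induction with
  | base => exact ⟨A, le_rfl, h, rfl⟩
  | succ m hm ih =>
    obtain ⟨C, hAC, hCB, hC⟩ := ih (by omega)
    have hlt : C < B := lt_of_le_of_ne hCB (by rintro rfl; omega)
    obtain ⟨v, hvB, hvC⟩ := SetLike.exists_of_lt hlt
    refine ⟨C ⊔ Submodule.span K {v}, hAC.trans le_sup_left, sup_le hCB ?_, ?_⟩
    · simpa [Submodule.span_singleton_le_iff_mem] using hvB
    · rw [dm_sup_span_singleton hvC, hC]

/-- The modular law turns `B ⊓ (A ⊔ C)` into `A ⊔ (B ⊓ C)`. This measures how far a space `B` above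
`A` must reach into `A ⊔ C` once its trace on `C` is known. -/
lemma inf_sup_dm_of_le (h : A ≤ B) (C : Submodule K V) :
    dm (B ⊓ (A ⊔ C)) + dm (A ⊓ C) = dm A + dm (B ⊓ C) := by
  have h1 : B ⊓ (A ⊔ C) = A ⊔ (B ⊓ C) := by
    rw [inf_comm, inf_comm B C, sup_inf_assoc_of_le C h]
  have h2 := dm_sup_add_inf A (B ⊓ C)
  have h3 : A ⊓ (B ⊓ C) = A ⊓ C := by rw [← inf_assoc, inf_eq_left.2 h]
  rw [h3] at h2
  rw [h1]; omega

end Dimension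

/-! ### Double counting and covering bounds for finite sets. -/

section Counting

lemma card_mul_eq_card_mul_of_rel {α β : Type*} [Finite α] [Finite β] (s : Set α) (u : Set β)
    (r : α → β → Prop) {m n : ℕ} (hm : ∀ a ∈ s, {b ∈ u | r a b}.ncard = m)
    (hn : ∀ b ∈ u, {a ∈ s | r a b}.ncard = n) : s.ncard * m = u.ncard * n := by
  classical
  have := Fintype.ofFinite α
  have := Fintype.ofFinite β
  rw [Set.ncard_eq_toFinset_card' s, Set.ncard_eq_toFinset_card' u]
  refine Finset.card_mul_eq_card_mul r (fun a ha => ?_) (fun b hb => ?_)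
  · rw [← hm a (by simpa using ha), Set.ncard_eq_toFinset_card']
    congr 1
    ext b; simp [Finset.bipartiteAbove]
  · rw [← hn b (by simpa using hb), Set.ncard_eq_toFinset_card']
    congr 1
    ext b; simp [Finset.bipartiteBelow]

lemma ncard_le_mul_of_cover {α ι : Type*} [Finite α] [Finite ι] (s : Set α) (I : Set ι)
    (r : ι → α → Prop) {b : ℝ} (h : ∀ a ∈ s, ∃ i ∈ I, r i a)
    (hb : ∀ i ∈ I, ({a ∈ s | r i a}.ncard : ℝ) ≤ b) : (s.ncard : ℝ) ≤ I.ncard * b := by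
  classical
  have := Fintype.ofFinite α
  have := Fintype.ofFinite ι
  have h1 : s.toFinset ⊆ I.toFinset.biUnion fun i => {a ∈ s | r i a}.toFinset := by
    intro a ha
    obtain ⟨i, hi, hr⟩ := h a (by simpa using ha)
    simp only [Finset.mem_biUnion, Set.mem_toFinset]
    exact ⟨i, hi, by simpa using ha, hr⟩
  have h2 := (Finset.card_le_card h1).trans Finset.card_biUnion_le
  rw [Set.ncard_eq_toFinset_card' s, Set.ncard_eq_toFinset_card' I]
  calc (s.toFinset.card : ℝ)
      ≤ ∑ i ∈ I.toFinset, (({a ∈ s | r i a}.toFinset.card : ℕ) : ℝ) := by exact_mod_cast h2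
    _ ≤ ∑ _i ∈ I.toFinset, b := by
        refine Finset.sum_le_sum fun i hi => ?_
        rw [← Set.ncard_eq_toFinset_card']
        exact hb i (by simpa using hi)
    _ = _ := by simp

lemma ncard_le_ncard_real {α : Type*} [Finite α] {s u : Set α} (h : s ⊆ u) :
    (s.ncard : ℝ) ≤ u.ncard := by
  exact_mod_cast Set.ncard_le_ncard h (Set.toFinite _)

lemma ncard_le_add_of_imp {α : Type*} [Finite α] (s : Set α) (p : α → Prop) :
    s.ncard ≤ {a ∈ s | p a}.ncard + {a ∈ s | ¬ p a}.ncard := by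
  have : s = {a ∈ s | p a} ∪ {a ∈ s | ¬ p a} := by ext a; by_cases h : p a <;> simp [h]
  conv_lhs => rw [this]
  exact Set.ncard_union_le _ _

end Counting

/-! ### Arithmetic of `q`-integers. -/

/-- The `q`-analogue of the natural number `i`. -/
def qInt (q i : ℕ) : ℕ := ∑ j ∈ Finset.range i, q ^ j

lemma qInt_zero (q : ℕ) : qInt q 0 = 0 := rfl

lemma qInt_one (q : ℕ) : qInt q 1 = 1 := by simp [qInt]

lemma qInt_two (q : ℕ) : qInt q 2 = q + 1 := by simp [qInt, Finset.sum_range_succ, add_comm]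

lemma qInt_three (q : ℕ) : qInt q 3 = q ^ 2 + q + 1 := by
  simp [qInt, Finset.sum_range_succ]; ring

lemma qInt_mul_sub_one_real (q i : ℕ) : (qInt q i : ℝ) * ((q : ℝ) - 1) = (q : ℝ) ^ i - 1 := by
  simp only [qInt, Nat.cast_sum, Nat.cast_pow]
  exact geom_sum_mul _ _

lemma qInt_pos {q i : ℕ} (hi : 0 < i) : 0 < qInt q i := by
  obtain ⟨j, rfl⟩ := Nat.exists_eq_succ_of_ne_zero hi.ne'
  rw [qInt, Finset.sum_range_succ']
  simp

lemma qInt_mono (q : ℕ) : Monotone (qInt q) := fun _ _ h =>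
  Finset.sum_le_sum_of_subset (Finset.range_mono h)

lemma qInt_mul_add_pow (q a b : ℕ) :
    qInt q b * (q ^ (a + 1) - q ^ a : ℤ) = q ^ (a + b) - q ^ a := by
  have : (qInt q b : ℤ) * ((q : ℤ) - 1) = (q : ℤ) ^ b - 1 := by
    simp only [qInt, Nat.cast_sum, Nat.cast_pow]
    exact geom_sum_mul _ _
  rw [pow_succ, pow_add]
  linear_combination (q : ℤ) ^ a * this

/-! ### Branching above a subspace, and counting subspaces in an interval. -/

section Intervals

variable {K V : Type*} [Field K] [AddCommGroup V] [Module K V]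

/-- The subspaces between `A` and `B` of dimension `m`. -/
def betw (A B : Submodule K V) (m : ℕ) : Set (Submodule K V) := {C | A ≤ C ∧ C ≤ B ∧ dm C = m}

/-- The subspaces between `A` and `B` of dimension one more than that of `A`. -/
def pts (A B : Submodule K V) : Set (Submodule K V) := betw A B (dm A + 1)

section Extension

variable [FiniteDimensional K V]

/-- A subspace that misses the threshold `t` with `U` can be enlarged by one dimension inside a
space of controlled dimension, in such a way that every `F` above it which reaches the threshold
contains one of the enlargements. -/
theorem exists_extension_space {R U : Submodule K V} {t : ℕ} (hRU : dm (R ⊓ U) < t)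
    (hU : t ≤ dm U) :
    ∃ M, R ≤ M ∧ M ≤ R ⊔ U ∧ dm M = dm R + (dm U - t + 1) ∧
      ∀ F, R ≤ F → t ≤ dm (F ⊓ U) → ∃ C ∈ pts R M, C ≤ F := by
  have h1 := dm_sup_add_inf R U
  -- With this dimension `M` has codimension `t - 1 - dm (R ⊓ U)` in `R ⊔ U`, while `F ⊓ (R ⊔ U)`
  -- exceeds `R` by at least `t - dm (R ⊓ U)`. So `F ⊓ M` strictly contains `R`.
  obtain ⟨M, hRM, hMU, hM⟩ := exists_between_of_dm (le_sup_left : R ≤ R ⊔ U)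
    (m := dm R + (dm U - t + 1)) (by omega) (by omega)
  refine ⟨M, hRM, hMU, hM, fun F hRF hF => ?_⟩
  have h2 := inf_sup_dm_of_le hRF U
  have h3 := dm_sup_add_inf (F ⊓ (R ⊔ U)) M
  have h4 : dm (F ⊓ (R ⊔ U) ⊔ M) ≤ dm (R ⊔ U) := dm_mono (sup_le inf_le_right hMU)
  have h5 : R ≤ F ⊓ (R ⊔ U) ⊓ M := le_inf (le_inf hRF le_sup_left) hRM
  obtain ⟨C, hRC, hCM, hC⟩ := exists_between_of_dm h5 (m := dm R + 1) (by omega) (by omega)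
  exact ⟨C, ⟨hRC, hCM.trans inf_le_right, hC⟩, hCM.trans (inf_le_left.trans inf_le_left)⟩

end Extension

variable [Finite K] [FiniteDimensional K V]

variable (K V) in
lemma finite_submodule : Finite (Submodule K V) := by
  have : Finite V := Module.finite_of_finite K
  exact Finite.of_injective (fun A : Submodule K V => (A : Set V)) SetLike.coe_injective

lemma ncard_coe_submodule (A : Submodule K V) : (A : Set V).ncard = Nat.card K ^ dm A := by
  have : Finite V := Module.finite_of_finite K
  rw [← Module.natCard_eq_pow_finrank (K := K) (V := A)]
  rfl

variable (K) in
lemma two_le_card_field : 2 ≤ Nat.card K := Finite.one_lt_card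

/-- Pairs `v ∈ C` with `v ∈ B \ A` are counted twice: each `v` lies in the single space `A ⊔ span
{v}`, and each `C` has `q ^ (dm A + 1) - q ^ dm A` vectors outside `A`. -/
theorem ncard_pts {A B : Submodule K V} (h : A ≤ B) :
    (pts A B).ncard = qInt (Nat.card K) (dm B - dm A) := by
  have : Finite V := Module.finite_of_finite K
  have := finite_submodule K V
  have hq := two_le_card_field K
  set q := Nat.card K with hqdef
  have hdiff : ∀ {C : Submodule K V}, A ≤ C →
      (((C : Set V) \ A).ncard : ℤ) = q ^ dm C - q ^ dm A := by
    intro C hC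
    have := Set.ncard_sdiff_add_ncard_of_subset (show (A : Set V) ⊆ C from hC)
    rw [ncard_coe_submodule, ncard_coe_submodule] at this
    have : (((C : Set V) \ A).ncard : ℤ) + q ^ dm A = q ^ dm C := by exact_mod_cast this
    linarith
  have key := card_mul_eq_card_mul_of_rel (pts A B) ((B : Set V) \ A) (fun C v => v ∈ C)
    (m := q ^ (dm A + 1) - q ^ dm A) (n := 1) ?_ ?_
  · have hle : q ^ dm A ≤ q ^ (dm A + 1) := Nat.pow_le_pow_right (by omega) (by omega)
    have key' : ((pts A B).ncard : ℤ) * (q ^ (dm A + 1) - q ^ dm A) = q ^ dm B - q ^ dm A := by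
      rw [← hdiff h]
      have := congrArg (Nat.cast : ℕ → ℤ) key
      push_cast [Nat.cast_sub hle] at this
      linarith
    have h2 := qInt_mul_add_pow q (dm A) (dm B - dm A)
    rw [Nat.add_sub_cancel' (dm_mono h), ← key'] at h2
    have hpos : (0 : ℤ) < q ^ (dm A + 1) - q ^ dm A := by
      have : q ^ dm A < q ^ (dm A + 1) := Nat.pow_lt_pow_right (by omega) (by omega)
      have : (q ^ dm A : ℤ) < q ^ (dm A + 1) := by exact_mod_cast this
      linarith
    exact_mod_cast (mul_right_cancel₀ hpos.ne' h2).symm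
  · rintro C ⟨hAC, hCB, hC⟩
    have h1 : {v ∈ (B : Set V) \ A | v ∈ C} = (C : Set V) \ A := by
      ext v; simp only [Set.mem_ofPred_eq, Set.mem_sdiff, SetLike.mem_coe]
      exact ⟨fun h => ⟨h.2, h.1.2⟩, fun h => ⟨⟨hCB h.1, h.2⟩, h.1⟩⟩
    rw [h1]
    have hle : q ^ dm A ≤ q ^ (dm A + 1) := Nat.pow_le_pow_right (by omega) (by omega)
    zify [hle]
    rw [hdiff hAC, hC]
  · rintro v ⟨hvB, hvA⟩
    rw [Set.ncard_eq_one]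
    refine ⟨A ⊔ Submodule.span K {v}, ?_⟩
    ext C
    simp only [Set.mem_ofPred_eq, Set.mem_singleton_iff]
    constructor
    · rintro ⟨⟨hAC, hCB, hC⟩, hv⟩
      refine (eq_of_le_of_dm_le (sup_le hAC ?_) ?_).symm
      · simpa [Submodule.span_singleton_le_iff_mem] using hv
      · rw [dm_sup_span_singleton hvA, hC]
    · rintro rfl
      refine ⟨⟨le_sup_left, sup_le h ?_, dm_sup_span_singleton hvA⟩, ?_⟩
      · simpa [Submodule.span_singleton_le_iff_mem] using hvB
      · exact Submodule.mem_sup_right (Submodule.mem_span_singleton_self v)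

end Intervals

/-! ### Gaussian binomial coefficients and the number of `k`-spaces over a given space. -/

/-- The `q`-factorial. -/
noncomputable def qFact (q i : ℕ) : ℝ := ∏ j ∈ Finset.range i, (qInt q (j + 1) : ℝ)

lemma qFact_pos (q i : ℕ) : 0 < qFact q i :=
  Finset.prod_pos fun j _ => by exact_mod_cast qInt_pos j.succ_pos

lemma qFact_succ (q i : ℕ) : qFact q (i + 1) = qFact q i * qInt q (i + 1) :=
  Finset.prod_range_succ _ _

/-- The Gaussian binomial coefficient. -/
noncomputable def gb (q N j : ℕ) : ℝ :=
  if j ≤ N then qFact q N / (qFact q j * qFact q (N - j)) else 0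

lemma gb_zero_right (q N : ℕ) : gb q N 0 = 1 := by
  have := (qFact_pos q N).ne'
  simp only [gb, Nat.zero_le, if_true, Nat.sub_zero]
  rw [show qFact q 0 = 1 by simp [qFact], one_mul, div_self this]

lemma gb_pos {q N j : ℕ} (h : j ≤ N) : 0 < gb q N j := by
  rw [gb, if_pos h]
  exact div_pos (qFact_pos _ _) (mul_pos (qFact_pos _ _) (qFact_pos _ _))

lemma gb_symm (q i j : ℕ) : gb q (i + j) i = gb q (i + j) j := by
  rw [gb, gb, if_pos (by omega), if_pos (by omega)]
  simp only [Nat.add_sub_cancel_left, Nat.add_sub_cancel]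
  rw [mul_comm]

lemma gb_succ_succ_mul (q : ℕ) {N j : ℕ} (h : j ≤ N) :
    gb q (N + 1) (j + 1) * qInt q (j + 1) = qInt q (N + 1) * gb q N j := by
  rw [gb, gb, if_pos (by omega), if_pos h, qFact_succ, qFact_succ,
    show N + 1 - (j + 1) = N - j by omega]
  have h1 := (qFact_pos q j).ne'
  have h2 := (qFact_pos q (N - j)).ne'
  have h3 : (qInt q (j + 1) : ℝ) ≠ 0 := by exact_mod_cast (qInt_pos j.succ_pos).ne'
  field_simp

lemma gb_succ_left_mul (q : ℕ) {N j : ℕ} (h : j ≤ N) :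
    gb q (N + 1) j * qInt q (N + 1 - j) = qInt q (N + 1) * gb q N j := by
  rw [gb, gb, if_pos (by omega), if_pos h, qFact_succ,
    show N + 1 - j = (N - j) + 1 by omega, qFact_succ]
  have h1 := (qFact_pos q j).ne'
  have h2 := (qFact_pos q (N - j)).ne'
  have h3 : (qInt q (N - j + 1) : ℝ) ≠ 0 := by exact_mod_cast (qInt_pos (N - j).succ_pos).ne'
  field_simp

section Intervals

variable {K V : Type*} [Field K] [AddCommGroup V] [Module K V] [Finite K] [FiniteDimensional K V]

/-- Induction on `m - dm A`: flags `A < C ≤ F`, with `C` one dimension above `A`, are counted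
through `C` and through `F`, which reproduces the recursion `gb_succ_succ_mul`. -/
theorem ncard_betw {A B : Submodule K V} (h : A ≤ B) {m : ℕ} (hA : dm A ≤ m) (hB : m ≤ dm B) :
    ((betw A B m).ncard : ℝ) = gb (Nat.card K) (dm B - dm A) (m - dm A) := by
  have := finite_submodule K V
  obtain ⟨j, rfl⟩ := Nat.exists_eq_add_of_le hA
  induction j generalizing A with
  | zero =>
    have : betw A B (dm A + 0) = {A} := by
      ext C
      simp only [betw, Set.mem_ofPred_eq, Set.mem_singleton_iff, add_zero]
      constructor
      · rintro ⟨h1, _, h2⟩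
        exact (eq_of_le_of_dm_le h1 h2.le).symm
      · rintro rfl
        exact ⟨le_rfl, h, rfl⟩
    rw [this]
    simp [gb_zero_right]
  | succ j ih =>
    have hlt : dm A < dm B := by omega
    have ih' : ∀ C ∈ pts A B, ((betw C B (dm A + (j + 1))).ncard : ℝ) =
        gb (Nat.card K) (dm B - dm A - 1) j := by
      rintro C ⟨hAC, hCB, hC⟩
      have := ih hCB (by omega) (by omega)
      rw [show dm C + j = dm A + (j + 1) by omega] at this
      rw [this]
      congr 1 <;> omega
    obtain ⟨C₀, hAC₀, hC₀B, hC₀⟩ := exists_between_of_dm h (m := dm A + 1) (by omega) hlt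
    have key := card_mul_eq_card_mul_of_rel (pts A B) (betw A B (dm A + (j + 1)))
      (fun C F => C ≤ F) (m := (betw C₀ B (dm A + (j + 1))).ncard)
      (n := qInt (Nat.card K) (j + 1)) ?_ ?_
    · rw [ncard_pts h] at key
      have key' := congrArg (Nat.cast : ℕ → ℝ) key
      push_cast at key'
      rw [ih' C₀ ⟨hAC₀, hC₀B, hC₀⟩] at key'
      have h2 := gb_succ_succ_mul (Nat.card K) (N := dm B - dm A - 1) (j := j) (by omega)
      rw [show dm B - dm A - 1 + 1 = dm B - dm A by omega] at h2
      have h3 : (qInt (Nat.card K) (j + 1) : ℝ) ≠ 0 := by exact_mod_cast (qInt_pos j.succ_pos).ne'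
      rw [show dm A + (j + 1) - dm A = j + 1 by omega]
      refine mul_right_cancel₀ h3 ?_
      rw [h2, ← key']
    · intro C hC
      have h1 : {F ∈ betw A B (dm A + (j + 1)) | C ≤ F} = betw C B (dm A + (j + 1)) := by
        ext F
        simp only [betw, Set.mem_ofPred_eq]
        exact ⟨fun h => ⟨h.2, h.1.2⟩, fun h => ⟨⟨hC.1.trans h.1, h.2⟩, h.1⟩⟩
      rw [h1]
      have : ((betw C B (dm A + (j + 1))).ncard : ℝ) = (betw C₀ B (dm A + (j + 1))).ncard := by
        rw [ih' C hC, ih' C₀ ⟨hAC₀, hC₀B, hC₀⟩]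
      exact_mod_cast this
    · rintro F ⟨hAF, hFB, hF⟩
      have h1 : {C ∈ pts A B | C ≤ F} = pts A F := by
        ext C
        simp only [pts, betw, Set.mem_ofPred_eq]
        exact ⟨fun h => ⟨h.1.1, h.2, h.1.2.2⟩, fun h => ⟨⟨h.1, h.2.1.trans hFB, h.2.2⟩, h.2.1⟩⟩
      rw [h1, ncard_pts hAF, hF, Nat.add_sub_cancel_left]

lemma ncard_above_le_mul {𝓐 : Set (Submodule K V)} {R M : Submodule K V} {i : ℕ} {b : ℝ}
    (hRM : R ≤ M) (hM : dm M = dm R + i) (hex : ∀ F ∈ 𝓐, R ≤ F → ∃ C ∈ pts R M, C ≤ F)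
    (hb : ∀ C ∈ pts R M, ({F ∈ 𝓐 | C ≤ F}.ncard : ℝ) ≤ b) :
    ({F ∈ 𝓐 | R ≤ F}.ncard : ℝ) ≤ qInt (Nat.card K) i * b := by
  have := finite_submodule K V
  have h := ncard_le_mul_of_cover {F ∈ 𝓐 | R ≤ F} (pts R M) (fun C F => C ≤ F) (b := b)
    (fun F hF => hex F hF.1 hF.2) (fun C hC => ?_)
  · rwa [ncard_pts hRM, hM, Nat.add_sub_cancel_left] at h
  · refine le_trans ?_ (hb C hC)
    exact ncard_le_ncard_real fun F hF => ⟨hF.1.1, hF.2⟩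

end Intervals

lemma gb_one_right (q : ℕ) {N : ℕ} (h : 1 ≤ N) : gb q N 1 = qInt q N := by
  obtain ⟨M, rfl⟩ := Nat.exists_eq_add_of_le' h
  have := gb_succ_succ_mul q (N := M) (j := 0) (Nat.zero_le _)
  rw [gb_zero_right, zero_add, qInt_one] at this
  simpa using this

lemma one_le_gb (q : ℕ) {N j : ℕ} (h : j ≤ N) : 1 ≤ gb q N j := by
  induction j generalizing N with
  | zero => rw [gb_zero_right]
  | succ j ih =>
    obtain ⟨M, rfl⟩ := Nat.exists_eq_add_of_le' (show 1 ≤ N by omega)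
    have h1 := gb_succ_succ_mul q (N := M) (j := j) (by omega)
    have h2 := ih (N := M) (by omega)
    have h3 : (0 : ℝ) < qInt q (j + 1) := by exact_mod_cast qInt_pos j.succ_pos
    have h4 : (qInt q (j + 1) : ℝ) ≤ qInt q (M + 1) := by exact_mod_cast qInt_mono q h
    nlinarith

lemma gb_two_right (q t : ℕ) :
    gb q (t + 2) 2 * (q + 1 : ℝ) = qInt q (t + 2) * qInt q (t + 1) := by
  have h := gb_succ_succ_mul q (N := t + 1) (j := 1) (by omega)
  rw [gb_one_right q (by omega), qInt_two] at h
  push_cast at h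
  exact h

lemma gb_three_right (q t : ℕ) :
    gb q (t + 3) 3 * (q ^ 2 + q + 1 : ℝ) = qInt q (t + 3) * gb q (t + 2) 2 := by
  have h := gb_succ_succ_mul q (N := t + 2) (j := 2) (by omega)
  rw [qInt_three] at h
  push_cast at h
  exact h

/-- The number of `k`-dimensional subspaces of an `n`-dimensional space that contain a given
`r`-dimensional subspace. -/
noncomputable def cnt (q n k r : ℕ) : ℝ := if r ≤ k then gb q (n - r) (k - r) else 0

lemma one_le_cnt (q : ℕ) {n k r : ℕ} (hr : r ≤ k) (hk : k ≤ n) : 1 ≤ cnt q n k r := by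
  rw [cnt, if_pos hr]; exact one_le_gb q (by omega)

lemma cnt_nonneg (q : ℕ) {n k : ℕ} (hk : k ≤ n) (r : ℕ) : 0 ≤ cnt q n k r := by
  by_cases hr : r ≤ k
  · exact zero_le_one.trans (one_le_cnt q hr hk)
  · rw [cnt, if_neg hr]

lemma cnt_mul (q : ℕ) {n k r : ℕ} (hr : r ≤ k) (hk : k ≤ n) :
    cnt q n k r * qInt q (k - r) = qInt q (n - r) * cnt q n k (r + 1) := by
  rcases hr.lt_or_eq with h | rfl
  · rw [cnt, cnt, if_pos hr, if_pos (Nat.succ_le_of_lt h)]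
    have := gb_succ_succ_mul q (N := n - (r + 1)) (j := k - (r + 1)) (by omega)
    rwa [show n - (r + 1) + 1 = n - r by omega, show k - (r + 1) + 1 = k - r by omega] at this
  -- For `r = k` both sides vanish: `qInt q 0 = 0`, and `cnt` is `0` above dimension `k`.
  · simp [cnt, qInt_zero]

/-- Second-order inclusion-exclusion. Adding the `i`-th set loses at most `c` for each earlier one,
hence `c` for each pair in total. -/
lemma bonferroni {α ι : Type*} [DecidableEq α] [DecidableEq ι] (s : Finset ι) (A : ι → Finset α)
    {b c : ℝ} (hb : ∀ i ∈ s, b ≤ (A i).card)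
    (hc : ∀ i ∈ s, ∀ j ∈ s, i ≠ j → ((A i ∩ A j).card : ℝ) ≤ c) :
    s.card * b ≤ (s.biUnion A).card + s.card * (s.card - 1) / 2 * c := by
  induction s using Finset.induction_on with
  | empty => simp
  | insert i s hi ih =>
    have ih' := ih (fun j hj => hb j (Finset.mem_insert_of_mem hj))
      (fun j hj l hl => hc j (Finset.mem_insert_of_mem hj) l (Finset.mem_insert_of_mem hl))
    rw [Finset.biUnion_insert, Finset.card_insert_of_notMem hi]
    have h1 : (((A i ∪ s.biUnion A).card : ℕ) : ℝ) + (A i ∩ s.biUnion A).card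
        = (A i).card + (s.biUnion A).card := by
      exact_mod_cast Finset.card_union_add_card_inter _ _
    have h2 : ((A i ∩ s.biUnion A).card : ℝ) ≤ s.card * c := by
      rw [Finset.inter_biUnion]
      calc (((s.biUnion fun j => A i ∩ A j).card : ℕ) : ℝ)
          ≤ ∑ j ∈ s, ((A i ∩ A j).card : ℝ) := by exact_mod_cast Finset.card_biUnion_le
        _ ≤ ∑ _j ∈ s, c := Finset.sum_le_sum fun j hj =>
            hc i (Finset.mem_insert_self _ _) j (Finset.mem_insert_of_mem hj)
              (by rintro rfl; exact hi hj)
        _ = _ := by simp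
    have h3 := hb i (Finset.mem_insert_self _ _)
    push_cast
    nlinarith

/-! ### Branching bounds for almost `t`-intersecting families, and the size of a star. -/

section Families

variable {K V : Type*} [Field K] [AddCommGroup V] [Module K V]

lemma mem_subspaces {k : ℕ} {F : Submodule K V} : F ∈ subspaces K V k ↔ dm F = k := by
  simp [subspaces, subspacesOf]

variable [Finite K] [FiniteDimensional K V]

lemma ncard_above (R : Submodule K V) {k : ℕ} (hk : k ≤ Module.finrank K V) :
    ({F : Submodule K V | R ≤ F ∧ dm F = k}.ncard : ℝ) =
      cnt (Nat.card K) (Module.finrank K V) k (dm R) := by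
  have := finite_submodule K V
  by_cases hr : dm R ≤ k
  · have h := ncard_betw (le_top : R ≤ ⊤) hr (by rw [dm, finrank_top]; exact hk)
    rw [dm, dm, finrank_top] at h
    rw [cnt, if_pos hr, ← h]
    congr 2
    ext F; simp [betw]
  · rw [cnt, if_neg hr, Nat.cast_eq_zero, Set.ncard_eq_zero]
    ext F
    simp only [Set.mem_ofPred_eq, Set.mem_empty_iff_false, iff_false, not_and]
    intro h1 h2
    exact hr (h2 ▸ dm_mono h1)

lemma ncard_above_le {𝓐 : Set (Submodule K V)} {k : ℕ} (h𝓐 : ∀ F ∈ 𝓐, dm F = k)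
    (hk : k ≤ Module.finrank K V) (R : Submodule K V) :
    ({F ∈ 𝓐 | R ≤ F}.ncard : ℝ) ≤ cnt (Nat.card K) (Module.finrank K V) k (dm R) := by
  have := finite_submodule K V
  rw [← ncard_above R hk]
  exact ncard_le_ncard_real fun F hF => ⟨hF.2, h𝓐 F hF.1⟩

lemma ncard_above_le_mul_of_meets {𝓐 : Set (Submodule K V)} {R U : Submodule K V} {t : ℕ} {b : ℝ}
    (hRU : dm (R ⊓ U) < t) (hU : t ≤ dm U) (h𝓐 : ∀ F ∈ 𝓐, R ≤ F → t ≤ dm (F ⊓ U))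
    (hb : ∀ C, R ≤ C → C ≤ R ⊔ U → dm C = dm R + 1 → ({F ∈ 𝓐 | C ≤ F}.ncard : ℝ) ≤ b) :
    ({F ∈ 𝓐 | R ≤ F}.ncard : ℝ) ≤ qInt (Nat.card K) (dm U - t + 1) * b := by
  obtain ⟨M, hRM, hMU, hM, hex⟩ := exists_extension_space hRU hU
  exact ncard_above_le_mul hRM hM (fun F hF hRF => hex F hRF (h𝓐 F hF hRF))
    (fun C hC => hb C hC.1 (hC.2.1.trans hMU) hC.2.2)

lemma ncard_exceptional_le_one {𝓕 𝓐 : Set (Submodule K V)} {t : ℕ}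
    (halm : IsAlmostTIntersecting t 𝓕) (h𝓐 : 𝓐 ⊆ 𝓕) {U : Submodule K V} (hU : U ∈ 𝓕) :
    {F ∈ 𝓐 | ¬ t ≤ dm (F ⊓ U)}.ncard ≤ 1 := by
  have := finite_submodule K V
  rw [Set.ncard_le_one_iff_subsingleton]
  refine (halm U hU).anti fun F hF => ⟨h𝓐 hF.1, ?_⟩
  rw [inf_comm]
  exact not_le.1 hF.2

/-- One branching step along a member `U` of the family: at most one member fails to reach `t` with
`U`, which accounts for the summand `1`. -/
lemma ncard_above_le_one_add_mul {𝓕 𝓐 : Set (Submodule K V)} {k t : ℕ} (hk : ∀ F ∈ 𝓕, dm F = k)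
    (halm : IsAlmostTIntersecting t 𝓕) (h𝓐 : 𝓐 ⊆ 𝓕) (htk : t ≤ k) {R U : Submodule K V}
    (hU : U ∈ 𝓕) (hRU : dm (R ⊓ U) < t) {b : ℝ}
    (hb : ∀ C, R ≤ C → dm C = dm R + 1 → ({F ∈ 𝓐 | C ≤ F}.ncard : ℝ) ≤ b) :
    ({F ∈ 𝓐 | R ≤ F}.ncard : ℝ) ≤ 1 + qInt (Nat.card K) (k - t + 1) * b := by
  have := finite_submodule K V
  have h1 := ncard_le_add_of_imp {F ∈ 𝓐 | R ≤ F} (fun F => t ≤ dm (F ⊓ U))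
  have h2 : {F ∈ {F ∈ 𝓐 | R ≤ F} | ¬ t ≤ dm (F ⊓ U)}.ncard ≤ 1 :=
    ncard_exceptional_le_one halm (fun F hF => h𝓐 hF.1) hU
  have h3 := ncard_above_le_mul_of_meets (𝓐 := {F ∈ 𝓐 | t ≤ dm (F ⊓ U)}) (b := b) hRU
    (by rw [hk U hU]; exact htk) (fun F hF _ => hF.2) (fun C hRC _ hC => by
      refine le_trans ?_ (hb C hRC hC)
      exact ncard_le_ncard_real fun F hF => ⟨hF.1.1, hF.2⟩)
  rw [hk U hU] at h3
  have h4 : {F ∈ {F ∈ 𝓐 | R ≤ F} | t ≤ dm (F ⊓ U)} = {F ∈ {F ∈ 𝓐 | t ≤ dm (F ⊓ U)} | R ≤ F} := by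
    ext F; simp only [Set.mem_ofPred_eq]; tauto
  rw [h4] at h1
  have h5 : ({F ∈ 𝓐 | R ≤ F}.ncard : ℝ) ≤
      {F ∈ {F ∈ 𝓐 | t ≤ dm (F ⊓ U)} | R ≤ F}.ncard + 1 := by exact_mod_cast h1.trans (by omega)
  linarith

/-- The branching factor of an extension step, including one exceptional member. -/
noncomputable def theta (q d : ℕ) : ℝ := qInt q (d + 1) + 1

lemma one_le_theta (q d : ℕ) : 1 ≤ theta q d := by
  have : (0 : ℝ) ≤ qInt q (d + 1) := Nat.cast_nonneg _
  rw [theta]; linarith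

/-- Branching is iterated from dimension `m - j` up to `m`. The hypothesis `hnc` supplies a member
to branch along at each level; it is required only for spaces below some element of `𝓐`, which
allows a restricted `𝓐` to branch once more than `𝓕`. -/
theorem ncard_above_le_pow {𝓕 𝓐 : Set (Submodule K V)} {k t m : ℕ} (hk : ∀ F ∈ 𝓕, dm F = k)
    (halm : IsAlmostTIntersecting t 𝓕) (h𝓐 : 𝓐 ⊆ 𝓕) (htk : t ≤ k) (hmk : m ≤ k)
    (hkn : k ≤ Module.finrank K V)
    (hnc : ∀ Q, dm Q < m → (∃ F ∈ 𝓐, Q ≤ F) → ∃ U ∈ 𝓕, dm (Q ⊓ U) < t)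
    (j : ℕ) (R : Submodule K V) (hR : dm R + j = m) :
    ({F ∈ 𝓐 | R ≤ F}.ncard : ℝ) ≤
      theta (Nat.card K) (k - t) ^ j * cnt (Nat.card K) (Module.finrank K V) k m := by
  have := finite_submodule K V
  have hθ := one_le_theta (Nat.card K) (k - t)
  have hc := one_le_cnt (Nat.card K) hmk hkn
  induction j generalizing R with
  | zero =>
    rw [pow_zero, one_mul, ← hR, add_zero]
    exact ncard_above_le (fun F hF => hk F (h𝓐 hF)) hkn R
  | succ j ih =>
    have hpow : 1 ≤ theta (Nat.card K) (k - t) ^ j := one_le_pow₀ hθ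
    by_cases hne : ∃ F ∈ 𝓐, R ≤ F
    · obtain ⟨U, hU, hRU⟩ := hnc R (by omega) hne
      refine (ncard_above_le_one_add_mul hk halm h𝓐 htk hU hRU
        (fun C _ hC => ih C (by omega))).trans ?_
      -- As the bound for the next level is at least `1`, the exceptional member is absorbed: `1 +
      -- [k-t+1] b ≤ theta * b`.
      have : 1 ≤ theta (Nat.card K) (k - t) ^ j * cnt (Nat.card K) (Module.finrank K V) k m :=
        one_le_mul_of_one_le_of_one_le hpow hc
      rw [pow_succ, mul_right_comm]
      nth_rewrite 3 [theta]
      linarith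
    · have : {F ∈ 𝓐 | R ≤ F} = ∅ := by
        ext F
        simp only [Set.mem_ofPred_eq, Set.mem_empty_iff_false, iff_false]
        exact fun h => hne ⟨F, h⟩
      rw [this, Set.ncard_empty, Nat.cast_zero]
      positivity

lemma ncard_le_gb_mul {𝓐 : Set (Submodule K V)} {S : Submodule K V} {t : ℕ} {b : ℝ}
    (hS : t ≤ dm S) (h𝓐 : ∀ F ∈ 𝓐, t ≤ dm (F ⊓ S))
    (hb : ∀ T, T ≤ S → dm T = t → ({F ∈ 𝓐 | T ≤ F}.ncard : ℝ) ≤ b) :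
    (𝓐.ncard : ℝ) ≤ gb (Nat.card K) (dm S) t * b := by
  have := finite_submodule K V
  have h0 : dm (⊥ : Submodule K V) = 0 := finrank_bot K V
  have h1 := ncard_betw (bot_le : ⊥ ≤ S) (m := t) (by rw [h0]; omega) hS
  rw [h0, Nat.sub_zero, Nat.sub_zero] at h1
  rw [← h1]
  refine ncard_le_mul_of_cover 𝓐 (betw ⊥ S t) (fun T F => T ≤ F) (fun F hF => ?_)
    (fun T hT => hb T hT.2.1 hT.2.2)
  obtain ⟨T, _, hT, hTt⟩ := exists_between_of_dm (bot_le : ⊥ ≤ F ⊓ S) (m := t)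
    (by rw [h0]; omega) (h𝓐 F hF)
  exact ⟨T, ⟨bot_le, hT.trans inf_le_right, hTt⟩, hT.trans inf_le_left⟩

/-- A lower bound for the star part of the family `𝓗(U₁, U₂, E)`. -/
theorem le_ncard_star {k t : ℕ} (htk : t ≤ k) (hkn : k ≤ Module.finrank K V)
    {E U : Submodule K V} (hE : dm E = t) (hU : dm U = k) (hEU : dm (E ⊓ U) + 1 = t) :
    (qInt (Nat.card K) (k - t + 1) : ℝ) * cnt (Nat.card K) (Module.finrank K V) k (t + 1) ≤
      {F ∈ subspaces K V k | E ≤ F ∧ t ≤ dm (F ⊓ U)}.ncard +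
      (qInt (Nat.card K) (k - t + 1) : ℝ) * (qInt (Nat.card K) (k - t + 1) - 1) / 2 *
        cnt (Nat.card K) (Module.finrank K V) k (t + 2) := by
  classical
  have := finite_submodule K V
  have := Fintype.ofFinite (Submodule K V)
  have hsup := dm_sup_add_inf E U
  -- `E ⊔ U` has dimension `k + 1`, so a `(t+1)`-space between `E` and `E ⊔ U` meets `U` in
  -- dimension at least `t`, and everything above it belongs to the star.
  have hcard : (pts E (E ⊔ U)).toFinset.card = qInt (Nat.card K) (k - t + 1) := by
    rw [← Set.ncard_eq_toFinset_card', ncard_pts le_sup_left]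
    congr 1; omega
  have key := bonferroni (pts E (E ⊔ U)).toFinset
    (fun C => {F : Submodule K V | C ≤ F ∧ dm F = k}.toFinset)
    (b := cnt (Nat.card K) (Module.finrank K V) k (t + 1))
    (c := cnt (Nat.card K) (Module.finrank K V) k (t + 2)) ?_ ?_
  · rw [hcard] at key
    refine key.trans (add_le_add_left ?_ _)
    rw [Set.ncard_eq_toFinset_card']
    refine Nat.cast_le.2 (Finset.card_le_card fun F hF => ?_)
    simp only [Finset.mem_biUnion, Set.mem_toFinset] at hF
    obtain ⟨C, ⟨hEC, hCU, hC⟩, hCF, hF⟩ := hF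
    rw [Set.mem_toFinset]
    refine ⟨mem_subspaces.2 hF, hEC.trans hCF, ?_⟩
    have h1 := dm_sup_add_inf C U
    have h2 : dm (C ⊔ U) ≤ dm (E ⊔ U) := dm_mono (sup_le hCU le_sup_right)
    have h3 : dm (C ⊓ U) ≤ dm (F ⊓ U) := dm_mono (inf_le_inf_right U hCF)
    omega
  · intro C hC
    rw [Set.mem_toFinset] at hC
    rw [← Set.ncard_eq_toFinset_card', ncard_above C hkn, hC.2.2, hE]
  · intro C hC C' hC' hne
    rw [Set.mem_toFinset] at hC hC'
    have hdm : t + 2 ≤ dm (C ⊔ C') := by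
      have : C < C ⊔ C' := by
        refine lt_of_le_of_ne le_sup_left fun h => hne ?_
        exact (eq_of_le_of_dm_le (h ▸ le_sup_right : C' ≤ C) (by rw [hC.2.2, hC'.2.2])).symm
      have := dm_lt_of_lt this
      have := hC.2.2
      omega
    obtain ⟨Q, _, hQ, hQd⟩ := exists_between_of_dm (bot_le : ⊥ ≤ C ⊔ C') (m := t + 2)
      (by rw [dm, finrank_bot]; omega) hdm
    rw [← hQd, ← ncard_above Q hkn, Set.ncard_eq_toFinset_card']
    refine Nat.cast_le.2 (Finset.card_le_card fun F hF => ?_)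
    simp only [Finset.mem_inter, Set.mem_toFinset] at hF ⊢
    exact ⟨hQ.trans (sup_le hF.1.1 hF.2.1), hF.1.2⟩

end Families

/-! ### Existence, admissibility and size of the families `familyH`. -/

section Star

variable {K V : Type*} [Field K] [AddCommGroup V] [Module K V] [FiniteDimensional K V]

/-- All members except `U₂` contain `E`, and all except `U₁` reach `t` with `U₂`. Hence `{U₁, U₂}`
is the only pair below the threshold. -/
lemma familyH_isProperAlmost {k t : ℕ} (ht : 1 ≤ t) {U₁ U₂ E : Submodule K V}
    (hU₁ : dm U₁ = k) (hU₂ : dm U₂ = k) (hE : dm E = t) (hEU : E ≤ U₁) (hWE : U₁ ⊓ U₂ ≤ E)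
    (hW : dm (U₁ ⊓ U₂) = t - 1) : IsProperAlmost k t (familyH k t U₁ U₂ E) := by
  have htk : t ≤ k := hE ▸ hU₁ ▸ dm_mono hEU
  have hmeet : ∀ F ∈ familyH k t U₁ U₂ E, F ≠ U₂ → E ≤ F := by
    rintro F (⟨_, hF, _⟩ | hF) hne
    · exact hF
    · rcases hF with rfl | hF
      · exact hEU
      · exact absurd hF hne
  have hmeet' : ∀ F ∈ familyH k t U₁ U₂ E, F ≠ U₁ → t ≤ dm (F ⊓ U₂) := by
    rintro F (⟨_, _, hF⟩ | hF) hne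
    · exact hF
    · rcases hF with hF | rfl
      · exact absurd hF hne
      · rw [inf_idem, hU₂]; exact htk
  have hbad : ∀ F ∈ familyH k t U₁ U₂ E, ∀ F' ∈ familyH k t U₁ U₂ E, dm (F ⊓ F') < t →
      (F = U₁ ∧ F' = U₂) ∨ (F = U₂ ∧ F' = U₁) := by
    intro F hF F' hF' hlt
    by_cases h2 : F = U₂
    · by_cases h1 : F' = U₁
      · exact Or.inr ⟨h2, h1⟩
      · have := hmeet' F' hF' h1
        rw [h2, inf_comm] at hlt
        omega
    · by_cases h2' : F' = U₂
      · by_cases h1 : F = U₁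
        · exact Or.inl ⟨h1, h2'⟩
        · have := hmeet' F hF h1
          rw [h2'] at hlt
          omega
      · have := dm_mono (le_inf (hmeet F hF h2) (hmeet F' hF' h2'))
        omega
  have hne : U₁ ≠ U₂ := by
    rintro rfl
    rw [inf_idem] at hW
    omega
  refine ⟨?_, ?_, ?_⟩
  · rintro F (⟨hF, _⟩ | hF)
    · exact hF
    · rcases hF with rfl | rfl
      · exact mem_subspaces.2 hU₁
      · exact mem_subspaces.2 hU₂
  · rintro F hF A ⟨hA, hA'⟩ B ⟨hB, hB'⟩
    rcases hbad F hF A hA hA' with ⟨h1, h2⟩ | ⟨h1, h2⟩ <;>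
    rcases hbad F hF B hB hB' with ⟨h3, h4⟩ | ⟨h3, h4⟩
    · rw [h2, h4]
    · exact absurd (h1.symm.trans h3) hne
    · exact absurd (h3.symm.trans h1) hne
    · rw [h2, h4]
  · intro h
    have : t ≤ dm (U₁ ⊓ U₂) := h U₁ (Or.inr (Or.inl rfl)) U₂ (Or.inr (Or.inr rfl))
    rw [hW] at this
    omega

/-- The bound on the dimension of `V` is exactly the room needed for `U₁ ⊔ U₂`, of dimension `2k - t
+ 1`. The second space is `W ⊔ B`, with `W` inside `U₁` and `B` inside a complement of `U₁`. -/
lemma exists_familyH_triple {k t : ℕ} (ht : 1 ≤ t) (htk : t ≤ k)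
    (hn : 2 * k + 1 ≤ Module.finrank K V + t) :
    ∃ U₁ U₂ E : Submodule K V, dm U₁ = k ∧ dm U₂ = k ∧ dm E = t ∧ E ≤ U₁ ∧ U₁ ⊓ U₂ ≤ E ∧
      dm (U₁ ⊓ U₂) = t - 1 := by
  have hbot : dm (⊥ : Submodule K V) = 0 := finrank_bot K V
  have htop : dm (⊤ : Submodule K V) = Module.finrank K V := finrank_top K V
  obtain ⟨U₁, _, _, hU₁⟩ := exists_between_of_dm (bot_le : (⊥ : Submodule K V) ≤ ⊤) (m := k)
    (by omega) (by omega)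
  obtain ⟨W, _, hWU, hW⟩ := exists_between_of_dm (bot_le : ⊥ ≤ U₁) (m := t - 1)
    (by omega) (by omega)
  obtain ⟨E, hWE, hEU, hE⟩ := exists_between_of_dm hWU (m := t) (by omega) (by omega)
  obtain ⟨P, hP⟩ := exists_isCompl U₁
  have hPd := dm_sup_add_inf U₁ P
  rw [hP.sup_eq_top, hP.inf_eq_bot, hbot, htop] at hPd
  obtain ⟨B, _, hBP, hB⟩ := exists_between_of_dm (bot_le : ⊥ ≤ P) (m := k - t + 1)
    (by omega) (by omega)
  have hUB : U₁ ⊓ B = ⊥ := le_bot_iff.1 (hP.inf_eq_bot ▸ inf_le_inf_left U₁ hBP)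
  have hinf : U₁ ⊓ (W ⊔ B) = W := by
    rw [inf_comm, sup_inf_assoc_of_le B hWU, inf_comm, hUB, sup_bot_eq]
  have hWB := dm_sup_add_inf W B
  have hWB' : W ⊓ B = ⊥ := le_bot_iff.1 (hUB ▸ inf_le_inf_right B hWU)
  rw [hWB', hbot] at hWB
  refine ⟨U₁, W ⊔ B, E, hU₁, by omega, hE, hEU, ?_, ?_⟩
  · rw [hinf]; exact hWE
  · rw [hinf]; exact hW

lemma ncard_familyH [Finite K] {k t : ℕ} {U₁ U₂ E : Submodule K V} (hE : dm E = t)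
    (hEU : E ≤ U₁) (hlt : dm (U₁ ⊓ U₂) < t) :
    (familyH k t U₁ U₂ E).ncard =
      {F ∈ subspaces K V k | E ≤ F ∧ t ≤ dm (F ⊓ U₂)}.ncard + 2 := by
  have := finite_submodule K V
  have hne : U₁ ≠ U₂ := by
    rintro rfl
    rw [inf_idem] at hlt
    have := dm_mono hEU
    omega
  rw [familyH, Set.ncard_union_eq, Set.ncard_pair hne]
  rw [Set.disjoint_right]
  rintro F (rfl | rfl) ⟨_, h1, h2⟩
  · exact absurd h2 (not_le.2 hlt)
  · have := dm_mono (le_inf hEU h1)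
    omega

end Star

/-! ### Pairs of members below the threshold. -/

/-- `U₁` and `U₂` are two members, meeting in dimension less than `t`, of the almost
`t`-intersecting family `𝓕` of `k`-subspaces. -/
structure IsBadPair {K V : Type*} [Field K] [AddCommGroup V] [Module K V] (k t : ℕ)
    (𝓕 : Set (Submodule K V)) (U₁ U₂ : Submodule K V) : Prop where
  dm_eq : ∀ F ∈ 𝓕, dm F = k
  almost : IsAlmostTIntersecting t 𝓕
  left_mem : U₁ ∈ 𝓕
  right_mem : U₂ ∈ 𝓕
  lt : dm (U₁ ⊓ U₂) < t

section Pair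

variable {K V : Type*} [Field K] [AddCommGroup V] [Module K V] {k t : ℕ}
  {𝓕 : Set (Submodule K V)} {U₁ U₂ : Submodule K V}

lemma IsProperAlmost.exists_isBadPair (h : IsProperAlmost k t 𝓕) :
    ∃ U₁ U₂, IsBadPair k t 𝓕 U₁ U₂ := by
  obtain ⟨h1, h2, h3⟩ := h
  simp only [IsTIntersecting, not_forall, not_le] at h3
  obtain ⟨U₁, hU₁, U₂, hU₂, hlt⟩ := h3
  exact ⟨U₁, U₂, fun F hF => mem_subspaces.1 (h1 hF), h2, hU₁, hU₂, hlt⟩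

namespace IsBadPair

lemma symm (h : IsBadPair k t 𝓕 U₁ U₂) : IsBadPair k t 𝓕 U₂ U₁ :=
  ⟨h.dm_eq, h.almost, h.right_mem, h.left_mem, by rw [inf_comm]; exact h.lt⟩

/-- `U₁` already uses up the one exception allowed to `U₂`. -/
lemma le_dm_inf_right (h : IsBadPair k t 𝓕 U₁ U₂) {F : Submodule K V} (hF : F ∈ 𝓕) (hne : F ≠ U₁) :
    t ≤ dm (F ⊓ U₂) := by
  by_contra hlt
  rw [inf_comm] at hlt
  refine hne (h.almost U₂ h.right_mem ⟨hF, not_le.1 hlt⟩ ⟨h.left_mem, ?_⟩)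
  rw [inf_comm]; exact h.lt

lemma le_dm_inf_left (h : IsBadPair k t 𝓕 U₁ U₂) {F : Submodule K V} (hF : F ∈ 𝓕) (hne : F ≠ U₂) :
    t ≤ dm (F ⊓ U₁) := h.symm.le_dm_inf_right hF hne

lemma dm_left (h : IsBadPair k t 𝓕 U₁ U₂) : dm U₁ = k := h.dm_eq _ h.left_mem

lemma dm_right (h : IsBadPair k t 𝓕 U₁ U₂) : dm U₂ = k := h.dm_eq _ h.right_mem

variable [FiniteDimensional K V]

lemma dm_inf_of_star (h : IsBadPair k t 𝓕 U₁ U₂) {E : Submodule K V} (hEU : E ≤ U₁)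
    (hEU₂ : dm (E ⊓ U₂) + 1 = t) : U₁ ⊓ U₂ = E ⊓ U₂ := by
  have := h.lt
  exact (eq_of_le_of_dm_le (inf_le_inf_right U₂ hEU) (by omega)).symm

/-- A maximum family all of whose members outside the pair contain a common `t`-space `E` inside
`U₁` that nearly meets `U₂` is of the form `𝓗(U₁, U₂, E)`. -/
theorem eq_familyH [Finite K] (h : IsBadPair k t 𝓕 U₁ U₂)
    (hmax : IsMaximumProperAlmost k t 𝓕) {E : Submodule K V} (hE : dm E = t) (hEU : E ≤ U₁)
    (hEU₂ : dm (E ⊓ U₂) + 1 = t) (hstar : ∀ F ∈ 𝓕, F ≠ U₁ → F ≠ U₂ → E ≤ F) :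
    U₁ ⊓ U₂ ∈ subspacesOf E (t - 1) ∧ 𝓕 = familyH k t U₁ U₂ E := by
  have := finite_submodule K V
  have hW := h.dm_inf_of_star hEU hEU₂
  have hWE : U₁ ⊓ U₂ ≤ E := hW ▸ inf_le_left
  have hWd : dm (U₁ ⊓ U₂) = t - 1 := by rw [hW]; omega
  refine ⟨⟨hWE, hWd⟩, ?_⟩
  refine Set.eq_of_subset_of_ncard_le ?_ (hmax.2 _ (familyH_isProperAlmost (by omega) h.dm_left
    h.dm_right hE hEU hWE hWd)) (Set.toFinite _)
  intro F hF
  by_cases h1 : F = U₁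
  · exact Or.inr (Or.inl h1)
  by_cases h2 : F = U₂
  · exact Or.inr (Or.inr h2)
  exact Or.inl ⟨mem_subspaces.2 (h.dm_eq F hF), hstar F hF h1 h2, h.le_dm_inf_right hF h1⟩

end IsBadPair

end Pair

/-! ### The grid of `(t+1)`-spaces that reach `t` with both `U₁` and `U₂`. -/

section Geometry

variable {K V : Type*} [Field K] [AddCommGroup V] [Module K V] [FiniteDimensional K V]
  {t : ℕ} {U₁ U₂ R R' : Submodule K V}

/-- A `(t+1)`-space that meets two spaces `U₁`, `U₂` in dimension at least `t`, where `U₁ ⊓ U₂` has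
dimension less than `t`, contains `U₁ ⊓ U₂` and is spanned by its intersections with them. -/
lemma structure_of_cover (hlt : dm (U₁ ⊓ U₂) < t) (hR : dm R = t + 1) (h1 : t ≤ dm (R ⊓ U₁))
    (h2 : t ≤ dm (R ⊓ U₂)) :
    U₁ ⊓ U₂ ≤ R ∧ dm (U₁ ⊓ U₂) + 1 = t ∧ dm (R ⊓ U₁) = t ∧ dm (R ⊓ U₂) = t ∧
      (R ⊓ U₁) ⊔ (R ⊓ U₂) = R := by
  have h3 := dm_sup_add_inf (R ⊓ U₁) (R ⊓ U₂)
  have hle : (R ⊓ U₁) ⊔ (R ⊓ U₂) ≤ R := sup_le inf_le_left inf_le_left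
  have h4 := dm_mono hle
  have h5 : (R ⊓ U₁) ⊓ (R ⊓ U₂) ≤ U₁ ⊓ U₂ := inf_le_inf inf_le_right inf_le_right
  have h6 := dm_mono h5
  have h7 : (R ⊓ U₁) ⊓ (R ⊓ U₂) = U₁ ⊓ U₂ := eq_of_le_of_dm_le h5 (by omega)
  refine ⟨h7 ▸ inf_le_left.trans inf_le_left, by omega, by omega, by omega, ?_⟩
  exact eq_of_le_of_dm_le hle (by omega)

/-- If both traces differed, `R ⊔ R'` would contain two spaces of dimension at least `t + 1`, one in
`U₁` and one in `U₂`, which meet in dimension at most `t - 1`. Its dimension would then be at least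
`t + 3`, whereas `t ≤ dm (R ⊓ R')` allows only `t + 2`. -/
lemma inf_eq_or_inf_eq_of_cover (hlt : dm (U₁ ⊓ U₂) < t) (hR : dm R = t + 1)
    (hR' : dm R' = t + 1) (h1 : t ≤ dm (R ⊓ U₁)) (h2 : t ≤ dm (R ⊓ U₂)) (h1' : t ≤ dm (R' ⊓ U₁))
    (h2' : t ≤ dm (R' ⊓ U₂)) (hRR' : t ≤ dm (R ⊓ R')) :
    R ⊓ U₁ = R' ⊓ U₁ ∨ R ⊓ U₂ = R' ⊓ U₂ := by
  obtain ⟨_, hW, hA, hB, _⟩ := structure_of_cover hlt hR h1 h2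
  obtain ⟨_, _, hA', hB', _⟩ := structure_of_cover hlt hR' h1' h2'
  by_contra! hne
  have aux : ∀ {X Y : Submodule K V}, dm X = t → dm Y = t → X ≠ Y → t + 1 ≤ dm (X ⊔ Y) := by
    intro X Y hX hY hXY
    have : X < X ⊔ Y := lt_of_le_of_ne le_sup_left fun h =>
      hXY (eq_of_le_of_dm_le (h ▸ le_sup_right : Y ≤ X) (by omega)).symm
    have := dm_lt_of_lt this
    omega
  have h3 := aux hA hA' hne.1
  have h4 := aux hB hB' hne.2
  have h5 := dm_sup_add_inf (R ⊓ U₁ ⊔ R' ⊓ U₁) (R ⊓ U₂ ⊔ R' ⊓ U₂)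
  have h6 : dm ((R ⊓ U₁ ⊔ R' ⊓ U₁) ⊓ (R ⊓ U₂ ⊔ R' ⊓ U₂)) ≤ dm (U₁ ⊓ U₂) :=
    dm_mono (inf_le_inf (sup_le inf_le_right inf_le_right) (sup_le inf_le_right inf_le_right))
  have h7 : dm ((R ⊓ U₁ ⊔ R' ⊓ U₁) ⊔ (R ⊓ U₂ ⊔ R' ⊓ U₂)) ≤ dm (R ⊔ R') :=
    dm_mono (sup_le (sup_le_sup inf_le_left inf_le_left) (sup_le_sup inf_le_left inf_le_left))
  have h8 := dm_sup_add_inf R R'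
  omega

/-- A set of cells in a grid, any two of which share a row or a column, lies in one row or in one
column. -/
lemma forall_eq_or_forall_eq {α β γ : Type*} {s : Set α} {f : α → β} {g : α → γ}
    (h : ∀ a ∈ s, ∀ b ∈ s, f a = f b ∨ g a = g b) :
    (∀ a ∈ s, ∀ b ∈ s, f a = f b) ∨ (∀ a ∈ s, ∀ b ∈ s, g a = g b) := by
  by_contra! hcon
  obtain ⟨⟨a, ha, b, hb, hab⟩, c, hc, e, he, hce⟩ := hcon
  have h1 := h a ha b hb
  have h2 := h c hc e he
  have h3 := h a ha c hc
  have h4 := h b hb c hc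
  have h5 := h a ha e he
  have h6 := h b hb e he
  grind

/-- The `(t+1)`-spaces over `E` that cover both `U₂` and a space `F` not containing `E`. -/
lemma ncard_covers_le [Finite K] {k : ℕ} {E F : Submodule K V} {𝓡 : Set (Submodule K V)}
    (hE : dm E = t) (hEU : E ≤ U₁) (hWE : U₁ ⊓ U₂ ≤ E) (hEU₂ : dm (E ⊓ U₂) + 1 = t)
    (hU₂ : dm U₂ = k) (hF : dm F = k) (hEF : ¬ E ≤ F) (hFU : t ≤ dm (F ⊓ U₁))
    (h𝓡 : ∀ R ∈ 𝓡, dm R = t + 1 ∧ E ≤ R ∧ t ≤ dm (R ⊓ U₂) ∧ t ≤ dm (R ⊓ F)) :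
    𝓡.ncard ≤ qInt (Nat.card K) (k - t) := by
  have := finite_submodule K V
  rcases 𝓡.eq_empty_or_nonempty with rfl | ⟨R₀, hR₀⟩
  · simp
  have aux : ∀ R ∈ 𝓡, ∀ U : Submodule K V, dm (E ⊓ U) < t → t ≤ dm (R ⊓ U) → R ≤ E ⊔ U := by
    intro R hR U hEU hRU
    obtain ⟨h1, h2, _⟩ := h𝓡 R hR
    have h3 := inf_sup_dm_of_le h2 U
    have h4 : R ⊓ (E ⊔ U) = R := eq_of_le_of_dm_le inf_le_left (by omega)
    exact inf_eq_left.1 h4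
  have hEF' : dm (E ⊓ F) < t := by
    rw [← hE]
    exact dm_lt_of_lt (lt_of_le_of_ne inf_le_left fun h => hEF (inf_eq_left.1 h))
  have hEF1 : dm (E ⊓ F) + 1 = t := by
    obtain ⟨h1, h2, _, h4⟩ := h𝓡 R₀ hR₀
    have h5 := inf_sup_dm_of_le h2 F
    have h6 : dm (R₀ ⊓ (E ⊔ F)) ≤ dm R₀ := dm_mono inf_le_left
    omega
  have hs1 := dm_sup_add_inf E U₂
  have hs2 := dm_sup_add_inf E F
  have hle : E ≤ (E ⊔ U₂) ⊓ (E ⊔ F) := le_inf le_sup_left le_sup_left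
  -- Both joins have dimension `k + 1`. If they coincided, the modular law would put `F ⊓ U₁` inside
  -- `E`, hence equal to `E`, against `¬ E ≤ F`. This lost dimension turns `[k-t+1]` into `[k-t]`.
  have hd : dm ((E ⊔ U₂) ⊓ (E ⊔ F)) ≤ k := by
    by_contra hcon
    have h1 : (E ⊔ U₂) ⊓ (E ⊔ F) = E ⊔ U₂ := eq_of_le_of_dm_le inf_le_left (by omega)
    have h2 : (E ⊔ U₂) ⊓ (E ⊔ F) = E ⊔ F := eq_of_le_of_dm_le inf_le_right (by omega)
    have h3 : F ≤ E ⊔ U₂ := by rw [← h1, h2]; exact le_sup_right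
    have h4 : F ⊓ U₁ ≤ E := by
      have : (E ⊔ U₂) ⊓ U₁ ≤ E := by
        rw [sup_inf_assoc_of_le U₂ hEU, inf_comm]
        exact sup_le le_rfl hWE
      exact (inf_le_inf_right U₁ h3).trans this
    have h5 : F ⊓ U₁ = E := eq_of_le_of_dm_le h4 (by omega)
    exact hEF (h5 ▸ inf_le_left)
  calc 𝓡.ncard ≤ (pts E ((E ⊔ U₂) ⊓ (E ⊔ F))).ncard := by
        refine Set.ncard_le_ncard (fun R hR => ?_) (Set.toFinite _)
        obtain ⟨h1, h2, h3, h4⟩ := h𝓡 R hR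
        exact ⟨h2, le_inf (aux R hR U₂ (by omega) h3) (aux R hR F hEF' h4), by omega⟩
    _ = qInt (Nat.card K) (dm ((E ⊔ U₂) ⊓ (E ⊔ F)) - dm E) := ncard_pts hle
    _ ≤ _ := qInt_mono _ (by omega)

end Geometry

/-! ### Quasi-covers and the bounds obtained from one of minimal dimension. -/

section Covers

variable {K V : Type*} [Field K] [AddCommGroup V] [Module K V] {k t : ℕ}
  {𝓕 : Set (Submodule K V)} {U₁ U₂ : Submodule K V}

/-- `S` meets `U₁`, `U₂` and all but at most one member of `𝓕` in dimension at least `t`. -/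
def IsQuasiCover (t : ℕ) (𝓕 : Set (Submodule K V)) (U₁ U₂ S : Submodule K V) : Prop :=
  t ≤ dm (S ⊓ U₁) ∧ t ≤ dm (S ⊓ U₂) ∧ {F ∈ 𝓕 | ¬ t ≤ dm (F ⊓ S)}.ncard ≤ 1

namespace IsBadPair

lemma isQuasiCover_of_cover (h : IsBadPair k t 𝓕 U₁ U₂) {S : Submodule K V}
    (hS : ∀ F ∈ 𝓕, t ≤ dm (S ⊓ F)) : IsQuasiCover t 𝓕 U₁ U₂ S := by
  refine ⟨hS _ h.left_mem, hS _ h.right_mem, ?_⟩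
  have : {F ∈ 𝓕 | ¬ t ≤ dm (F ⊓ S)} = ∅ := by
    ext F
    simp only [Set.mem_ofPred_eq, Set.mem_empty_iff_false, iff_false, not_and, not_not]
    intro hF
    rw [inf_comm]
    exact hS F hF
  rw [this, Set.ncard_empty]
  exact zero_le_one

lemma exists_dm_inf_lt (h : IsBadPair k t 𝓕 U₁ U₂) {Q : Submodule K V}
    (hQ : ¬ IsQuasiCover t 𝓕 U₁ U₂ Q) : ∃ U ∈ 𝓕, dm (Q ⊓ U) < t := by
  by_contra! hcon
  exact hQ (h.isQuasiCover_of_cover hcon)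

variable [FiniteDimensional K V]

lemma succ_le_dm_of_isQuasiCover (h : IsBadPair k t 𝓕 U₁ U₂) {S : Submodule K V}
    (hS : IsQuasiCover t 𝓕 U₁ U₂ S) : t + 1 ≤ dm S := by
  by_contra hcon
  have h0 := h.lt
  have h1 : S ⊓ U₁ = S := eq_of_le_of_dm_le inf_le_left (by have := hS.1; omega)
  have h2 : S ⊓ U₂ = S := eq_of_le_of_dm_le inf_le_left (by have := hS.2.1; omega)
  have h3 : S ≤ U₁ ⊓ U₂ := le_inf (inf_eq_left.1 h1) (inf_eq_left.1 h2)
  have h4 := dm_mono h3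
  have h5 : dm (S ⊓ U₁) ≤ dm S := dm_mono inf_le_left
  have := hS.1
  omega

variable [Finite K]

/-- This is the reason for allowing one exception in `IsQuasiCover`: members of the family then
qualify, so the minimal dimension is at most `k`. -/
lemma isQuasiCover_of_mem (h : IsBadPair k t 𝓕 U₁ U₂) {F : Submodule K V} (hF : F ∈ 𝓕)
    (h1 : F ≠ U₁) (h2 : F ≠ U₂) : IsQuasiCover t 𝓕 U₁ U₂ F :=
  ⟨h.le_dm_inf_left hF h2, h.le_dm_inf_right hF h1,
    ncard_exceptional_le_one h.almost subset_rfl hF⟩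

lemma ncard_le_add_one {S : Submodule K V} (hexc : {F ∈ 𝓕 | ¬ t ≤ dm (F ⊓ S)}.ncard ≤ 1) :
    (𝓕.ncard : ℝ) ≤ 1 + {F ∈ 𝓕 | t ≤ dm (F ⊓ S)}.ncard := by
  have := finite_submodule K V
  have h1 := ncard_le_add_of_imp 𝓕 (fun F => t ≤ dm (F ⊓ S))
  have h2 : 𝓕.ncard ≤ 1 + {F ∈ 𝓕 | t ≤ dm (F ⊓ S)}.ncard := by omega
  exact_mod_cast h2

/-- Each non-exceptional member contains a `t`-subspace of `S`, and each such `t`-space branches `m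
- t` times. -/
theorem ncard_le_of_minimal_cover (h : IsBadPair k t 𝓕 U₁ U₂) {m : ℕ} (htm : t ≤ m) (hmk : m ≤ k)
    (hkn : k ≤ Module.finrank K V) {S : Submodule K V} (hS : dm S = m)
    (hexc : {F ∈ 𝓕 | ¬ t ≤ dm (F ⊓ S)}.ncard ≤ 1)
    (hnc : ∀ Q, dm Q < m → ∃ U ∈ 𝓕, dm (Q ⊓ U) < t) :
    (𝓕.ncard : ℝ) ≤ 1 + gb (Nat.card K) m t * (theta (Nat.card K) (k - t) ^ (m - t) *
      cnt (Nat.card K) (Module.finrank K V) k m) := by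
  have := finite_submodule K V
  refine (ncard_le_add_one hexc).trans (add_le_add_right ?_ 1)
  rw [← hS]
  refine ncard_le_gb_mul (by omega) (fun F hF => hF.2) (fun T _ hT => ?_)
  rw [hS]
  exact ncard_above_le_pow h.dm_eq h.almost (fun F hF => hF.1) (by omega) hmk hkn
    (fun Q hQ _ => hnc Q hQ) (m - t) T (by omega)

/-- Members above a `(t+1)`-space that is not a cover. -/
lemma ncard_above_le_of_not_cover (h : IsBadPair k t 𝓕 U₁ U₂) (hk : t + 2 ≤ k)
    (hkn : k ≤ Module.finrank K V) {R U : Submodule K V} (hR : dm R = t + 1) (hU : U ∈ 𝓕)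
    (hRU : dm (R ⊓ U) < t) :
    ({F ∈ 𝓕 | R ≤ F}.ncard : ℝ) ≤
      theta (Nat.card K) (k - t) * cnt (Nat.card K) (Module.finrank K V) k (t + 2) := by
  refine (ncard_above_le_one_add_mul h.dm_eq h.almost subset_rfl (by omega) hU hRU
    (b := cnt (Nat.card K) (Module.finrank K V) k (t + 2)) (fun C _ hC => ?_)).trans ?_
  · have := ncard_above_le h.dm_eq hkn C
    rwa [hC, hR] at this
  · have := one_le_cnt (Nat.card K) hk hkn
    rw [theta]
    linarith

/-- The case where some `(t+1)`-space is a quasi-cover and the family is not a star. -/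
theorem ncard_le_of_cover_succ (h : IsBadPair k t 𝓕 U₁ U₂) (hk : t + 2 ≤ k)
    (hkn : k ≤ Module.finrank K V) {S : Submodule K V} (hS : dm S = t + 1)
    (hexc : {F ∈ 𝓕 | ¬ t ≤ dm (F ⊓ S)}.ncard ≤ 1)
    (h1 : ∀ E, E ≤ U₁ → dm E = t → ∃ F ∈ 𝓕, F ≠ U₁ ∧ F ≠ U₂ ∧ ¬ E ≤ F)
    (h2 : ∀ E, E ≤ U₂ → dm E = t → ∃ F ∈ 𝓕, F ≠ U₁ ∧ F ≠ U₂ ∧ ¬ E ≤ F) :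
    (𝓕.ncard : ℝ) ≤ 1 + qInt (Nat.card K) (k - t) *
        cnt (Nat.card K) (Module.finrank K V) k (t + 1) +
      qInt (Nat.card K) (t + 1) * (theta (Nat.card K) (k - t) ^ 2 *
        cnt (Nat.card K) (Module.finrank K V) k (t + 2)) := by
  have := finite_submodule K V
  set q := Nat.card K
  set n := Module.finrank K V
  set D' := cnt q n k (t + 2) with hD'
  set θ := theta q (k - t) with hθ
  have hD'1 : 1 ≤ D' := one_le_cnt q hk hkn
  have hθ1 : 1 ≤ θ := one_le_theta _ _
  -- `𝓡` collects the heavy `(t+1)`-spaces. A space that fails to reach `t` with some member can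
  -- branch and has at most `θ * D'` members above it, so heavy spaces reach `t` with every member.
  set 𝓡 : Set (Submodule K V) := {R | dm R = t + 1 ∧ θ * D' < {F ∈ 𝓕 | R ≤ F}.ncard} with h𝓡
  have hcov : ∀ R ∈ 𝓡, ∀ F ∈ 𝓕, t ≤ dm (R ⊓ F) := by
    intro R hR F hF
    by_contra! hcon
    exact absurd (h.ncard_above_le_of_not_cover hk hkn hR.1 hF hcon) (not_le.2 hR.2)
  -- A heavy `R'` can itself be branched along. Having only dimension `t + 1`, it gives the factor
  -- `[2]`, too small for `R` to be heavy.
  have hpair : ∀ R ∈ 𝓡, ∀ R' ∈ 𝓡, t ≤ dm (R ⊓ R') := by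
    intro R hR R' hR'
    by_contra! hcon
    have h3 := ncard_above_le_mul_of_meets (𝓐 := 𝓕) (b := D') hcon (by rw [hR'.1]; omega)
      (fun F hF _ => by rw [inf_comm]; exact hcov R' hR' F hF)
      (fun C _ _ hC => by
        have := ncard_above_le h.dm_eq hkn C
        rwa [hC, hR.1] at this)
    rw [hR'.1, show t + 1 - t + 1 = 2 by omega] at h3
    have h4 : (qInt q 2 : ℝ) ≤ qInt q (k - t + 1) := by exact_mod_cast qInt_mono q (by omega)
    have h5 := hR.2
    have h6 : (qInt q 2 : ℝ) * D' ≤ θ * D' := by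
      refine mul_le_mul_of_nonneg_right ?_ (by linarith)
      rw [hθ, theta]; linarith
    linarith
  have hcard : 𝓡.ncard ≤ qInt q (k - t) := by
    rcases 𝓡.eq_empty_or_nonempty with he | ⟨R₀, hR₀⟩
    · rw [he]; simp
    have hstr := fun R (hR : R ∈ 𝓡) => structure_of_cover h.lt hR.1 (hcov R hR _ h.left_mem)
      (hcov R hR _ h.right_mem)
    -- Heavy spaces with a common trace on `A` all contain that trace; since the family is not a
    -- star, some member avoids it and `ncard_covers_le` applies.
    have haux : ∀ {A B : Submodule K V}, IsBadPair k t 𝓕 A B →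
        (∀ E, E ≤ A → dm E = t → ∃ F ∈ 𝓕, F ≠ A ∧ F ≠ B ∧ ¬ E ≤ F) →
        (∀ R ∈ 𝓡, ∀ R' ∈ 𝓡, R ⊓ A = R' ⊓ A) → 𝓡.ncard ≤ qInt q (k - t) := by
      intro A B hAB hE heq
      have hs := structure_of_cover hAB.lt hR₀.1 (hcov R₀ hR₀ _ hAB.left_mem)
        (hcov R₀ hR₀ _ hAB.right_mem)
      obtain ⟨F, hF, hFA, hFB, hEF⟩ := hE (R₀ ⊓ A) inf_le_right hs.2.2.1
      have hWE : A ⊓ B ≤ R₀ ⊓ A := le_inf hs.1 inf_le_left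
      have hEB : (R₀ ⊓ A) ⊓ B = A ⊓ B := by
        refine le_antisymm (inf_le_inf_right B inf_le_right) (le_inf hWE inf_le_right)
      refine ncard_covers_le hs.2.2.1 inf_le_right hWE (by rw [hEB]; exact hs.2.1) hAB.dm_right
        (hAB.dm_eq F hF) hEF (hAB.le_dm_inf_left hF hFB) (fun R hR => ?_)
      exact ⟨hR.1, heq R hR R₀ hR₀ ▸ inf_le_left, hcov R hR _ hAB.right_mem, hcov R hR F hF⟩
    rcases forall_eq_or_forall_eq (fun R hR R' hR' => inf_eq_or_inf_eq_of_cover h.lt hR.1 hR'.1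
      (hcov R hR _ h.left_mem) (hcov R hR _ h.right_mem) (hcov R' hR' _ h.left_mem)
      (hcov R' hR' _ h.right_mem) (hpair R hR R' hR')) with heq | heq
    · exact haux h h1 heq
    · refine haux h.symm (fun E hE hEt => ?_) heq
      obtain ⟨F, hF, ha, hb, hc⟩ := h2 E hE hEt
      exact ⟨F, hF, hb, ha, hc⟩
  have hbig : ({F ∈ 𝓕 | ∃ R ∈ 𝓡, R ≤ F}.ncard : ℝ) ≤ qInt q (k - t) * cnt q n k (t + 1) := by
    refine (ncard_le_mul_of_cover {F ∈ 𝓕 | ∃ R ∈ 𝓡, R ≤ F} 𝓡 (fun R F => R ≤ F)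
      (b := cnt q n k (t + 1)) (fun F hF => hF.2) (fun R hR => ?_)).trans ?_
    · have := ncard_above_le (𝓐 := {F ∈ 𝓕 | ∃ R ∈ 𝓡, R ≤ F}) (fun F hF => h.dm_eq F hF.1) hkn R
      rwa [hR.1] at this
    · exact mul_le_mul_of_nonneg_right (by exact_mod_cast hcard) (cnt_nonneg q hkn _)
  set 𝓐 : Set (Submodule K V) := {F ∈ {F ∈ 𝓕 | t ≤ dm (F ⊓ S)} | ¬ ∃ R ∈ 𝓡, R ≤ F} with h𝓐
  have hsmall : (𝓐.ncard : ℝ) ≤ qInt q (t + 1) * (θ ^ 2 * D') := by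
    have h3 := ncard_le_gb_mul (𝓐 := 𝓐) (S := S) (t := t) (b := θ ^ 2 * D') (by omega)
      (fun F hF => hF.1.2) (fun T _ hT => ?_)
    · rwa [hS, gb_symm q t 1, gb_one_right q (by omega)] at h3
    · have hC : ∀ C, T ≤ C → dm C = dm T + 1 → ({F ∈ 𝓐 | C ≤ F}.ncard : ℝ) ≤ θ * D' := by
        intro C _ hC
        by_cases hCR : C ∈ 𝓡
        · have : {F ∈ 𝓐 | C ≤ F} = ∅ := by
            ext F
            simp only [Set.mem_ofPred_eq, Set.mem_empty_iff_false, iff_false, not_and]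
            exact fun hF hCF => hF.2 ⟨C, hCR, hCF⟩
          rw [this, Set.ncard_empty, Nat.cast_zero]
          positivity
        · have h4 : ({F ∈ 𝓕 | C ≤ F}.ncard : ℝ) ≤ θ * D' := by
            by_contra! hcon
            exact hCR ⟨by omega, hcon⟩
          exact le_trans (ncard_le_ncard_real (u := {F ∈ 𝓕 | C ≤ F})
            fun F hF => ⟨hF.1.1.1, hF.2⟩) h4
      obtain ⟨U, hU, hTU⟩ : ∃ U ∈ 𝓕, dm (T ⊓ U) < t := by
        refine h.exists_dm_inf_lt fun hq => ?_
        have := h.succ_le_dm_of_isQuasiCover hq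
        omega
      refine (ncard_above_le_one_add_mul h.dm_eq h.almost (fun F hF => hF.1.1) (by omega) hU hTU
        hC).trans ?_
      have : 1 ≤ θ * D' := one_le_mul_of_one_le_of_one_le hθ1 hD'1
      have h5 : θ ^ 2 * D' = (qInt q (k - t + 1) + 1) * (θ * D') := by
        rw [pow_two, mul_assoc]; rfl
      rw [h5]
      linarith
  have hsplit := ncard_le_add_of_imp {F ∈ 𝓕 | t ≤ dm (F ⊓ S)} (fun F => ∃ R ∈ 𝓡, R ≤ F)
  have hsplit' : ({F ∈ 𝓕 | t ≤ dm (F ⊓ S)}.ncard : ℝ) ≤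
      {F ∈ {F ∈ 𝓕 | t ≤ dm (F ⊓ S)} | ∃ R ∈ 𝓡, R ≤ F}.ncard + 𝓐.ncard := by exact_mod_cast hsplit
  have hsub : ({F ∈ {F ∈ 𝓕 | t ≤ dm (F ⊓ S)} | ∃ R ∈ 𝓡, R ≤ F}.ncard : ℝ) ≤
      {F ∈ 𝓕 | ∃ R ∈ 𝓡, R ≤ F}.ncard := ncard_le_ncard_real fun F hF => ⟨hF.1.1, hF.2⟩
  have := ncard_le_add_one (t := t) (𝓕 := 𝓕) hexc
  linarith

/-- The case where all quasi-covers of the minimum dimension `t + 2` contain `U₁ ⊓ U₂`. -/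
theorem ncard_le_of_covers_contain (h : IsBadPair k t 𝓕 U₁ U₂) (hk : t + 2 ≤ k)
    (hkn : k ≤ Module.finrank K V) {S : Submodule K V} (hS : dm S = t + 2)
    (hSq : IsQuasiCover t 𝓕 U₁ U₂ S) (hW : dm (U₁ ⊓ U₂) + 1 = t)
    (hnc : ∀ Q, dm Q < t + 2 → ∃ U ∈ 𝓕, dm (Q ⊓ U) < t)
    (hcon : ∀ Q, dm Q = t + 2 → IsQuasiCover t 𝓕 U₁ U₂ Q → U₁ ⊓ U₂ ≤ Q) :
    (𝓕.ncard : ℝ) ≤ 1 + qInt (Nat.card K) 3 * (theta (Nat.card K) (k - t) ^ 2 *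
        cnt (Nat.card K) (Module.finrank K V) k (t + 2)) +
      gb (Nat.card K) (t + 2) 2 * (theta (Nat.card K) (k - t) ^ 3 *
        cnt (Nat.card K) (Module.finrank K V) k (t + 3)) := by
  have := finite_submodule K V
  have hWS := hcon S hS hSq
  have hsplit := ncard_le_add_of_imp {F ∈ 𝓕 | t ≤ dm (F ⊓ S)} (fun F => U₁ ⊓ U₂ ≤ F)
  have hsplit' : ({F ∈ 𝓕 | t ≤ dm (F ⊓ S)}.ncard : ℝ) ≤
      {F ∈ {F ∈ 𝓕 | t ≤ dm (F ⊓ S)} | U₁ ⊓ U₂ ≤ F}.ncard +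
      {F ∈ {F ∈ 𝓕 | t ≤ dm (F ⊓ S)} | ¬ U₁ ⊓ U₂ ≤ F}.ncard := by exact_mod_cast hsplit
  have h1 : ({F ∈ {F ∈ 𝓕 | t ≤ dm (F ⊓ S)} | U₁ ⊓ U₂ ≤ F}.ncard : ℝ) ≤
      qInt (Nat.card K) 3 * (theta (Nat.card K) (k - t) ^ 2 *
        cnt (Nat.card K) (Module.finrank K V) k (t + 2)) := by
    refine ncard_above_le_mul (𝓐 := {F ∈ 𝓕 | t ≤ dm (F ⊓ S)}) hWS (by omega)
      (fun F hF hWF => ?_) (fun T hT => ?_)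
    · obtain ⟨T, hWT, hT, hTt⟩ := exists_between_of_dm (le_inf hWF hWS) (m := t) (by omega) hF.2
      exact ⟨T, ⟨hWT, hT.trans inf_le_right, by omega⟩, hT.trans inf_le_left⟩
    · exact ncard_above_le_pow h.dm_eq h.almost (fun F hF => hF.1) (by omega) hk hkn
        (fun Q hQ _ => hnc Q hQ) 2 T (by have := hT.2.2; omega)
  have h2 : ({F ∈ {F ∈ 𝓕 | t ≤ dm (F ⊓ S)} | ¬ U₁ ⊓ U₂ ≤ F}.ncard : ℝ) ≤
      gb (Nat.card K) (t + 2) 2 * (theta (Nat.card K) (k - t) ^ 3 *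
        cnt (Nat.card K) (Module.finrank K V) k (t + 3)) := by
    -- For `k = t + 2` the members other than `U₁, U₂` are themselves quasi-covers of dimension `t +
    -- 2`, so all members contain `U₁ ⊓ U₂`.
    rcases hk.eq_or_lt with hk2 | hk3
    · have he : {F ∈ {F ∈ 𝓕 | t ≤ dm (F ⊓ S)} | ¬ U₁ ⊓ U₂ ≤ F} = ∅ := by
        ext F
        simp only [Set.mem_ofPred_eq, Set.mem_empty_iff_false, iff_false, not_and, not_not]
        rintro ⟨hF, _⟩
        by_cases h1 : F = U₁
        · rw [h1]; exact inf_le_left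
        by_cases h2 : F = U₂
        · rw [h2]; exact inf_le_right
        exact hcon F (by rw [h.dm_eq F hF, hk2]) (h.isQuasiCover_of_mem hF h1 h2)
      rw [he, Set.ncard_empty, Nat.cast_zero]
      have := cnt_nonneg (Nat.card K) hkn (t + 3)
      have := one_le_theta (Nat.card K) (k - t)
      have := gb_pos (q := Nat.card K) (show 2 ≤ t + 2 by omega)
      positivity
    · have h3 := ncard_le_gb_mul (𝓐 := {F ∈ {F ∈ 𝓕 | t ≤ dm (F ⊓ S)} | ¬ U₁ ⊓ U₂ ≤ F})
        (S := S) (t := t) (b := theta (Nat.card K) (k - t) ^ 3 *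
          cnt (Nat.card K) (Module.finrank K V) k (t + 3)) (by omega)
        (fun F hF => hF.1.2) (fun T _ hT => ?_)
      · rwa [hS, gb_symm] at h3
      -- A `(t+2)`-space below a member not containing `U₁ ⊓ U₂` cannot be a quasi-cover, which
      -- permits the third branching.
      · refine ncard_above_le_pow h.dm_eq h.almost (fun F hF => hF.1.1) (by omega) hk3 hkn
          (fun Q hQ hF => ?_) 3 T (by omega)
        rcases Nat.lt_succ_iff_lt_or_eq.1 hQ with hlt | heq
        · exact hnc Q hlt
        · obtain ⟨F, hF, hQF⟩ := hF
          exact h.exists_dm_inf_lt fun hq => hF.2 ((hcon Q heq hq).trans hQF)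
  have := ncard_le_add_one (t := t) (𝓕 := 𝓕) hSq.2.2
  linarith

end IsBadPair

end Covers

/-! ### Quasi-covers of dimension `t + 2` spanned by their traces on `U₁` and `U₂`. -/

section Transversal

variable {K V : Type*} [Field K] [AddCommGroup V] [Module K V]

/-- `S` is a `(t+2)`-space spanned by two `t`-spaces, its intersections with the `k`-spaces `U₁` and
`U₂`, where `U₁ ⊓ U₂` has dimension less than `t`. -/
structure IsTransversal (k t : ℕ) (U₁ U₂ S : Submodule K V) : Prop where
  dm_left : dm U₁ = k
  dm_right : dm U₂ = k
  lt : dm (U₁ ⊓ U₂) < t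
  dm_eq : dm S = t + 2
  dm_inf_left : dm (S ⊓ U₁) = t
  dm_inf_right : dm (S ⊓ U₂) = t
  dm_inf_inf : dm (S ⊓ (U₁ ⊓ U₂)) + 2 = t

namespace IsTransversal

variable {k t : ℕ} {U₁ U₂ S T : Submodule K V}

lemma symm (h : IsTransversal k t U₁ U₂ S) : IsTransversal k t U₂ U₁ S :=
  ⟨h.dm_right, h.dm_left, by rw [inf_comm]; exact h.lt, h.dm_eq, h.dm_inf_right, h.dm_inf_left,
    by rw [inf_comm U₂]; exact h.dm_inf_inf⟩

variable [FiniteDimensional K V]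

lemma dm_sup_inf_left (h : IsTransversal k t U₁ U₂ S) (hTS : T ≤ S) (hT : dm T = t) :
    dm (T ⊔ (S ⊓ U₁)) + dm (T ⊓ U₁) = 2 * t := by
  have h1 := dm_sup_add_inf T (S ⊓ U₁)
  have h2 : T ⊓ (S ⊓ U₁) = T ⊓ U₁ := by rw [← inf_assoc, inf_eq_left.2 hTS]
  rw [h2, h.dm_inf_left] at h1
  omega

lemma le_dm_inf_left (h : IsTransversal k t U₁ U₂ S) (hTS : T ≤ S) (hT : dm T = t) :
    t ≤ dm (T ⊓ U₁) + 2 := by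
  have h1 := h.dm_sup_inf_left hTS hT
  have h2 : dm (T ⊔ (S ⊓ U₁)) ≤ dm S := dm_mono (sup_le hTS inf_le_left)
  have := h.dm_eq
  omega

lemma le_sup_left_of_dm (h : IsTransversal k t U₁ U₂ S) (hTS : T ≤ S) (hT : dm T = t)
    (h1 : dm (T ⊓ U₁) + 2 = t) : S ≤ T ⊔ U₁ := by
  have h2 := h.dm_sup_inf_left hTS hT
  have h3 : T ⊔ (S ⊓ U₁) = S := eq_of_le_of_dm_le (sup_le hTS inf_le_left)
    (by have := h.dm_eq; omega)
  rw [← h3]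
  exact sup_le_sup_left inf_le_right T

/-- This controls the interaction of branching along `U₁` with branching along `U₂`: the two joins
share at most `t + 3` dimensions when `T` has deficit `2` with both spaces, and at most `t + 2` when
the deficits are `2` and `1`. -/
lemma dm_inf_sup_sup (h : IsTransversal k t U₁ U₂ S) (T : Submodule K V) (hT : dm T = t) :
    dm ((T ⊔ U₁) ⊓ (T ⊔ U₂)) + dm (T ⊓ U₁) + dm (T ⊓ U₂) + 1 ≤ 3 * t := by
  have h1 := dm_sup_add_inf (T ⊔ U₁) (T ⊔ U₂)
  have h2 := dm_sup_add_inf T U₁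
  have h3 := dm_sup_add_inf T U₂
  have h4 := dm_sup_add_inf U₁ U₂
  have h5 : dm (U₁ ⊔ U₂) ≤ dm ((T ⊔ U₁) ⊔ (T ⊔ U₂)) :=
    dm_mono (sup_le_sup le_sup_right le_sup_right)
  have := h.lt
  have := h.dm_left
  have := h.dm_right
  omega

lemma eq_inf_left_of_dm (h : IsTransversal k t U₁ U₂ S) (hTS : T ≤ S) (hT : dm T = t)
    (h1 : t ≤ dm (T ⊓ U₁)) : T = S ⊓ U₁ := by
  have h2 : T ⊓ U₁ = T := eq_of_le_of_dm_le inf_le_left (by omega)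
  exact eq_of_le_of_dm_le (le_inf hTS (inf_eq_left.1 h2)) (by rw [h.dm_inf_left, hT])

/-- A hyperplane of `T ⊔ U₂` that meets `T ⊔ U₁` inside `S`. -/
lemma exists_hyperplane (h : IsTransversal k t U₁ U₂ S) (hTS : T ≤ S) (hT : dm T = t)
    (h1 : dm (T ⊓ U₁) + 2 = t) (h2 : dm (T ⊓ U₂) + 2 = t) :
    ∃ M, T ≤ M ∧ M ≤ T ⊔ U₂ ∧ dm M = k + 1 ∧ M ⊓ (T ⊔ U₁) ≤ S := by
  have hS1 := h.le_sup_left_of_dm hTS hT h1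
  have hS2 := h.symm.le_sup_left_of_dm hTS hT h2
  have hZd := h.dm_inf_sup_sup T hT
  have hP2 := dm_sup_add_inf T U₂
  set Z := (T ⊔ U₁) ⊓ (T ⊔ U₂) with hZ
  have hSZ : S ≤ Z := le_inf hS1 hS2
  -- `Z` has dimension at most `t + 3`, so `S` has codimension at most one in it. Completing `S` by
  -- a complement of `Z` inside `T ⊔ U₂`, a space of dimension `k + 2`, leaves at least `k + 1`
  -- dimensions and keeps the intersection with `Z` equal to `S`.
  obtain ⟨Z', hZ'⟩ := exists_isCompl Z
  have hsup : Z ⊔ Z' ⊓ (T ⊔ U₂) = T ⊔ U₂ := by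
    rw [← sup_inf_assoc_of_le Z' (inf_le_right : Z ≤ T ⊔ U₂), hZ'.sup_eq_top, top_inf_eq]
  have hinf : (S ⊔ Z' ⊓ (T ⊔ U₂)) ⊓ Z = S := by
    rw [sup_inf_assoc_of_le _ hSZ]
    have : Z' ⊓ (T ⊔ U₂) ⊓ Z = ⊥ :=
      le_bot_iff.1 ((le_inf inf_le_right (inf_le_left.trans inf_le_left)).trans
        hZ'.inf_eq_bot.le)
    rw [this, sup_bot_eq]
  have hsup' : (S ⊔ Z' ⊓ (T ⊔ U₂)) ⊔ Z = T ⊔ U₂ := by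
    rw [sup_right_comm, sup_eq_right.2 hSZ, hsup]
  have hd := dm_sup_add_inf (S ⊔ Z' ⊓ (T ⊔ U₂)) Z
  rw [hinf, hsup', h.dm_eq] at hd
  have hU2 := h.dm_right
  have hTd : T ≤ S ⊔ Z' ⊓ (T ⊔ U₂) := hTS.trans le_sup_left
  have htk : t ≤ k := by
    have h4 : dm (S ⊓ U₂) ≤ dm U₂ := dm_mono inf_le_right
    rw [h.dm_inf_right, hU2] at h4
    exact h4
  obtain ⟨M, hTM, hM, hMd⟩ := exists_between_of_dm hTd (m := k + 1) (by omega) (by omega)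
  have hM2 : M ≤ T ⊔ U₂ := hM.trans (sup_le hS2 inf_le_right)
  refine ⟨M, hTM, hM2, hMd, ?_⟩
  calc M ⊓ (T ⊔ U₁) ≤ (S ⊔ Z' ⊓ (T ⊔ U₂)) ⊓ Z :=
        le_inf (inf_le_left.trans hM) (le_inf inf_le_right (inf_le_left.trans hM2))
    _ = S := hinf

end IsTransversal

lemma dm_inf_le_succ [FiniteDimensional K V] {C C' : Submodule K V} (U : Submodule K V)
    (hle : C ≤ C') (hd : dm C' = dm C + 1) : dm (C' ⊓ U) ≤ dm (C ⊓ U) + 1 := by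
  have h1 := dm_sup_add_inf C U
  have h2 := dm_sup_add_inf C' U
  have h3 : dm (C ⊔ U) ≤ dm (C' ⊔ U) := dm_mono (sup_le_sup_right hle U)
  omega

variable [Finite K] [FiniteDimensional K V] {k t : ℕ} {U₁ U₂ S T : Submodule K V}

/-- Three branchings without exceptional members. The first happens inside `M`; by `hsmall` the new
space `C` satisfies `C ⊓ U ≤ T ⊓ U`, so the deficit of two with `U` survives and pays for two more
branchings along `U`. -/
lemma ncard_le_cube {𝓔 : Set (Submodule K V)} {U M : Submodule K V} (hkn : k ≤ Module.finrank K V)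
    (htk : t ≤ k) (hT : dm T = t) (hU : dm U = k) (hTU : dm (T ⊓ U) + 2 ≤ t) (hTM : T ≤ M)
    (hM : dm M = k + 1) (hdk : ∀ F ∈ 𝓔, dm F = k) (hTF : ∀ F ∈ 𝓔, T ≤ F)
    (hFU : ∀ F ∈ 𝓔, t ≤ dm (F ⊓ U)) (hFM : ∀ F ∈ 𝓔, t + 1 ≤ dm (F ⊓ M))
    (hsmall : ∀ F ∈ 𝓔, F ⊓ (M ⊓ (T ⊔ U)) ≤ T) :
    (𝓔.ncard : ℝ) ≤ (qInt (Nat.card K) (k - t + 1) : ℝ) ^ 3 *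
      cnt (Nat.card K) (Module.finrank K V) k (t + 3) := by
  have := finite_submodule K V
  have h𝓔 : 𝓔 = {F ∈ 𝓔 | T ≤ F} := by
    ext F; exact ⟨fun hF => ⟨hF, hTF F hF⟩, fun hF => hF.1⟩
  rw [h𝓔, pow_succ', mul_assoc]
  refine ncard_above_le_mul hTM (by omega) (fun F hF hTF => ?_) (fun C hC => ?_)
  · obtain ⟨C, hTC, hCF, hC⟩ := exists_between_of_dm (le_inf hTF hTM) (m := dm T + 1) (by omega)
      (by rw [hT]; exact hFM F hF)
    exact ⟨C, ⟨hTC, hCF.trans inf_le_right, hC⟩, hCF.trans inf_le_left⟩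
  · by_cases hne : ∃ F ∈ 𝓔, C ≤ F
    · obtain ⟨F, hF, hCF⟩ := hne
      have h1 : C ⊓ U ≤ T ⊓ U := by
        refine le_inf (le_trans ?_ (hsmall F hF)) inf_le_right
        exact le_inf (inf_le_left.trans hCF) (inf_le_inf hC.2.1 le_sup_right)
      have h2 := dm_mono h1
      rw [pow_succ', pow_one, mul_assoc]
      rw [← hU]
      refine ncard_above_le_mul_of_meets (by omega) (by omega) (fun F hF _ => hFU F hF)
        (fun C₂ hCC₂ _ hC₂ => ?_)
      have h3 := dm_inf_le_succ U hCC₂ hC₂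
      refine ncard_above_le_mul_of_meets (by omega) (by omega) (fun F hF _ => hFU F hF)
        (fun C₃ _ _ hC₃ => ?_)
      have h4 := ncard_above_le hdk hkn C₃
      rw [hC₃, hC₂, hC.2.2, hT, ← hU] at h4
      exact h4
    · have : {F ∈ 𝓔 | C ≤ F} = ∅ := by
        ext F
        simp only [Set.mem_ofPred_eq, Set.mem_empty_iff_false, iff_false]
        exact fun h => hne ⟨F, h⟩
      rw [this, Set.ncard_empty, Nat.cast_zero]
      have := cnt_nonneg (Nat.card K) hkn (t + 3)
      positivity

namespace IsTransversal

/-- The `t`-subspaces of `S` of mixed type. -/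
lemma ncard_mixed_le (h : IsTransversal k t U₁ U₂ S) (ht : 1 ≤ t) :
    ({T | T ≤ S ∧ dm T = t ∧ dm (T ⊓ U₁) + 2 = t ∧ dm (T ⊓ U₂) + 1 = t}.ncard : ℝ) ≤
      qInt (Nat.card K) t * ((Nat.card K : ℝ) ^ 2 + Nat.card K) := by
  have := finite_submodule K V
  have h0 : dm (⊥ : Submodule K V) = 0 := finrank_bot K V
  have hY : ((betw ⊥ (S ⊓ U₂) (t - 1)).ncard : ℝ) = qInt (Nat.card K) t := by
    rw [ncard_betw bot_le (by omega) (by rw [h.dm_inf_right]; omega), h0, h.dm_inf_right,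
      Nat.sub_zero, Nat.sub_zero]
    have := gb_symm (Nat.card K) (t - 1) 1
    rwa [show t - 1 + 1 = t by omega, gb_one_right _ ht] at this
  rw [← hY]
  refine ncard_le_mul_of_cover _ _ (fun Y T => Y ≤ T) (fun T hT => ?_) (fun Y hY => ?_)
  · exact ⟨T ⊓ U₂, ⟨bot_le, inf_le_inf_right U₂ hT.1, by have := hT.2.2.2; omega⟩, inf_le_left⟩
  · have hYS : Y ≤ S := hY.2.1.trans inf_le_left
    have hYd := hY.2.2
    have hX : S ⊓ U₂ ∈ pts Y S := ⟨hY.2.1, inf_le_left, by rw [h.dm_inf_right]; omega⟩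
    -- Over a hyperplane `Y` of `S ⊓ U₂` there are `[3]` spaces of dimension `t` in `S`; removing `S
    -- ⊓ U₂` itself leaves `q² + q`.
    have hc : ((pts Y S \ {S ⊓ U₂}).ncard : ℝ) = (Nat.card K : ℝ) ^ 2 + Nat.card K := by
      rw [Set.ncard_sdiff_singleton_of_mem hX, ncard_pts hYS, h.dm_eq,
        show t + 2 - dm Y = 3 by omega, qInt_three]
      push_cast [Nat.add_sub_cancel]
      ring
    rw [← hc]
    refine ncard_le_ncard_real fun T hT => ⟨⟨hT.2, hT.1.1, by have := hT.1.2.1; omega⟩, ?_⟩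
    rintro rfl
    have h1 := hT.1.2.2.2
    rw [inf_assoc, inf_idem, h.dm_inf_right] at h1
    omega

/-- The `t`-subspaces of `S` that meet both `S ⊓ U₁` and `S ⊓ U₂` in hyperplanes. -/
lemma ncard_both_le (h : IsTransversal k t U₁ U₂ S) :
    ({T | T ≤ S ∧ dm T = t ∧ dm (T ⊓ U₁) + 1 = t ∧ dm (T ⊓ U₂) + 1 = t}.ncard : ℝ) ≤
      ((Nat.card K : ℝ) + 1) ^ 2 := by
  have := finite_submodule K V
  set X := S ⊓ (U₁ ⊓ U₂) with hX
  have hXd : dm X + 2 = t := h.dm_inf_inf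
  -- Such a `T` is the span of its two traces, each one of the `q + 1` spaces one dimension above
  -- `X`.
  have key : ∀ T : Submodule K V, T ≤ S → dm T = t → dm (T ⊓ U₁) + 1 = t → dm (T ⊓ U₂) + 1 = t →
      X ≤ T ∧ (T ⊓ U₁) ⊔ (T ⊓ U₂) = T := by
    intro T hTS hT h1 h2
    have h3 := dm_sup_add_inf (T ⊓ U₁) (T ⊓ U₂)
    have h4 : (T ⊓ U₁) ⊔ (T ⊓ U₂) ≤ T := sup_le inf_le_left inf_le_left
    have h5 : (T ⊓ U₁) ⊓ (T ⊓ U₂) ≤ X :=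
      le_inf (inf_le_left.trans (inf_le_left.trans hTS)) (inf_le_inf inf_le_right inf_le_right)
    have h6 := dm_mono h4
    have h7 := dm_mono h5
    have h8 : (T ⊓ U₁) ⊓ (T ⊓ U₂) = X := eq_of_le_of_dm_le h5 (by omega)
    exact ⟨h8 ▸ inf_le_left.trans inf_le_left, eq_of_le_of_dm_le h4 (by omega)⟩
  have hX1 : X ≤ S ⊓ U₁ := inf_le_inf_left S inf_le_left
  have hX2 : X ≤ S ⊓ U₂ := inf_le_inf_left S inf_le_right
  have hle := Set.ncard_le_ncard_of_injOn (fun T => (T ⊓ U₁, T ⊓ U₂))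
    (s := {T | T ≤ S ∧ dm T = t ∧ dm (T ⊓ U₁) + 1 = t ∧ dm (T ⊓ U₂) + 1 = t})
    (t := pts X (S ⊓ U₁) ×ˢ pts X (S ⊓ U₂)) ?_ ?_ (Set.toFinite _)
  · rw [Set.ncard_prod, ncard_pts hX1, ncard_pts hX2, h.dm_inf_left, h.dm_inf_right,
      show t - dm X = 2 by omega, qInt_two] at hle
    rw [pow_two]
    exact_mod_cast hle
  · rintro T ⟨hTS, hT, h1, h2⟩
    obtain ⟨hXT, _⟩ := key T hTS hT h1 h2
    have e1 : dm (T ⊓ U₁) = dm X + 1 := by omega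
    have e2 : dm (T ⊓ U₂) = dm X + 1 := by omega
    exact ⟨⟨le_inf hXT (hX1.trans inf_le_right), inf_le_inf_right U₁ hTS, e1⟩,
      ⟨le_inf hXT (hX2.trans inf_le_right), inf_le_inf_right U₂ hTS, e2⟩⟩
  · rintro T ⟨hTS, hT, h1, h2⟩ T' ⟨hTS', hT', h1', h2'⟩ heq
    simp only [Prod.mk.injEq] at heq
    rw [← (key T hTS hT h1 h2).2, ← (key T' hTS' hT' h1' h2').2, heq.1, heq.2]

/-- Members that meet `S` in a `t`-space of mixed type and contain a further point of
`(T ⊔ U₁) ⊓ (T ⊔ U₂)`. -/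
lemma ncard_mixed_type_le (h : IsTransversal k t U₁ U₂ S) (hTS : T ≤ S) (hT : dm T = t)
    (h1 : dm (T ⊓ U₁) + 2 = t) (h2 : dm (T ⊓ U₂) + 1 = t) {𝓐 : Set (Submodule K V)} {b : ℝ}
    (hb : ∀ R, dm R = t + 1 → ({F ∈ 𝓐 | R ≤ F}.ncard : ℝ) ≤ b)
    (hTF : ∀ F ∈ 𝓐, F ⊓ S = T) (hZ : ∀ F ∈ 𝓐, ¬ F ⊓ ((T ⊔ U₁) ⊓ (T ⊔ U₂)) ≤ T) :
    (𝓐.ncard : ℝ) ≤ Nat.card K * b := by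
  have := finite_submodule K V
  have hZd := h.dm_inf_sup_sup T hT
  have hS1 := h.le_sup_left_of_dm hTS hT h1
  have hTZ : T ≤ (T ⊔ U₁) ⊓ (T ⊔ U₂) := le_inf le_sup_left le_sup_left
  have hCd := h.symm.dm_sup_inf_left hTS hT
  -- Among the at most `q + 1` spaces one dimension above `T` in the intersection of the joins, this
  -- one lies in `S` and is excluded by `F ⊓ S = T`; hence the factor `q`.
  have hC₀ : T ⊔ (S ⊓ U₂) ∈ pts T ((T ⊔ U₁) ⊓ (T ⊔ U₂)) :=
    ⟨le_sup_left, le_inf ((sup_le hTS inf_le_left).trans hS1) (sup_le_sup_left inf_le_right T),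
      by omega⟩
  have hb0 : 0 ≤ b := (Nat.cast_nonneg _).trans (hb _ (hC₀.2.2.trans (by rw [hT])))
  have hI : ((pts T ((T ⊔ U₁) ⊓ (T ⊔ U₂)) \ {T ⊔ (S ⊓ U₂)}).ncard : ℝ) ≤ Nat.card K := by
    rw [Set.ncard_sdiff_singleton_of_mem hC₀, ncard_pts hTZ]
    have h3 := qInt_mono (Nat.card K)
      (show dm ((T ⊔ U₁) ⊓ (T ⊔ U₂)) - dm T ≤ 2 by omega)
    rw [qInt_two] at h3
    have h4 : qInt (Nat.card K) (dm ((T ⊔ U₁) ⊓ (T ⊔ U₂)) - dm T) - 1 ≤ Nat.card K := by omega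
    exact_mod_cast h4
  refine (ncard_le_mul_of_cover 𝓐 (pts T ((T ⊔ U₁) ⊓ (T ⊔ U₂)) \ {T ⊔ (S ⊓ U₂)})
    (fun C F => C ≤ F) (b := b) (fun F hF => ?_) (fun C hC => hb C ?_)).trans
    (mul_le_mul_of_nonneg_right hI hb0)
  · have hTF' : T ≤ F := hTF F hF ▸ inf_le_left
    have hlt : T < F ⊓ ((T ⊔ U₁) ⊓ (T ⊔ U₂)) :=
      lt_of_le_of_ne (le_inf hTF' hTZ) fun he => hZ F hF he.symm.le
    obtain ⟨C, hTC, hCF, hC⟩ := exists_between_of_dm hlt.le (m := dm T + 1) (by omega)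
      (dm_lt_of_lt hlt)
    refine ⟨C, ⟨⟨hTC, hCF.trans inf_le_right, hC⟩, ?_⟩, hCF.trans inf_le_left⟩
    rintro rfl
    have h5 : T ⊔ (S ⊓ U₂) ≤ F ⊓ S := le_inf (hCF.trans inf_le_left) (sup_le hTS inf_le_left)
    rw [hTF F hF] at h5
    have := dm_mono h5
    omega
  · rw [hC.1.2.2, hT]

/-- Members meeting `S` in more than `t` dimensions are counted by `b₁`. The others are sorted by `T
= F ⊓ S`. The traces `S ⊓ Uᵢ` and the `T` with deficit `1` on both sides are few and may cost `b₀`.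
Deficits `2` and `1` cost `q * b₁` if `F` contains more than `T` of the intersection of the two
joins, and otherwise allow `ncard_le_cube`, as does deficit `2` on both sides. -/
theorem ncard_le (h : IsTransversal k t U₁ U₂ S) (hkn : k ≤ Module.finrank K V)
    {𝓐 : Set (Submodule K V)} {b₀ b₁ : ℝ} (hdk : ∀ F ∈ 𝓐, dm F = k)
    (hF1 : ∀ F ∈ 𝓐, t ≤ dm (F ⊓ U₁)) (hF2 : ∀ F ∈ 𝓐, t ≤ dm (F ⊓ U₂))
    (hFS : ∀ F ∈ 𝓐, t ≤ dm (F ⊓ S))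
    (hb₀ : ∀ T, dm T = t → ({F ∈ 𝓐 | T ≤ F}.ncard : ℝ) ≤ b₀)
    (hb₁ : ∀ R, dm R = t + 1 → ({F ∈ 𝓐 | R ≤ F}.ncard : ℝ) ≤ b₁) :
    (𝓐.ncard : ℝ) ≤ qInt (Nat.card K) (t + 2) * b₁ + (((Nat.card K : ℝ) + 1) ^ 2 + 2) * b₀ +
      2 * (qInt (Nat.card K) t * ((Nat.card K : ℝ) ^ 2 + Nat.card K) * (Nat.card K * b₁)) +
      gb (Nat.card K) (t + 2) 2 * ((qInt (Nat.card K) (k - t + 1) : ℝ) ^ 3 *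
        cnt (Nat.card K) (Module.finrank K V) k (t + 3)) := by
  have := finite_submodule K V
  have h0 : dm (⊥ : Submodule K V) = 0 := finrank_bot K V
  have ht2 : 2 ≤ t := by have := h.dm_inf_inf; omega
  have htk : t ≤ k := by
    have h4 : dm (S ⊓ U₂) ≤ dm U₂ := dm_mono inf_le_right
    rwa [h.dm_inf_right, h.dm_right] at h4
  have hb₁0 : 0 ≤ b₁ := by
    obtain ⟨R, _, _, hR⟩ := exists_between_of_dm (bot_le : ⊥ ≤ S) (m := t + 1) (by omega)
      (by rw [h.dm_eq]; omega)
    exact (Nat.cast_nonneg _).trans (hb₁ R hR)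
  have hb₀0 : 0 ≤ b₀ := (Nat.cast_nonneg _).trans (hb₀ _ h.dm_inf_left)
  set Z : Submodule K V → Submodule K V := fun T => (T ⊔ U₁) ⊓ (T ⊔ U₂) with hZdef
  set J₂₁ : Set (Submodule K V) :=
    {T | T ≤ S ∧ dm T = t ∧ dm (T ⊓ U₁) + 2 = t ∧ dm (T ⊓ U₂) + 1 = t} with hJ₂₁
  set J₁₂ : Set (Submodule K V) :=
    {T | T ≤ S ∧ dm T = t ∧ dm (T ⊓ U₂) + 2 = t ∧ dm (T ⊓ U₁) + 1 = t} with hJ₁₂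
  set J₂₂ : Set (Submodule K V) :=
    {T | T ≤ S ∧ dm T = t ∧ dm (T ⊓ U₁) + 2 = t ∧ dm (T ⊓ U₂) + 2 = t} with hJ₂₂
  set J₁₁ : Set (Submodule K V) :=
    {T | T ≤ S ∧ dm T = t ∧ dm (T ⊓ U₁) + 1 = t ∧ dm (T ⊓ U₂) + 1 = t} with hJ₁₁
  set 𝓐₀ : Set (Submodule K V) := {F ∈ 𝓐 | t + 1 ≤ dm (F ⊓ S)} with h𝓐₀
  set 𝓐₁ : Set (Submodule K V) := {F ∈ 𝓐 | F ⊓ S ∈ J₁₁ ∪ {S ⊓ U₁, S ⊓ U₂}} with h𝓐₁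
  set 𝓐₂ : Set (Submodule K V) := {F ∈ 𝓐 | F ⊓ S ∈ J₂₁ ∧ ¬ F ⊓ Z (F ⊓ S) ≤ F ⊓ S} with h𝓐₂
  set 𝓐₃ : Set (Submodule K V) := {F ∈ 𝓐 | F ⊓ S ∈ J₁₂ ∧ ¬ F ⊓ Z (F ⊓ S) ≤ F ⊓ S} with h𝓐₃
  set 𝓐₄ : Set (Submodule K V) := {F ∈ 𝓐 | F ⊓ S ∈ J₂₂ ∨
    ((F ⊓ S ∈ J₂₁ ∨ F ⊓ S ∈ J₁₂) ∧ F ⊓ Z (F ⊓ S) ≤ F ⊓ S)} with h𝓐₄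
  have hcover : 𝓐 ⊆ 𝓐₀ ∪ 𝓐₁ ∪ 𝓐₂ ∪ 𝓐₃ ∪ 𝓐₄ := by
    intro F hF
    by_cases hd : t + 1 ≤ dm (F ⊓ S)
    · exact Or.inl (Or.inl (Or.inl (Or.inl ⟨hF, hd⟩)))
    have hT : dm (F ⊓ S) = t := by have := hFS F hF; omega
    have hTS : F ⊓ S ≤ S := inf_le_right
    have e1 := h.le_dm_inf_left hTS hT
    have e2 := h.symm.le_dm_inf_left hTS hT
    by_cases c1 : t ≤ dm (F ⊓ S ⊓ U₁)
    · exact Or.inl (Or.inl (Or.inl (Or.inr ⟨hF, Or.inr (Or.inl (h.eq_inf_left_of_dm hTS hT c1))⟩)))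
    by_cases c2 : t ≤ dm (F ⊓ S ⊓ U₂)
    · exact Or.inl (Or.inl (Or.inl (Or.inr ⟨hF, Or.inr (Or.inr
        (h.symm.eq_inf_left_of_dm hTS hT c2))⟩)))
    by_cases c3 : dm (F ⊓ S ⊓ U₁) + 1 = t
    · by_cases c4 : dm (F ⊓ S ⊓ U₂) + 1 = t
      · exact Or.inl (Or.inl (Or.inl (Or.inr ⟨hF, Or.inl ⟨hTS, hT, c3, c4⟩⟩)))
      · have hJ : F ⊓ S ∈ J₁₂ := ⟨hTS, hT, by omega, c3⟩
        by_cases c5 : F ⊓ Z (F ⊓ S) ≤ F ⊓ S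
        · exact Or.inr ⟨hF, Or.inr ⟨Or.inr hJ, c5⟩⟩
        · exact Or.inl (Or.inr ⟨hF, hJ, c5⟩)
    · by_cases c4 : dm (F ⊓ S ⊓ U₂) + 1 = t
      · have hJ : F ⊓ S ∈ J₂₁ := ⟨hTS, hT, by omega, c4⟩
        by_cases c5 : F ⊓ Z (F ⊓ S) ≤ F ⊓ S
        · exact Or.inr ⟨hF, Or.inr ⟨Or.inl hJ, c5⟩⟩
        · exact Or.inl (Or.inl (Or.inr ⟨hF, hJ, c5⟩))
      · exact Or.inr ⟨hF, Or.inl ⟨hTS, hT, by omega, by omega⟩⟩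
  have n₀ : (𝓐₀.ncard : ℝ) ≤ qInt (Nat.card K) (t + 2) * b₁ := by
    have h1 := ncard_le_gb_mul (𝓐 := 𝓐₀) (S := S) (t := t + 1) (b := b₁) (by rw [h.dm_eq]; omega)
      (fun F hF => hF.2) (fun R _ hR => le_trans
        (ncard_le_ncard_real (u := {F ∈ 𝓐 | R ≤ F}) fun F hF => ⟨hF.1.1, hF.2⟩) (hb₁ R hR))
    rwa [h.dm_eq, gb_symm (Nat.card K) (t + 1) 1, gb_one_right _ (by omega)] at h1
  have n₁ : (𝓐₁.ncard : ℝ) ≤ (((Nat.card K : ℝ) + 1) ^ 2 + 2) * b₀ := by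
    have hI : ((J₁₁ ∪ {S ⊓ U₁, S ⊓ U₂}).ncard : ℝ) ≤ ((Nat.card K : ℝ) + 1) ^ 2 + 2 := by
      have i1 := Set.ncard_union_le J₁₁ {S ⊓ U₁, S ⊓ U₂}
      have i2 := Set.ncard_insert_le (S ⊓ U₁) {S ⊓ U₂}
      rw [Set.ncard_singleton] at i2
      have i3 := h.ncard_both_le
      have i4 : ((J₁₁ ∪ {S ⊓ U₁, S ⊓ U₂}).ncard : ℝ) ≤ J₁₁.ncard + 2 := by
        exact_mod_cast i1.trans (by omega)
      linarith
    refine (ncard_le_mul_of_cover 𝓐₁ (J₁₁ ∪ {S ⊓ U₁, S ⊓ U₂}) (fun T F => T ≤ F) (b := b₀)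
      (fun F hF => ⟨F ⊓ S, hF.2, inf_le_left⟩) (fun T hT => ?_)).trans
      (mul_le_mul_of_nonneg_right hI hb₀0)
    refine le_trans (ncard_le_ncard_real (u := {F ∈ 𝓐 | T ≤ F}) fun F hF => ⟨hF.1.1, hF.2⟩)
      (hb₀ T ?_)
    rcases hT with hT | rfl | rfl
    · exact hT.2.1
    · exact h.dm_inf_left
    · exact h.dm_inf_right
  have mixed : ∀ {A B : Submodule K V} (_ : IsTransversal k t A B S) (𝓑 : Set (Submodule K V)),
      (∀ F ∈ 𝓑, F ∈ 𝓐 ∧ F ⊓ S ∈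
        {T | T ≤ S ∧ dm T = t ∧ dm (T ⊓ A) + 2 = t ∧ dm (T ⊓ B) + 1 = t} ∧
        ¬ F ⊓ ((F ⊓ S ⊔ A) ⊓ (F ⊓ S ⊔ B)) ≤ F ⊓ S) →
      (𝓑.ncard : ℝ) ≤
        qInt (Nat.card K) t * ((Nat.card K : ℝ) ^ 2 + Nat.card K) * (Nat.card K * b₁) := by
    intro A B hAB 𝓑 h𝓑
    refine (ncard_le_mul_of_cover 𝓑 {T | T ≤ S ∧ dm T = t ∧ dm (T ⊓ A) + 2 = t ∧
      dm (T ⊓ B) + 1 = t} (fun T F => F ⊓ S = T) (b := Nat.card K * b₁)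
      (fun F hF => ⟨F ⊓ S, (h𝓑 F hF).2.1, rfl⟩) (fun T hT => ?_)).trans
      (mul_le_mul_of_nonneg_right (hAB.ncard_mixed_le (by omega)) (by positivity))
    refine hAB.ncard_mixed_type_le hT.1 hT.2.1 hT.2.2.1 hT.2.2.2 (fun R hR => le_trans
        (ncard_le_ncard_real (u := {F ∈ 𝓐 | R ≤ F}) fun F hF => ⟨(h𝓑 F hF.1.1).1, hF.2⟩) (hb₁ R hR))
      (fun F hF => hF.2) (fun F hF => ?_)
    have := (h𝓑 F hF.1).2.2
    rwa [hF.2] at this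
  have n₂ := mixed h 𝓐₂ (fun F hF => hF)
  have n₃ := mixed h.symm 𝓐₃ (fun F hF => ⟨hF.1, hF.2.1, by
    rw [inf_comm (F ⊓ S ⊔ U₂)]
    exact hF.2.2⟩)
  have n₄ : (𝓐₄.ncard : ℝ) ≤ gb (Nat.card K) (t + 2) 2 *
      ((qInt (Nat.card K) (k - t + 1) : ℝ) ^ 3 *
        cnt (Nat.card K) (Module.finrank K V) k (t + 3)) := by
    have hI : ((betw ⊥ S t).ncard : ℝ) = gb (Nat.card K) (t + 2) 2 := by
      rw [ncard_betw bot_le (by omega) (by rw [h.dm_eq]; omega), h0, h.dm_eq, Nat.sub_zero,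
        Nat.sub_zero, gb_symm]
    rw [← hI]
    have single : ∀ {A B : Submodule K V} (_ : IsTransversal k t A B S) (T : Submodule K V),
        T ≤ S → dm T = t → dm (T ⊓ A) + 2 = t → dm (T ⊓ B) + 1 = t →
        (∀ F ∈ 𝓐, t ≤ dm (F ⊓ A)) → (∀ F ∈ 𝓐, t ≤ dm (F ⊓ B)) →
        ({F ∈ 𝓐 | F ⊓ S = T ∧ F ⊓ ((T ⊔ A) ⊓ (T ⊔ B)) ≤ T}.ncard : ℝ) ≤
        (qInt (Nat.card K) (k - t + 1) : ℝ) ^ 3 *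
          cnt (Nat.card K) (Module.finrank K V) k (t + 3) := by
      intro A B hAB T hTS hT c1 c2 hA hB
      have hs := dm_sup_add_inf T B
      have hBd := hAB.dm_right
      refine ncard_le_cube (M := T ⊔ B) (U := A) hkn htk hT hAB.dm_left c1.le le_sup_left
        (by omega) (fun F hF => hdk F hF.1) (fun F hF => hF.2.1 ▸ inf_le_left)
        (fun F hF => hA F hF.1) (fun F hF => ?_) (fun F hF => ?_)
      · have := inf_sup_dm_of_le (hF.2.1 ▸ inf_le_left : T ≤ F) B
        have := hB F hF.1
        omega
      · rw [inf_comm (T ⊔ B)]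
        exact hF.2.2
    refine ncard_le_mul_of_cover 𝓐₄ (betw ⊥ S t) (fun T F => F ⊓ S = T) (fun F hF => ?_)
      (fun T hT => ?_)
    · refine ⟨F ⊓ S, ⟨bot_le, inf_le_right, ?_⟩, rfl⟩
      rcases hF.2 with hJ | ⟨hJ | hJ, _⟩ <;> exact hJ.2.1
    · obtain ⟨_, hTS, hTd⟩ := hT
      have hc := cnt_nonneg (Nat.card K) hkn (t + 3)
      by_cases c22 : T ∈ J₂₂
      -- With deficit `2` on both sides `T ⊔ U₂` has dimension `k + 2`, and its trace on `F` exceeds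
      -- `T` by at least two. The hyperplane `M` still catches one dimension of it, and `M ⊓ (T ⊔
      -- U₁) ≤ S` gives the smallness hypothesis.
      · obtain ⟨M, hTM, hMU, hM, hMS⟩ := h.exists_hyperplane hTS hTd c22.2.2.1 c22.2.2.2
        refine ncard_le_cube hkn htk hTd h.dm_left c22.2.2.1.le hTM hM
          (fun F hF => hdk F hF.1.1) (fun F hF => hF.2 ▸ inf_le_left) (fun F hF => hF1 F hF.1.1)
          (fun F hF => ?_) (fun F hF => ?_)
        · have e1 := inf_sup_dm_of_le (hF.2 ▸ inf_le_left : T ≤ F) U₂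
          have e2 := hF2 F hF.1.1
          have e3 := dm_sup_add_inf (F ⊓ (T ⊔ U₂)) M
          have e4 : dm (F ⊓ (T ⊔ U₂) ⊔ M) ≤ dm (T ⊔ U₂) := dm_mono (sup_le inf_le_right hMU)
          have e5 : dm (F ⊓ (T ⊔ U₂) ⊓ M) ≤ dm (F ⊓ M) :=
            dm_mono (inf_le_inf_right M inf_le_left)
          have e6 := dm_sup_add_inf T U₂
          have e7 := c22.2.2.2
          have e8 := h.dm_right
          omega
        · exact (inf_le_inf_left F hMS).trans hF.2.le
      by_cases c21 : T ∈ J₂₁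
      · refine le_trans (ncard_le_ncard_real fun F hF => ?_)
          (single h T hTS hTd c21.2.2.1 c21.2.2.2 hF1 hF2)
        obtain ⟨⟨hF, hF'⟩, rfl⟩ := hF
        rcases hF' with hJ | ⟨_, hZ⟩
        · exact absurd hJ c22
        · exact ⟨hF, rfl, hZ⟩
      by_cases c12 : T ∈ J₁₂
      · refine le_trans (ncard_le_ncard_real fun F hF => ?_)
          (single h.symm T hTS hTd c12.2.2.1 c12.2.2.2 hF2 hF1)
        obtain ⟨⟨hF, hF'⟩, rfl⟩ := hF
        rcases hF' with hJ | ⟨_, hZ⟩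
        · exact absurd hJ c22
        · refine ⟨hF, rfl, ?_⟩
          rw [inf_comm (F ⊓ S ⊔ U₂)]
          exact hZ
      · have he : {F ∈ 𝓐₄ | F ⊓ S = T} = ∅ := by
          ext F
          simp only [Set.mem_ofPred_eq, Set.mem_empty_iff_false, iff_false, not_and]
          rintro ⟨_, hF⟩ rfl
          rcases hF with hJ | ⟨hJ | hJ, _⟩
          · exact c22 hJ
          · exact c21 hJ
          · exact c12 hJ
        rw [he, Set.ncard_empty, Nat.cast_zero]
        positivity
  have hu : 𝓐.ncard ≤ 𝓐₀.ncard + 𝓐₁.ncard + 𝓐₂.ncard + 𝓐₃.ncard + 𝓐₄.ncard := by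
    refine (Set.ncard_le_ncard hcover (Set.toFinite _)).trans ?_
    refine (Set.ncard_union_le _ _).trans (Nat.add_le_add_right ?_ _)
    refine (Set.ncard_union_le _ _).trans (Nat.add_le_add_right ?_ _)
    refine (Set.ncard_union_le _ _).trans (Nat.add_le_add_right ?_ _)
    exact Set.ncard_union_le _ _
  have hu' : (𝓐.ncard : ℝ) ≤ 𝓐₀.ncard + 𝓐₁.ncard + 𝓐₂.ncard + 𝓐₃.ncard + 𝓐₄.ncard := by
    exact_mod_cast hu
  linarith

end IsTransversal

end Transversal

/-! ### Numerical inequalities for `q = 2`. -/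

section FieldWithTwoElements

/-! In this section `a = 2 ^ d`, `x = 2 ^ t`, `Y = 2 ^ (n - t)`, and `D`, `D'`, `D''` are the numbers
of `k`-spaces containing a given space of dimension `t + 1`, `t + 2`, `t + 3`. -/

variable {a x Y D D' D'' N g₂ g₃ : ℝ}

lemma ratio_lower_two (hx : 4 ≤ x) (ha : 4 ≤ a) (hY : 2 * a ^ 2 * x ^ 2 ≤ Y)
    (hD : D * (a - 2) = (Y - 2) * D') (hD' : 0 ≤ D') :
    (2 * a * x ^ 2 + 4 * x ^ 2) * D' ≤ D := by
  have h1 : (2 * a ^ 2 * x ^ 2 - 2) * D' ≤ D * (a - 2) := by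
    rw [hD]; exact mul_le_mul_of_nonneg_right (by linarith) hD'
  have h2 : ((2 * a * x ^ 2 + 4 * x ^ 2) * D') * (a - 2) ≤ D * (a - 2) := by
    refine le_trans (le_of_sub_nonneg ?_) h1
    have : (2 * a ^ 2 * x ^ 2 - 2) * D' - (2 * a * x ^ 2 + 4 * x ^ 2) * D' * (a - 2) =
      (8 * x ^ 2 - 2) * D' := by ring
    rw [this]
    exact mul_nonneg (by nlinarith) hD'
  exact le_of_mul_le_mul_right h2 (by linarith)

lemma ratio_upper_two (hx : 4 ≤ x) (ha : 4 ≤ a) (hY : 2 * a ^ 2 * x ^ 2 ≤ Y)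
    (hD'' : D' * (a - 4) = (Y - 4) * D'') (hD' : 0 ≤ D') (h0 : 0 ≤ D'') :
    (2 * a ^ 2 * x ^ 2 - 4) * D'' ≤ (a - 4) * D' ∧ 2 * a * x ^ 2 * D'' ≤ D' := by
  have hD''l : (2 * a ^ 2 * x ^ 2 - 4) * D'' ≤ (a - 4) * D' := by
    rw [mul_comm (a - 4), hD'']
    exact mul_le_mul_of_nonneg_right (by linarith) h0
  refine ⟨hD''l, ?_⟩
  have h3 : 1 ≤ a * x ^ 2 := by nlinarith
  have h1 : (2 * a * x ^ 2 * D'') * (a - 4) ≤ D' * (a - 4) := by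
    refine le_trans (le_of_sub_nonneg ?_) (hD''l.trans_eq (mul_comm _ _))
    have : (2 * a ^ 2 * x ^ 2 - 4) * D'' - 2 * a * x ^ 2 * D'' * (a - 4) =
      (8 * (a * x ^ 2) - 4) * D'' := by ring
    rw [this]
    exact mul_nonneg (by linarith) h0
  -- The value `a = 4` means `k = t + 2`, where no `k`-space lies over a `(t+3)`-space; the relation
  -- forces `D'' = 0`.
  rcases ha.eq_or_lt with rfl | hlt
  · have h4 : D'' ≤ 0 := by
      have h5 : 0 < 2 * (4 : ℝ) ^ 2 * x ^ 2 - 4 := by nlinarith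
      nlinarith
    have h5 : D'' = 0 := le_antisymm h4 h0
    rw [h5, mul_zero]; exact hD'
  · exact le_of_mul_le_mul_right h1 (by linarith)

lemma main_lower_two (ha : 4 ≤ a) (hD' : 0 ≤ D')
    (hDlow : (2 * a * x ^ 2 + 4 * x ^ 2) * D' ≤ D) :
    4 * x ^ 2 * (a ^ 2 * D') ≤ (2 * a - 1) * D := by
  have hpD : (2 * a - 1) * ((2 * a * x ^ 2 + 4 * x ^ 2) * D') ≤ (2 * a - 1) * D :=
    mul_le_mul_of_nonneg_left hDlow (by linarith)
  refine le_trans (le_of_sub_nonneg ?_) hpD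
  have : (2 * a - 1) * ((2 * a * x ^ 2 + 4 * x ^ 2) * D') - 4 * x ^ 2 * (a ^ 2 * D') =
    (6 * a - 4) * (x ^ 2 * D') := by ring
  rw [this]
  exact mul_nonneg (by linarith) (by positivity)

lemma loss_two (ha : 4 ≤ a) (hD' : 0 ≤ D') :
    (2 * a - 1) * (2 * a - 1 - 1) / 2 * D' ≤ 2 * (a ^ 2 * D') := by
  rw [← mul_assoc]
  refine mul_le_mul_of_nonneg_right ?_ hD'
  nlinarith

lemma cube_two (h : 2 * a * x ^ 2 * D'' ≤ D') :
    2 * (a ^ 3 * x ^ 2 * D'') ≤ a ^ 2 * D' := by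
  have h1 := mul_le_mul_of_nonneg_left h (sq_nonneg a)
  linarith

/-- At `x = 4` the leading terms `2a²x²` and `8a²x` tie and lower-order terms decide, so this
estimate cannot spare the factor `2` in the bound for `Y`, which comes from `n ≥ 2k + t + 1`. -/
lemma star_inequality_two (hx : 4 ≤ x) (ha : 4 ≤ a) (hD' : 0 ≤ D')
    (hDlow : (2 * a * x ^ 2 + 4 * x ^ 2) * D' ≤ D)
    (hN : (2 * a - 1) * D ≤ N + (2 * a - 1) * (2 * a - 1 - 1) / 2 * D') :
    (a - 1) * D + (2 * x - 1) * ((2 * a) ^ 2 * D') ≤ N := by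
  have h0 := loss_two ha hD'
  have h1 : a * ((2 * a * x ^ 2 + 4 * x ^ 2) * D') ≤ a * D :=
    mul_le_mul_of_nonneg_left hDlow (by linarith)
  have h3 : 0 ≤ (2 * x * (x - 4) + 2) * (a ^ 2 * D') + 4 * a * x ^ 2 * D' := by
    have h4 : 0 ≤ 2 * x * (x - 4) + 2 := by nlinarith
    have h5 : 0 ≤ a := by linarith
    positivity
  linarith

lemma contain_inequality_two (hx : 4 ≤ x) (ha : 4 ≤ a) (hD' : 0 ≤ D') (h0 : 0 ≤ D'')
    (hg₂ : g₂ ≤ 8 / 3 * x ^ 2) (hDlow : (2 * a * x ^ 2 + 4 * x ^ 2) * D' ≤ D)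
    (hD''u : 2 * a * x ^ 2 * D'' ≤ D')
    (hN : (2 * a - 1) * D ≤ N + (2 * a - 1) * (2 * a - 1 - 1) / 2 * D') :
    7 * ((2 * a) ^ 2 * D') + g₂ * ((2 * a) ^ 3 * D'') ≤ N := by
  have hl := loss_two ha hD'
  have hm := main_lower_two ha hD' hDlow
  have hc := cube_two hD''u
  have h1 : g₂ * ((2 * a) ^ 3 * D'') ≤ 8 / 3 * x ^ 2 * ((2 * a) ^ 3 * D'') :=
    mul_le_mul_of_nonneg_right hg₂ (by have : 0 ≤ a := by linarith
                                       positivity)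
  have h3 : 64 * (a ^ 2 * D') ≤ 4 * x ^ 2 * (a ^ 2 * D') :=
    mul_le_mul_of_nonneg_right (by nlinarith) (by positivity)
  have h4 : 0 ≤ a ^ 2 * D' := by positivity
  linarith

lemma deep_inequality_two (hx : 4 ≤ x) (ha : 4 ≤ a) (hD' : 0 ≤ D') (h0 : 0 ≤ D'')
    (hg₃ : g₃ ≤ 64 / 21 * x ^ 3) (hDlow : (2 * a * x ^ 2 + 4 * x ^ 2) * D' ≤ D)
    (hD''u : 2 * a * x ^ 2 * D'' ≤ D')
    (hN : (2 * a - 1) * D ≤ N + (2 * a - 1) * (2 * a - 1 - 1) / 2 * D') :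
    g₃ * ((2 * a) ^ 3 * D'') ≤ N := by
  have hl := loss_two ha hD'
  have hm := main_lower_two ha hD' hDlow
  have hc := cube_two hD''u
  have h1 : g₃ * ((2 * a) ^ 3 * D'') ≤ 64 / 21 * x ^ 3 * ((2 * a) ^ 3 * D'') :=
    mul_le_mul_of_nonneg_right hg₃ (by have : 0 ≤ a := by linarith
                                       positivity)
  have h3 : x * (2 * (a ^ 3 * x ^ 2 * D'')) ≤ x * (a ^ 2 * D') :=
    mul_le_mul_of_nonneg_left hc (by linarith)
  have h4 : (256 / 21 * x + 2) * (a ^ 2 * D') ≤ 4 * x ^ 2 * (a ^ 2 * D') :=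
    mul_le_mul_of_nonneg_right (by nlinarith) (by positivity)
  linarith

lemma transversal_cube_two (hx : 4 ≤ x) (ha : 4 ≤ a) (h0 : 0 ≤ D'')
    (hg₂ : g₂ * 3 = (4 * x - 1) * (2 * x - 1))
    (hD''l : (2 * a ^ 2 * x ^ 2 - 4) * D'' ≤ (a - 4) * D') :
    g₂ * ((2 * a - 1) ^ 3 * D'') ≤ (2 * a - 1) * (16 / 3 * ((a - 4) * D')) := by
  have h2 : g₂ * (2 * a - 1) ^ 2 ≤ 16 / 3 * (2 * a ^ 2 * x ^ 2 - 4) := by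
    have h5 : (4 * x - 1) * (2 * x - 1) ≤ 8 * x ^ 2 - 5 * x := by nlinarith
    have h6 : (2 * a - 1) ^ 2 ≤ 4 * a ^ 2 := by nlinarith
    have h7 : (4 * x - 1) * (2 * x - 1) * (2 * a - 1) ^ 2 ≤ (8 * x ^ 2 - 5 * x) * (4 * a ^ 2) :=
      mul_le_mul h5 h6 (by positivity) (by nlinarith)
    have h8 : 64 ≤ 5 * x * (4 * a ^ 2) := by
      have : 16 ≤ a ^ 2 := by nlinarith
      nlinarith
    rw [← hg₂] at h7
    linarith
  have h3 : g₂ * ((2 * a - 1) ^ 3 * D'') = (2 * a - 1) * (g₂ * (2 * a - 1) ^ 2 * D'') := by ring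
  rw [h3]
  refine mul_le_mul_of_nonneg_left ?_ (by linarith)
  calc g₂ * (2 * a - 1) ^ 2 * D'' ≤ 16 / 3 * (2 * a ^ 2 * x ^ 2 - 4) * D'' :=
        mul_le_mul_of_nonneg_right h2 h0
    _ ≤ 16 / 3 * ((a - 4) * D') := by linarith

lemma transversal_poly_two (hx : 4 ≤ x) (ha : 8 ≤ a) :
    (4 * x - 1) * (2 * a) + 11 * (2 * a) ^ 2 + 2 * ((x - 1) * 6 * (2 * (2 * a))) +
      (2 * a - 1) * (16 / 3 * (a - 4)) + (2 * a - 1) * (2 * a - 1 - 1) / 2 + 2 ≤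
      (2 * a - 1) * (2 * a * x ^ 2 + 4 * x ^ 2) := by
  obtain ⟨u, rfl⟩ : ∃ u, x = 4 + u := ⟨x - 4, by ring⟩
  obtain ⟨v, rfl⟩ : ∃ v, a = 8 + v := ⟨a - 8, by ring⟩
  -- After the shift the difference of the two sides is a polynomial in `u` and `v` with nonnegative
  -- coefficients.
  have hu : 0 ≤ u := by linarith
  have hv : 0 ≤ v := by linarith
  rw [← sub_nonneg]
  ring_nf
  positivity

lemma transversal_inequality_two (hx : 4 ≤ x) (ha : a = 4 ∨ 8 ≤ a) (hY : 2 * a ^ 2 * x ^ 2 ≤ Y)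
    (hD : D * (a - 2) = (Y - 2) * D') (hD' : 1 ≤ D') (h0 : 0 ≤ D'')
    (hg₂ : g₂ * 3 = (4 * x - 1) * (2 * x - 1))
    (hD''l : (2 * a ^ 2 * x ^ 2 - 4) * D'' ≤ (a - 4) * D')
    (hN : (2 * a - 1) * D ≤ N + (2 * a - 1) * (2 * a - 1 - 1) / 2 * D') :
    (4 * x - 1) * (2 * a * D') + ((2 + 1) ^ 2 + 2) * ((2 * a) ^ 2 * D') +
      2 * ((x - 1) * (2 ^ 2 + 2) * (2 * (2 * a * D'))) + g₂ * ((2 * a - 1) ^ 3 * D'') + 1 < N := by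
  have hD'0 : 0 ≤ D' := by linarith
  have ha4 : 4 ≤ a := by rcases ha with h | h <;> linarith
  have h1 := transversal_cube_two hx ha4 h0 hg₂ hD''l
  rcases ha with rfl | ha8
  · have h4 : (16 * x ^ 2 - 1) * D' ≤ D := by
      have : (2 * 4 ^ 2 * x ^ 2 - 2) * D' ≤ (Y - 2) * D' :=
        mul_le_mul_of_nonneg_right (by linarith) hD'0
      linarith
    have h5 : (224 * x + 527) * D' ≤ 7 * (16 * x ^ 2 - 1) * D' :=
      mul_le_mul_of_nonneg_right (by nlinarith) hD'0
    linarith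
  · have h7 := mul_le_mul_of_nonneg_right (transversal_poly_two hx ha8) hD'0
    have h8 : (2 * a - 1) * ((2 * a * x ^ 2 + 4 * x ^ 2) * D') ≤ (2 * a - 1) * D :=
      mul_le_mul_of_nonneg_left (ratio_lower_two hx ha4 hY hD hD'0) (by linarith)
    linarith

end FieldWithTwoElements

/-! ### Numerical inequalities for `q ≥ 3`. -/

section LargerFields

/-! In this section `Q ≥ 3` is the size of the field, `a = Q ^ d`, `x = Q ^ t`, `Y = Q ^ (n - t)`,
`p` is the `Q`-analogue of `d + 1`, and `D`, `D'`, `D''` are the numbers of `k`-spaces containing a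
given space of dimension `t + 1`, `t + 2`, `t + 3`. -/

variable {Q a x p Y D D' D'' N g₂ g₃ b₀ b₁ b₂ b₃ : ℝ}

lemma ratio_lower (hQ : 3 ≤ Q) (ha : Q ^ 2 ≤ a) (hY : a ^ 2 * x ^ 2 ≤ Y) (hx : Q ^ 2 ≤ x)
    (hD : D * (a - Q) = (Y - Q) * D') (hD' : 0 ≤ D') : (a + 3) * x ^ 2 * D' ≤ D := by
  have haQ : 0 < a - Q := by nlinarith
  have h1 : (a ^ 2 * x ^ 2 - Q) * D' ≤ D * (a - Q) := by
    rw [hD]; exact mul_le_mul_of_nonneg_right (by linarith) hD'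
  have hx9 : 9 ≤ x := by nlinarith
  have hx1 : 1 ≤ x ^ 2 := by nlinarith
  have h2 : ((a + 3) * x ^ 2 * D') * (a - Q) ≤ D * (a - Q) := by
    refine le_trans (le_of_sub_nonneg ?_) h1
    have : (a ^ 2 * x ^ 2 - Q) * D' - (a + 3) * x ^ 2 * D' * (a - Q) =
      ((a * (Q - 3)) * x ^ 2 + (3 * Q * x ^ 2 - Q)) * D' := by ring
    rw [this]
    refine mul_nonneg (add_nonneg (mul_nonneg (mul_nonneg ?_ ?_) ?_) ?_) hD' <;> nlinarith
  exact le_of_mul_le_mul_right h2 haQ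

lemma ratio_upper (hQ : 3 ≤ Q) (ha : Q ^ 2 ≤ a) (hY : a ^ 2 * x ^ 2 ≤ Y) (hx : Q ^ 2 ≤ x)
    (hD'' : D' * (a - Q ^ 2) = (Y - Q ^ 2) * D'') (hD' : 0 ≤ D') (h0 : 0 ≤ D'') :
    a * x ^ 2 * D'' ≤ D' := by
  have hD''l : (a ^ 2 * x ^ 2 - Q ^ 2) * D'' ≤ D' * (a - Q ^ 2) := by
    rw [hD'']
    exact mul_le_mul_of_nonneg_right (by linarith) h0
  have ha9 : 9 ≤ a := by nlinarith
  have hx9 : 9 ≤ x := by nlinarith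
  have hx1 : 1 ≤ x ^ 2 := by nlinarith
  have h3 : 1 ≤ a * x ^ 2 := by nlinarith
  have h1 : (a * x ^ 2 * D'') * (a - Q ^ 2) ≤ D' * (a - Q ^ 2) := by
    refine le_trans (le_of_sub_nonneg ?_) hD''l
    have : (a ^ 2 * x ^ 2 - Q ^ 2) * D'' - a * x ^ 2 * D'' * (a - Q ^ 2) =
      (Q ^ 2 * (a * x ^ 2 - 1)) * D'' := by ring
    rw [this]
    exact mul_nonneg (mul_nonneg (sq_nonneg _) (by linarith)) h0
  rcases ha.eq_or_lt with rfl | hlt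
  · have h4 : D'' ≤ 0 := by
      have h5 : 0 < (Q ^ 2) ^ 2 * x ^ 2 - Q ^ 2 := by nlinarith
      rw [sub_self, mul_zero] at hD''l
      by_contra! hcon
      exact absurd hD''l (not_le.2 (mul_pos h5 hcon))
    have h5 : D'' = 0 := le_antisymm h4 h0
    rw [h5, mul_zero]; exact hD'
  · exact le_of_mul_le_mul_right h1 (by linarith)

/-- The constants are extremal at `Q = 3`: `3/2` is `Q / (Q - 1)`, and `14/9` is `(p + 1) / a` for
`a = 9`, `p = 13`. -/
lemma bounds_p (hQ : 3 ≤ Q) (ha : Q ^ 2 ≤ a) (hp : p * (Q - 1) = Q * a - 1) :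
    a + 3 ≤ p ∧ p ≤ 3 / 2 * a ∧ p + 1 ≤ 14 / 9 * a := by
  have ha9 : 9 ≤ a := by nlinarith
  refine ⟨?_, ?_, ?_⟩
  · refine le_of_mul_le_mul_right (a := Q - 1) ?_ (by linarith)
    nlinarith
  · refine le_of_mul_le_mul_right (a := Q - 1) ?_ (by linarith)
    nlinarith
  · refine le_of_mul_le_mul_right (a := Q - 1) ?_ (by linarith)
    nlinarith

lemma bound_b_two (hQ : 3 ≤ Q) (hx : Q ^ 2 ≤ x) (hb : b₂ * (Q - 1) = Q ^ 2 * x - 1) :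
    b₂ ≤ x ^ 2 / 2 := by
  refine le_of_mul_le_mul_right (a := Q - 1) ?_ (by linarith)
  have h1 : Q ^ 2 * x ≤ x ^ 2 := by nlinarith
  nlinarith [sq_nonneg x]

lemma bound_b_zero (hQ : 3 ≤ Q) (hx : Q ^ 2 ≤ x) (hb : b₀ * (Q - 1) = x - 1) :
    b₀ * (Q ^ 2 + Q) * Q ≤ 2 * x ^ 2 := by
  have hx0 : 0 ≤ x := by nlinarith
  have h1 : b₀ * (Q - 1) ≤ x := by linarith
  have hb0 : 0 ≤ b₀ := by
    by_contra! h
    nlinarith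
  have h2 : b₀ * (Q + 1) ≤ 2 * x := by nlinarith
  have h3 : Q ^ 2 * (b₀ * (Q + 1)) ≤ x * (2 * x) :=
    mul_le_mul hx h2 (mul_nonneg hb0 (by linarith)) hx0
  linarith

lemma bound_g_two (hQ : 3 ≤ Q) (hx : Q ^ 2 ≤ x) (hb₁ : b₁ * (Q - 1) = Q * x - 1)
    (hb₂ : b₂ * (Q - 1) = Q ^ 2 * x - 1) (hg : g₂ * (Q + 1) = b₂ * b₁) :
    g₂ ≤ 27 / 16 * x ^ 2 := by
  have hx9 : 9 ≤ x := by nlinarith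
  have h1 : g₂ * ((Q + 1) * (Q - 1) ^ 2) = (Q ^ 2 * x - 1) * (Q * x - 1) := by
    rw [← hb₁, ← hb₂]; linear_combination (Q - 1) ^ 2 * hg
  have hpos : 0 < (Q + 1) * (Q - 1) ^ 2 := mul_pos (by linarith) (pow_pos (by linarith) 2)
  refine le_of_mul_le_mul_right (a := (Q + 1) * (Q - 1) ^ 2) ?_ hpos
  rw [h1]
  have h2 : (Q ^ 2 * x - 1) * (Q * x - 1) ≤ Q ^ 3 * x ^ 2 := by nlinarith
  -- Equality holds at `Q = 3`.
  have h3 : Q ^ 3 ≤ 27 / 16 * ((Q + 1) * (Q - 1) ^ 2) := by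
    obtain ⟨u, rfl⟩ : ∃ u, Q = 3 + u := ⟨Q - 3, by ring⟩
    have hu : 0 ≤ u := by linarith
    rw [← sub_nonneg]
    ring_nf
    positivity
  have h4 := mul_le_mul_of_nonneg_right h3 (sq_nonneg x)
  linarith

lemma bound_g_three (hQ : 3 ≤ Q) (hx : Q ^ 2 ≤ x) (hg₂ : g₂ ≤ 27 / 16 * x ^ 2) (hg₂0 : 0 ≤ g₂)
    (hb₃ : b₃ * (Q - 1) = Q ^ 3 * x - 1) (hg : g₃ * (Q ^ 2 + Q + 1) = b₃ * g₂) :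
    g₃ ≤ 9 / 5 * x ^ 3 := by
  have hx9 : 9 ≤ x := by nlinarith
  have hQ3 : 27 ≤ Q ^ 3 := by
    have : (3 : ℝ) ^ 3 ≤ Q ^ 3 := pow_le_pow_left₀ (by norm_num) hQ 3
    linarith
  have h1 : g₃ * (Q ^ 3 - 1) = (Q ^ 3 * x - 1) * g₂ := by
    rw [← hb₃]; linear_combination (Q - 1) * hg
  refine le_of_mul_le_mul_right (a := Q ^ 3 - 1) ?_ (by linarith)
  rw [h1]
  have h2 : (Q ^ 3 * x - 1) * g₂ ≤ (Q ^ 3 * x) * (27 / 16 * x ^ 2) :=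
    mul_le_mul (by linarith) hg₂ hg₂0 (by nlinarith)
  have h3 : 27 / 16 * Q ^ 3 ≤ 9 / 5 * (Q ^ 3 - 1) := by linarith
  have h4 := mul_le_mul_of_nonneg_right h3 (show 0 ≤ x ^ 3 by positivity)
  linarith

lemma main_lower (ha : 9 ≤ a) (hx : 9 ≤ x) (hp : a + 3 ≤ p) (hD' : 0 ≤ D')
    (hDlow : (a + 3) * x ^ 2 * D' ≤ D) :
    (a ^ 2 * x ^ 2 + 6 * (a * x ^ 2)) * D' ≤ p * D := by
  have h1 : (a + 3) * ((a + 3) * x ^ 2 * D') ≤ p * D :=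
    mul_le_mul hp hDlow (by positivity) (by linarith)
  have h2 : 0 ≤ x ^ 2 * D' := by positivity
  linarith

lemma loss (ha : 9 ≤ a) (hp : a + 3 ≤ p) (hp' : p ≤ 3 / 2 * a) (hD' : 0 ≤ D') :
    p * (p - 1) / 2 * D' ≤ 9 / 8 * (a ^ 2 * D') := by
  rw [← mul_assoc]
  refine mul_le_mul_of_nonneg_right ?_ hD'
  nlinarith

lemma cube_le {c : ℝ} (ha : 9 ≤ a) (hp : 0 ≤ p) (hc : p ≤ c * a) (h0 : 0 ≤ D'')
    (h : a * x ^ 2 * D'' ≤ D') : x ^ 2 * (p ^ 3 * D'') ≤ c ^ 3 * (a ^ 2 * D') := by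
  have h1 : p ^ 3 ≤ (c * a) ^ 3 := pow_le_pow_left₀ hp hc 3
  have hc0 : 0 ≤ c := by
    by_contra! hcon
    nlinarith
  have h2 : x ^ 2 * (p ^ 3 * D'') ≤ x ^ 2 * ((c * a) ^ 3 * D'') :=
    mul_le_mul_of_nonneg_left (mul_le_mul_of_nonneg_right h1 h0) (sq_nonneg x)
  have h3 : c ^ 3 * a ^ 2 * (a * x ^ 2 * D'') ≤ c ^ 3 * a ^ 2 * D' :=
    mul_le_mul_of_nonneg_left h (by positivity)
  linarith

lemma theta_sq_le (hp : a + 3 ≤ p) (ha : 9 ≤ a) (hθ : p + 1 ≤ 14 / 9 * a) (hD' : 0 ≤ D') :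
    (p + 1) ^ 2 * D' ≤ 5 / 2 * (a ^ 2 * D') := by
  rw [← mul_assoc]
  refine mul_le_mul_of_nonneg_right ?_ hD'
  have : (p + 1) ^ 2 ≤ (14 / 9 * a) ^ 2 := pow_le_pow_left₀ (by linarith) hθ 2
  nlinarith

lemma star_inequality (hQ : 3 ≤ Q) (ha : 9 ≤ a) (hx : 9 ≤ x) (hp : a + 3 ≤ p)
    (hp' : p ≤ 3 / 2 * a) (hθ : p + 1 ≤ 14 / 9 * a) (hb₁ : b₁ * (Q - 1) = Q * x - 1)
    (hD' : 0 ≤ D') (hDlow : (a + 3) * x ^ 2 * D' ≤ D)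
    (hN : p * D ≤ N + p * (p - 1) / 2 * D') :
    (p - a) * D + b₁ * ((p + 1) ^ 2 * D') ≤ N := by
  have hl := loss ha hp hp' hD'
  have ht := theta_sq_le hp ha hθ hD'
  have hb : b₁ ≤ 3 / 2 * x := by
    refine le_of_mul_le_mul_right (a := Q - 1) ?_ (by linarith)
    nlinarith
  have h0 : 0 ≤ (p + 1) ^ 2 * D' := by positivity
  have h1 : b₁ * ((p + 1) ^ 2 * D') ≤ 3 / 2 * x * (5 / 2 * (a ^ 2 * D')) :=
    (mul_le_mul_of_nonneg_right hb h0).trans (mul_le_mul_of_nonneg_left ht (by linarith))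
  have h2 : a * ((a + 3) * x ^ 2 * D') ≤ a * D := mul_le_mul_of_nonneg_left hDlow (by linarith)
  have h3 : (15 / 4 * x + 9 / 8) * (a ^ 2 * D') ≤ x ^ 2 * (a ^ 2 * D') :=
    mul_le_mul_of_nonneg_right (by nlinarith) (by positivity)
  have h4 : 0 ≤ a * x ^ 2 * D' := by positivity
  linarith

lemma contain_inequality (hQ : 3 ≤ Q) (hQx : Q ^ 2 ≤ x) (ha : 9 ≤ a) (hx : 9 ≤ x)
    (hp : a + 3 ≤ p) (hp' : p ≤ 3 / 2 * a) (hθ : p + 1 ≤ 14 / 9 * a) (hg₂ : g₂ ≤ 27 / 16 * x ^ 2)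
    (hD' : 0 ≤ D') (h0 : 0 ≤ D'') (hDlow : (a + 3) * x ^ 2 * D' ≤ D)
    (hD''u : a * x ^ 2 * D'' ≤ D') (hN : p * D ≤ N + p * (p - 1) / 2 * D') :
    (Q ^ 2 + Q + 1) * ((p + 1) ^ 2 * D') + g₂ * ((p + 1) ^ 3 * D'') ≤ N := by
  have hl := loss ha hp hp' hD'
  have hm := main_lower ha hx hp hD' hDlow
  have ht := theta_sq_le hp ha hθ hD'
  have hc := cube_le ha (by linarith : 0 ≤ p + 1) hθ h0 hD''u
  have hp0 : 0 ≤ p := by linarith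
  have h1 : g₂ * ((p + 1) ^ 3 * D'') ≤ 27 / 16 * x ^ 2 * ((p + 1) ^ 3 * D'') :=
    mul_le_mul_of_nonneg_right hg₂ (by positivity)
  have h2 : (Q ^ 2 + Q + 1) * ((p + 1) ^ 2 * D') ≤ (2 * x) * (5 / 2 * (a ^ 2 * D')) :=
    mul_le_mul (by nlinarith) ht (by positivity) (by linarith)
  have h3 : (5 * x + 10) * (a ^ 2 * D') ≤ x ^ 2 * (a ^ 2 * D') :=
    mul_le_mul_of_nonneg_right (by nlinarith) (by positivity)
  have h4 : 0 ≤ a * x ^ 2 * D' := by positivity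
  have h5 : 0 ≤ a ^ 2 * D' := by positivity
  linarith

lemma deep_inequality (ha : 9 ≤ a) (hx : 9 ≤ x) (hp : a + 3 ≤ p) (hp' : p ≤ 3 / 2 * a)
    (hθ : p + 1 ≤ 14 / 9 * a) (hg₃ : g₃ ≤ 9 / 5 * x ^ 3) (hD' : 0 ≤ D') (h0 : 0 ≤ D'')
    (hDlow : (a + 3) * x ^ 2 * D' ≤ D) (hD''u : a * x ^ 2 * D'' ≤ D')
    (hN : p * D ≤ N + p * (p - 1) / 2 * D') : g₃ * ((p + 1) ^ 3 * D'') ≤ N := by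
  have hl := loss ha hp hp' hD'
  have hm := main_lower ha hx hp hD' hDlow
  have hc := cube_le ha (by linarith : 0 ≤ p + 1) hθ h0 hD''u
  have hp0 : 0 ≤ p := by linarith
  have h1 : g₃ * ((p + 1) ^ 3 * D'') ≤ 9 / 5 * x ^ 3 * ((p + 1) ^ 3 * D'') :=
    mul_le_mul_of_nonneg_right hg₃ (by positivity)
  have h2 : x * (x ^ 2 * ((p + 1) ^ 3 * D'')) ≤ x * ((14 / 9) ^ 3 * (a ^ 2 * D')) :=
    mul_le_mul_of_nonneg_left hc (by linarith)
  have h3 : (9 / 5 * (14 / 9) ^ 3 * x + 9 / 8) * (a ^ 2 * D') ≤ x ^ 2 * (a ^ 2 * D') :=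
    mul_le_mul_of_nonneg_right (by nlinarith) (by positivity)
  have h4 : 0 ≤ a * x ^ 2 * D' := by positivity
  linarith

lemma transversal_inequality (hQ : 3 ≤ Q) (hQx : Q ^ 2 ≤ x) (ha : 9 ≤ a) (hx : 9 ≤ x)
    (hp : a + 3 ≤ p) (hp' : p ≤ 3 / 2 * a) (hθ : p + 1 ≤ 14 / 9 * a) (hg₂ : g₂ ≤ 27 / 16 * x ^ 2)
    (hb₂ : b₂ ≤ x ^ 2 / 2) (hb₀ : b₀ * (Q ^ 2 + Q) * Q ≤ 2 * x ^ 2)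
    (hD' : 1 ≤ D') (h0 : 0 ≤ D'') (hDlow : (a + 3) * x ^ 2 * D' ≤ D)
    (hD''u : a * x ^ 2 * D'' ≤ D') (hN : p * D ≤ N + p * (p - 1) / 2 * D') :
    b₂ * ((p + 1) * D') + ((Q + 1) ^ 2 + 2) * ((p + 1) ^ 2 * D') +
      2 * (b₀ * (Q ^ 2 + Q) * (Q * ((p + 1) * D'))) + g₂ * (p ^ 3 * D'') + 1 < N := by
  have hD'0 : 0 ≤ D' := by linarith
  have hp0 : 0 ≤ p := by linarith
  have hl := loss ha hp hp' hD'0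
  have hm := main_lower ha hx hp hD'0 hDlow
  have ht : (p + 1) ^ 2 * D' ≤ (14 / 9) ^ 2 * (a ^ 2 * D') := by
    rw [← mul_assoc, ← mul_pow]
    exact mul_le_mul_of_nonneg_right (pow_le_pow_left₀ (by linarith) hθ 2) hD'0
  have hc := cube_le ha hp0 hp' h0 hD''u
  have hθ' : (p + 1) * D' ≤ 14 / 9 * a * D' := mul_le_mul_of_nonneg_right hθ hD'0
  have h1 : b₂ * ((p + 1) * D') ≤ x ^ 2 / 2 * (14 / 9 * a * D') :=
    mul_le_mul hb₂ hθ' (by positivity) (by positivity)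
  have h2 : ((Q + 1) ^ 2 + 2) * ((p + 1) ^ 2 * D') ≤ (2 * x) * ((14 / 9) ^ 2 * (a ^ 2 * D')) :=
    mul_le_mul (by nlinarith) ht (by positivity) (by linarith)
  have h3 : (b₀ * (Q ^ 2 + Q) * Q) * ((p + 1) * D') ≤ 2 * x ^ 2 * (14 / 9 * a * D') :=
    mul_le_mul hb₀ hθ' (by positivity) (by positivity)
  have h4 : g₂ * (p ^ 3 * D'') ≤ 27 / 16 * x ^ 2 * (p ^ 3 * D'') :=
    mul_le_mul_of_nonneg_right hg₂ (by positivity)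
  have h5 : (2 * (14 / 9) ^ 2 * x + 8) * (a ^ 2 * D') ≤ 7 / 9 * x ^ 2 * (a ^ 2 * D') :=
    mul_le_mul_of_nonneg_right (by nlinarith) (by positivity)
  have h6 : 9 * (a * x ^ 2 * D') ≤ a * (a * x ^ 2 * D') :=
    mul_le_mul_of_nonneg_right ha (by positivity)
  have h7 : 81 * D' ≤ a ^ 2 * D' := mul_le_mul_of_nonneg_right (by nlinarith) hD'0
  have h8 : 0 ≤ a * x ^ 2 * D' := by positivity
  have h9 : 0 ≤ a ^ 2 * x ^ 2 * D' := by positivity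
  linarith

end LargerFields

/-! ### From the counting functions to the numerical inequalities. -/

lemma cnt_ratio (q : ℕ) {n t d i : ℕ} (hi : i ≤ d) (hn : t + d ≤ n) :
    cnt q n (t + d) (t + i) * ((q : ℝ) ^ d - (q : ℝ) ^ i) =
      ((q : ℝ) ^ (n - t) - (q : ℝ) ^ i) * cnt q n (t + d) (t + i + 1) := by
  have h := cnt_mul q (show t + i ≤ t + d by omega) hn
  have h1 := qInt_mul_sub_one_real q (t + d - (t + i))
  have h2 := qInt_mul_sub_one_real q (n - (t + i))
  have e1 : (q : ℝ) ^ d = (q : ℝ) ^ i * (q : ℝ) ^ (t + d - (t + i)) := by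
    rw [← pow_add]; congr 1; omega
  have e2 : (q : ℝ) ^ (n - t) = (q : ℝ) ^ i * (q : ℝ) ^ (n - (t + i)) := by
    rw [← pow_add]; congr 1; omega
  rw [e1, e2]
  linear_combination (q : ℝ) ^ i * ((q : ℝ) - 1) * h -
    (q : ℝ) ^ i * cnt q n (t + d) (t + i) * h1 + (q : ℝ) ^ i * cnt q n (t + d) (t + i + 1) * h2

/-- The numerical inequalities by which a set of `N` spaces outnumbers the families that are not of
the form `familyH`. -/
structure Dominates (q n t d : ℕ) (N : ℝ) : Prop where
  -- `star` serves minimal quasi-cover dimension `t + 1`, `contain` and `transversal` serve `t + 2`,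
  -- `deep` serves everything larger.
  star : (qInt q d : ℝ) * cnt q n (t + d) (t + 1) +
    qInt q (t + 1) * (theta q d ^ 2 * cnt q n (t + d) (t + 2)) ≤ N
  contain : (qInt q 3 : ℝ) * (theta q d ^ 2 * cnt q n (t + d) (t + 2)) +
    gb q (t + 2) 2 * (theta q d ^ 3 * cnt q n (t + d) (t + 3)) ≤ N
  deep : gb q (t + 3) 3 * (theta q d ^ 3 * cnt q n (t + d) (t + 3)) ≤ N
  -- The extra `1` and the strictness occur because this bound counts members other than `U₁, U₂`,
  -- so that `|𝓕|` may exceed it by three.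
  transversal : (qInt q (t + 2) : ℝ) * (theta q d * cnt q n (t + d) (t + 2)) +
    (((q : ℝ) + 1) ^ 2 + 2) * (theta q d ^ 2 * cnt q n (t + d) (t + 2)) +
    2 * (qInt q t * ((q : ℝ) ^ 2 + q) * (q * (theta q d * cnt q n (t + d) (t + 2)))) +
    gb q (t + 2) 2 * ((qInt q (d + 1) : ℝ) ^ 3 * cnt q n (t + d) (t + 3)) + 1 < N

lemma dominates_two {n t d : ℕ} (ht : 2 ≤ t) (hd : 2 ≤ d) (hn : 2 * (t + d) + t + 1 ≤ n)
    {N : ℝ} (hN : (qInt 2 (d + 1) : ℝ) * cnt 2 n (t + d) (t + 1) ≤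
      N + qInt 2 (d + 1) * ((qInt 2 (d + 1) : ℝ) - 1) / 2 * cnt 2 n (t + d) (t + 2)) :
    Dominates 2 n t d N := by
  have hq (i : ℕ) : (qInt 2 i : ℝ) = 2 ^ i - 1 := by
    have := qInt_mul_sub_one_real 2 i
    push_cast at this
    linarith
  have hD := cnt_ratio 2 (show 1 ≤ d by omega) (show t + d ≤ n by omega)
  have hD'' := cnt_ratio 2 hd (show t + d ≤ n by omega)
  have hD'1 := one_le_cnt 2 (show t + 2 ≤ t + d by omega) (show t + d ≤ n by omega)
  have hD''0 := cnt_nonneg 2 (show t + d ≤ n by omega) (t + 3)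
  have hg₂ := gb_two_right 2 t
  have hg₃ := gb_three_right 2 t
  have hY : 2 * ((2 : ℝ) ^ d) ^ 2 * ((2 : ℝ) ^ t) ^ 2 ≤ (2 : ℝ) ^ (n - t) := by
    have : 2 * ((2 : ℝ) ^ d) ^ 2 * ((2 : ℝ) ^ t) ^ 2 = (2 : ℝ) ^ (2 * t + 2 * d + 1) := by ring
    rw [this]
    exact pow_le_pow_right₀ (by norm_num) (by omega)
  have hx : (4 : ℝ) ≤ 2 ^ t := by
    calc (4 : ℝ) = 2 ^ 2 := by norm_num
      _ ≤ _ := pow_le_pow_right₀ (by norm_num) ht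
  have ha : (2 : ℝ) ^ d = 4 ∨ (8 : ℝ) ≤ 2 ^ d := by
    rcases hd.eq_or_lt with rfl | h
    · left; norm_num
    · right
      calc (8 : ℝ) = 2 ^ 3 := by norm_num
        _ ≤ _ := pow_le_pow_right₀ (by norm_num) h
  have ha4 : (4 : ℝ) ≤ 2 ^ d := by rcases ha with h | h <;> linarith
  have hp : (qInt 2 (d + 1) : ℝ) = 2 * 2 ^ d - 1 := by rw [hq]; ring
  have hθ : theta 2 d = 2 * 2 ^ d := by rw [theta, hp]; ring
  have hb₁ : (qInt 2 (t + 1) : ℝ) = 2 * 2 ^ t - 1 := by rw [hq]; ring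
  have hb₂ : (qInt 2 (t + 2) : ℝ) = 4 * 2 ^ t - 1 := by rw [hq]; ring
  have hb₃ : (qInt 2 (t + 3) : ℝ) = 8 * 2 ^ t - 1 := by rw [hq]; ring
  have h3 : (qInt 2 3 : ℝ) = 7 := by rw [hq]; norm_num
  rw [hb₁, hb₂] at hg₂
  rw [hb₃] at hg₃
  push_cast at hD hD'' hg₂ hg₃
  rw [pow_one] at hD
  norm_num at hD'' hg₂ hg₃
  rw [hp] at hN
  have hg₂u : gb 2 (t + 2) 2 ≤ 8 / 3 * (2 ^ t) ^ 2 := by nlinarith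
  have hg₃u : gb 2 (t + 3) 3 ≤ 64 / 21 * (2 ^ t) ^ 3 := by
    have h8 : (8 * (2 : ℝ) ^ t - 1) * gb 2 (t + 2) 2 ≤ (8 * 2 ^ t) * (8 / 3 * (2 ^ t) ^ 2) :=
      mul_le_mul (by linarith) hg₂u (gb_pos (by omega)).le (by linarith)
    linarith
  have hD'0 : 0 ≤ cnt 2 n (t + d) (t + 2) := by linarith
  have hlow := ratio_lower_two hx ha4 hY hD hD'0
  obtain ⟨hu1, hu2⟩ := ratio_upper_two hx ha4 hY hD'' hD'0 hD''0
  refine ⟨?_, ?_, ?_, ?_⟩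
  · rw [hq d, hb₁, hθ]
    exact star_inequality_two hx ha4 hD'0 hlow hN
  · rw [h3, hθ]
    exact contain_inequality_two hx ha4 hD'0 hD''0 hg₂u hlow hu2 hN
  · rw [hθ]
    exact deep_inequality_two hx ha4 hD'0 hD''0 hg₃u hlow hu2 hN
  · rw [hb₂, hθ, hp, hq t]
    push_cast
    exact transversal_inequality_two hx ha hY hD hD'1 hD''0 (by linarith) hu1 hN

lemma dominates_of_three_le {q n t d : ℕ} (hq : 3 ≤ q) (ht : 2 ≤ t) (hd : 2 ≤ d)
    (hn : 2 * (t + d) + t ≤ n)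
    {N : ℝ} (hN : (qInt q (d + 1) : ℝ) * cnt q n (t + d) (t + 1) ≤
      N + qInt q (d + 1) * ((qInt q (d + 1) : ℝ) - 1) / 2 * cnt q n (t + d) (t + 2)) :
    Dominates q n t d N := by
  have hQ : (3 : ℝ) ≤ q := by exact_mod_cast hq
  have hQ1 : (1 : ℝ) ≤ q := by linarith
  have hD := cnt_ratio q (show 1 ≤ d by omega) (show t + d ≤ n by omega)
  have hD'' := cnt_ratio q hd (show t + d ≤ n by omega)
  rw [pow_one] at hD
  have hD'1 := one_le_cnt q (show t + 2 ≤ t + d by omega) (show t + d ≤ n by omega)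
  have hD'0 : 0 ≤ cnt q n (t + d) (t + 2) := by linarith
  have hD''0 := cnt_nonneg q (show t + d ≤ n by omega) (t + 3)
  have hY : ((q : ℝ) ^ d) ^ 2 * ((q : ℝ) ^ t) ^ 2 ≤ (q : ℝ) ^ (n - t) := by
    have : ((q : ℝ) ^ d) ^ 2 * ((q : ℝ) ^ t) ^ 2 = (q : ℝ) ^ (2 * t + 2 * d) := by ring
    rw [this]
    exact pow_le_pow_right₀ hQ1 (by omega)
  have hx : (q : ℝ) ^ 2 ≤ (q : ℝ) ^ t := pow_le_pow_right₀ hQ1 ht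
  have ha : (q : ℝ) ^ 2 ≤ (q : ℝ) ^ d := pow_le_pow_right₀ hQ1 hd
  have hx9 : (9 : ℝ) ≤ (q : ℝ) ^ t := by nlinarith
  have ha9 : (9 : ℝ) ≤ (q : ℝ) ^ d := by nlinarith
  have hp : (qInt q (d + 1) : ℝ) * ((q : ℝ) - 1) = q * (q : ℝ) ^ d - 1 := by
    rw [qInt_mul_sub_one_real]; ring
  have hb₁ : (qInt q (t + 1) : ℝ) * ((q : ℝ) - 1) = q * (q : ℝ) ^ t - 1 := by
    rw [qInt_mul_sub_one_real]; ring
  have hb₂ : (qInt q (t + 2) : ℝ) * ((q : ℝ) - 1) = (q : ℝ) ^ 2 * (q : ℝ) ^ t - 1 := by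
    rw [qInt_mul_sub_one_real]; ring
  have hb₃ : (qInt q (t + 3) : ℝ) * ((q : ℝ) - 1) = (q : ℝ) ^ 3 * (q : ℝ) ^ t - 1 := by
    rw [qInt_mul_sub_one_real]; ring
  have hqd : (qInt q d : ℝ) = qInt q (d + 1) - (q : ℝ) ^ d := by
    rw [qInt, qInt, Finset.sum_range_succ]; push_cast; ring
  have h3 : (qInt q 3 : ℝ) = (q : ℝ) ^ 2 + q + 1 := by rw [qInt_three]; push_cast; ring
  obtain ⟨hp1, hp2, hp3⟩ := bounds_p hQ ha hp
  have hg₂ := bound_g_two hQ hx hb₁ hb₂ (gb_two_right q t)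
  have hg₃ := bound_g_three hQ hx hg₂ (gb_pos (by omega)).le hb₃ (gb_three_right q t)
  have hlow := ratio_lower hQ ha hY hx hD hD'0
  have hup := ratio_upper hQ ha hY hx hD'' hD'0 hD''0
  refine ⟨?_, ?_, ?_, ?_⟩
  · rw [hqd]
    exact star_inequality hQ ha9 hx9 hp1 hp2 hp3 hb₁ hD'0 hlow hN
  · rw [h3]
    exact contain_inequality hQ hx ha9 hx9 hp1 hp2 hp3 hg₂ hD'0 hD''0 hlow hup hN
  · exact deep_inequality ha9 hx9 hp1 hp2 hp3 hg₃ hD'0 hD''0 hlow hup hN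
  · exact transversal_inequality hQ hx ha9 hx9 hp1 hp2 hp3 hg₂ (bound_b_two hQ hx hb₂)
      (bound_b_zero hQ hx (qInt_mul_sub_one_real q t)) hD'1 hD''0 hlow hup hN

lemma qInt_add (q i j : ℕ) : qInt q (i + j) = qInt q i + q ^ i * qInt q j := by
  rw [qInt, Finset.sum_range_add, qInt, qInt, Finset.mul_sum]
  simp only [pow_add]

lemma qInt_lt_pow {q : ℕ} (hq : 2 ≤ q) (i : ℕ) : qInt q i < q ^ i := by
  induction i with
  | zero => simp [qInt_zero]
  | succ i ih =>
    have h : qInt q (i + 1) = qInt q i + q ^ i := by rw [qInt, qInt, Finset.sum_range_succ]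
    rw [h, pow_succ]
    nlinarith

/-- The bound for families with minimal quasi-covers of dimension `m` decreases with `m`. -/
lemma minimal_cover_bound_succ_le {q n k t m : ℕ} (hq : 2 ≤ q) (htm : t ≤ m) (hmk : m < k)
    (hn : 2 * k + 2 ≤ n) :
    gb q (m + 1) t * (theta q (k - t) ^ (m + 1 - t) * cnt q n k (m + 1)) ≤
      gb q m t * (theta q (k - t) ^ (m - t) * cnt q n k m) := by
  obtain ⟨e, rfl⟩ : ∃ e, m = t + e := ⟨m - t, by omega⟩
  have h1 := gb_succ_left_mul q (show t ≤ t + e by omega)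
  have h2 := cnt_mul q hmk.le (show k ≤ n by omega)
  rw [show t + e + 1 - t = e + 1 by omega] at h1 ⊢
  rw [show t + e - t = e by omega]
  -- Consecutive bounds have ratio `([m+1] / [m+1-t]) * θ * ([k-m] / [n-m])`. The three factors are
  -- at most `2q^t`, `q^(k-t+1)` and `q^(-(n-k))`, and `n ≥ 2k + 2` makes the product at most `1`.
  have h3 : qInt q (t + e + 1) ≤ 2 * q ^ t * qInt q (e + 1) := by
    rw [add_assoc, qInt_add]
    have h4 := qInt_lt_pow hq t
    have h5 : 0 < qInt q (e + 1) := qInt_pos (by omega)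
    nlinarith [pow_pos (show 0 < q by omega) t]
  have h4 : q ^ (n - k) * qInt q (k - (t + e)) ≤ qInt q (n - (t + e)) := by
    rw [show n - (t + e) = (n - k) + (k - (t + e)) by omega, qInt_add]
    omega
  have h5 : theta q (k - t) ≤ q ^ (k - t + 1) := by
    rw [theta]
    exact_mod_cast qInt_lt_pow hq (k - t + 1)
  have h6 : (2 * q ^ t : ℝ) * q ^ (k - t + 1) ≤ q ^ (n - k) := by
    have hq' : (2 : ℝ) ≤ q := by exact_mod_cast hq
    calc (2 * q ^ t : ℝ) * q ^ (k - t + 1) ≤ q * q ^ t * q ^ (k - t + 1) := by gcongr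
      _ = q ^ (1 + t + (k - t + 1)) := by ring
      _ ≤ _ := pow_le_pow_right₀ (by linarith) (by omega)
  have h3' : (qInt q (t + e + 1) : ℝ) ≤ 2 * q ^ t * qInt q (e + 1) := by exact_mod_cast h3
  have h4' : (q ^ (n - k) * qInt q (k - (t + e)) : ℝ) ≤ qInt q (n - (t + e)) := by
    exact_mod_cast h4
  have hpos1 : (0 : ℝ) < qInt q (e + 1) := by exact_mod_cast qInt_pos (by omega)
  have hpos2 : (0 : ℝ) < qInt q (k - (t + e)) := by exact_mod_cast qInt_pos (by omega)
  have hθ := one_le_theta q (k - t)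
  have hc := cnt_nonneg q (show k ≤ n by omega) (t + e + 1)
  have hg : 0 ≤ gb q (t + e) t := (gb_pos (by omega)).le
  refine le_of_mul_le_mul_right (a := (qInt q (e + 1) : ℝ) * qInt q (k - (t + e))) ?_
    (mul_pos hpos1 hpos2)
  set θ := theta q (k - t)
  calc gb q (t + e + 1) t * (θ ^ (e + 1) * cnt q n k (t + e + 1)) *
        (qInt q (e + 1) * qInt q (k - (t + e)))
      = (gb q (t + e + 1) t * qInt q (e + 1)) *
          (θ ^ (e + 1) * cnt q n k (t + e + 1) * qInt q (k - (t + e))) := by ring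
    _ = gb q (t + e) t * θ ^ e * cnt q n k (t + e + 1) *
          (qInt q (t + e + 1) * θ * qInt q (k - (t + e))) := by rw [h1]; ring
    _ ≤ gb q (t + e) t * θ ^ e * cnt q n k (t + e + 1) *
          ((2 * q ^ t * qInt q (e + 1)) * q ^ (k - t + 1) * qInt q (k - (t + e))) := by
        gcongr
    _ = gb q (t + e) t * θ ^ e * cnt q n k (t + e + 1) * qInt q (e + 1) *
          ((2 * q ^ t * q ^ (k - t + 1)) * qInt q (k - (t + e))) := by ring
    _ ≤ gb q (t + e) t * θ ^ e * cnt q n k (t + e + 1) * qInt q (e + 1) *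
          (q ^ (n - k) * qInt q (k - (t + e))) := by gcongr
    _ ≤ gb q (t + e) t * θ ^ e * cnt q n k (t + e + 1) * qInt q (e + 1) *
          qInt q (n - (t + e)) := by gcongr
    _ = gb q (t + e) t * (θ ^ e * (qInt q (n - (t + e)) * cnt q n k (t + e + 1))) *
          qInt q (e + 1) := by ring
    _ = _ := by rw [← h2]; ring

lemma minimal_cover_bound_le {q n k t m : ℕ} (hq : 2 ≤ q) (hm : t + 3 ≤ m) (hmk : m ≤ k)
    (hn : 2 * k + 2 ≤ n) :
    gb q m t * (theta q (k - t) ^ (m - t) * cnt q n k m) ≤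
      gb q (t + 3) 3 * (theta q (k - t) ^ 3 * cnt q n k (t + 3)) := by
  induction m, hm using Nat.le_induction with
  | base => rw [gb_symm, show t + 3 - t = 3 by omega]
  | succ m hm ih =>
    exact (minimal_cover_bound_succ_le hq (by omega) (by omega) hn).trans (ih (by omega))

lemma IsBadPair.isTransversal {K V : Type*} [Field K] [AddCommGroup V] [Module K V]
    [FiniteDimensional K V] {k t : ℕ} {𝓕 : Set (Submodule K V)} {U₁ U₂ : Submodule K V}
    (h : IsBadPair k t 𝓕 U₁ U₂) {S : Submodule K V}
    (hS : dm S = t + 2) (h1 : t ≤ dm (S ⊓ U₁)) (h2 : t ≤ dm (S ⊓ U₂))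
    (hW : dm (S ⊓ (U₁ ⊓ U₂)) + 2 ≤ t) : IsTransversal k t U₁ U₂ S := by
  have h3 := dm_sup_add_inf (S ⊓ U₁) (S ⊓ U₂)
  rw [← inf_inf_distrib_left] at h3
  have h4 : dm ((S ⊓ U₁) ⊔ (S ⊓ U₂)) ≤ dm S := dm_mono (sup_le inf_le_left inf_le_left)
  exact ⟨h.dm_left, h.dm_right, h.lt, hS, by omega, by omega, by omega⟩

/-! ### The case `k ≥ t + 2`. -/

section LargeDimension

variable {K V : Type*} [Field K] [AddCommGroup V] [Module K V] [FiniteDimensional K V] [Finite K]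
  {t d : ℕ} {𝓕 : Set (Submodule K V)} {U₁ U₂ : Submodule K V}

lemma exists_dominates (ht : 2 ≤ t) (hd : 2 ≤ d)
    (hn : 2 * (t + d) + t + (if Nat.card K = 2 then 1 else 0) ≤ Module.finrank K V)
    (hmax : IsMaximumProperAlmost (t + d) t 𝓕) :
    ∃ N : ℝ, N + 2 ≤ 𝓕.ncard ∧ Dominates (Nat.card K) (Module.finrank K V) t d N := by
  obtain ⟨X₁, X₂, E, hX₁, hX₂, hE, hEX, hXE, hX⟩ :=
    exists_familyH_triple (K := K) (V := V) (k := t + d) (t := t) (by omega) (by omega) (by omega)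
  have hEX₂ : E ⊓ X₂ = X₁ ⊓ X₂ :=
    le_antisymm (inf_le_inf_right _ hEX) (le_inf hXE inf_le_right)
  have h1 := hmax.2 _ (familyH_isProperAlmost (by omega) hX₁ hX₂ hE hEX hXE hX)
  rw [ncard_familyH hE hEX (by omega)] at h1
  have h2 := le_ncard_star (K := K) (V := V) (k := t + d) (by omega) (by omega) hE hX₂
    (by rw [hEX₂]; omega)
  rw [Nat.add_sub_cancel_left] at h2
  refine ⟨({F ∈ subspaces K V (t + d) | E ≤ F ∧ t ≤ dm (F ⊓ X₂)}.ncard : ℕ),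
    by exact_mod_cast h1, ?_⟩
  rcases (two_le_card_field K).eq_or_lt with hq | hq
  · rw [← hq] at h2 hn ⊢
    exact dominates_two ht hd (by simpa using hn) h2
  · exact dominates_of_three_le hq ht hd (by omega) h2

lemma Dominates.sq_mul_lt {q n : ℕ} {N : ℝ} (h : Dominates q n t d N) (hd : 2 ≤ d)
    (hn : t + d ≤ n) :
    (qInt q (d + 1) : ℝ) * (qInt q (d + 1) * cnt q n (t + d) (t + 2)) < N := by
  refine lt_of_lt_of_le ?_ h.star
  have h1 : (1 : ℝ) ≤ qInt q d := by exact_mod_cast qInt_pos (by omega)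
  have h2 : (1 : ℝ) ≤ qInt q (t + 1) := by exact_mod_cast qInt_pos (by omega)
  have h3 := one_le_cnt q (show t + 1 ≤ t + d by omega) hn
  have h4 := cnt_nonneg q hn (t + 2)
  have h5 : (0 : ℝ) ≤ qInt q (d + 1) := Nat.cast_nonneg _
  have h6 : (qInt q (d + 1) : ℝ) * (qInt q (d + 1) * cnt q n (t + d) (t + 2)) ≤
      theta q d ^ 2 * cnt q n (t + d) (t + 2) := by
    rw [← mul_assoc, ← sq]
    refine mul_le_mul_of_nonneg_right (pow_le_pow_left₀ h5 ?_ 2) h4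
    rw [theta]; linarith
  have h7 : theta q d ^ 2 * cnt q n (t + d) (t + 2) ≤
      qInt q (t + 1) * (theta q d ^ 2 * cnt q n (t + d) (t + 2)) :=
    le_mul_of_one_le_left (by positivity) h2
  have h8 : 1 * 1 ≤ qInt q d * cnt q n (t + d) (t + 1) :=
    mul_le_mul h1 h3 zero_le_one (by linarith)
  linarith

namespace IsBadPair

lemma ncard_le_ncard_add_two (p : Submodule K V → Prop) :
    {F ∈ 𝓕 | p F}.ncard ≤ {F ∈ 𝓕 | (F ≠ U₁ ∧ F ≠ U₂) ∧ p F}.ncard + 2 := by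
  have := finite_submodule K V
  have h1 : {F ∈ 𝓕 | p F} ⊆ {F ∈ 𝓕 | (F ≠ U₁ ∧ F ≠ U₂) ∧ p F} ∪ {U₁, U₂} := by
    intro F hF
    by_cases h1 : F = U₁
    · exact Or.inr (Or.inl h1)
    by_cases h2 : F = U₂
    · exact Or.inr (Or.inr h2)
    exact Or.inl ⟨hF.1, ⟨h1, h2⟩, hF.2⟩
  have h2 := Set.ncard_le_ncard h1 (Set.toFinite _)
  have h3 := Set.ncard_union_le {F ∈ 𝓕 | (F ≠ U₁ ∧ F ≠ U₂) ∧ p F} {U₁, U₂}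
  have h4 := Set.ncard_insert_le U₁ {U₂}
  rw [Set.ncard_singleton] at h4
  omega

/-- The kernel of a star in a large family nearly meets the second member of the bad pair. -/
lemma dm_inf_of_large_star (h : IsBadPair (t + d) t 𝓕 U₁ U₂) (hd : 2 ≤ d)
    (hn : t + d ≤ Module.finrank K V) {N : ℝ} (hN : N + 2 ≤ 𝓕.ncard)
    (hdom : Dominates (Nat.card K) (Module.finrank K V) t d N) {E : Submodule K V}
    (hE : dm E = t) (hEU : E ≤ U₁) (hstar : ∀ F ∈ 𝓕, F ≠ U₁ → F ≠ U₂ → E ≤ F) :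
    dm (E ⊓ U₂) + 1 = t := by
  have := finite_submodule K V
  have hlt : dm (E ⊓ U₂) < t := (dm_mono (inf_le_inf_right U₂ hEU)).trans_lt h.lt
  -- Otherwise `E` has deficit at least two with `U₂`, and two exception-free branchings bound the
  -- star by `[d+1]² D' < N`.
  by_contra hne
  set 𝓐 := {F ∈ 𝓕 | (F ≠ U₁ ∧ F ≠ U₂) ∧ E ≤ F} with h𝓐
  have hmeet : ∀ F ∈ 𝓐, t ≤ dm (F ⊓ U₂) := fun F hF => h.le_dm_inf_right hF.1 hF.2.1.1
  have h𝓐E : {F ∈ 𝓐 | E ≤ F} = 𝓐 := by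
    ext F
    exact ⟨fun hF => hF.1, fun hF => ⟨hF, hF.2.2⟩⟩
  have h1 : ({F ∈ 𝓐 | E ≤ F}.ncard : ℝ) ≤ qInt (Nat.card K) (dm U₂ - t + 1) *
      (qInt (Nat.card K) (dm U₂ - t + 1) *
        cnt (Nat.card K) (Module.finrank K V) (t + d) (t + 2)) := by
    refine ncard_above_le_mul_of_meets hlt (by rw [h.dm_right]; omega)
      (fun F hF _ => hmeet F hF) (fun C hEC _ hC => ?_)
    refine ncard_above_le_mul_of_meets ?_ (by rw [h.dm_right]; omega)
      (fun F hF _ => hmeet F hF) (fun C' _ _ hC' => ?_)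
    · have := dm_inf_le_succ U₂ hEC hC
      omega
    · have h2 := ncard_above_le (𝓐 := 𝓐) (fun F hF => h.dm_eq F hF.1) hn C'
      rwa [hC', hC, hE] at h2
  rw [h𝓐E, h.dm_right, Nat.add_sub_cancel_left] at h1
  have h2 := hdom.sq_mul_lt hd hn
  have h3 : 𝓕.ncard ≤ 𝓐.ncard + 2 := by
    have h4 := ncard_le_ncard_add_two (𝓕 := 𝓕) (U₁ := U₁) (U₂ := U₂) (fun _ => True)
    have h5 : {F ∈ 𝓕 | True} = 𝓕 := by ext F; simp
    have h6 : {F ∈ 𝓕 | (F ≠ U₁ ∧ F ≠ U₂) ∧ True} = 𝓐 := by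
      ext F
      simp only [h𝓐, Set.mem_ofPred_eq, and_true]
      exact ⟨fun hF => ⟨hF.1, hF.2, hstar F hF.1 hF.2.1 hF.2.2⟩, fun hF => ⟨hF.1, hF.2.1⟩⟩
    rwa [h5, h6] at h4
  have h3' : (𝓕.ncard : ℝ) ≤ 𝓐.ncard + 2 := by exact_mod_cast h3
  linarith

/-- If there were no star, the least dimension `m` of a quasi-cover would select one of the four
bounds, each contradicting `N + 2 ≤ |𝓕|`. -/
theorem exists_star_of_large (h : IsBadPair (t + d) t 𝓕 U₁ U₂) (hd : 2 ≤ d)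
    (hn : 2 * (t + d) + 2 ≤ Module.finrank K V) {N : ℝ} (hN : N + 2 ≤ 𝓕.ncard)
    (hdom : Dominates (Nat.card K) (Module.finrank K V) t d N) :
    (∃ E, E ≤ U₁ ∧ dm E = t ∧ ∀ F ∈ 𝓕, F ≠ U₁ → F ≠ U₂ → E ≤ F) ∨
    (∃ E, E ≤ U₂ ∧ dm E = t ∧ ∀ F ∈ 𝓕, F ≠ U₁ → F ≠ U₂ → E ≤ F) := by
  have := finite_submodule K V
  by_contra! hcon
  obtain ⟨hc1, hc2⟩ := hcon
  have hkn : t + d ≤ Module.finrank K V := by omega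
  have hex : ∃ m, ∃ S, dm S = m ∧ IsQuasiCover t 𝓕 U₁ U₂ S := by
    obtain ⟨E, _, hE, hEt⟩ := exists_between_of_dm (bot_le : ⊥ ≤ U₁) (m := t)
      (by rw [show dm (⊥ : Submodule K V) = 0 from finrank_bot K V]; omega)
      (by rw [h.dm_left]; omega)
    obtain ⟨F, hF, h1, h2, _⟩ := hc1 E hE hEt
    exact ⟨_, F, rfl, h.isQuasiCover_of_mem hF h1 h2⟩
  classical
  obtain ⟨S, hS, hSq⟩ := Nat.find_spec hex
  set m := Nat.find hex with hm
  have hmin : ∀ Q, dm Q < m → ∃ U ∈ 𝓕, dm (Q ⊓ U) < t := fun Q hQ =>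
    h.exists_dm_inf_lt fun hQq => Nat.find_min hex hQ ⟨Q, rfl, hQq⟩
  have hm1 : t + 1 ≤ m := hS ▸ h.succ_le_dm_of_isQuasiCover hSq
  have hmk : m ≤ t + d := by
    by_contra hlt
    obtain ⟨E, _, hE, hEt⟩ := exists_between_of_dm (bot_le : ⊥ ≤ U₁) (m := t)
      (by rw [show dm (⊥ : Submodule K V) = 0 from finrank_bot K V]; omega)
      (by rw [h.dm_left]; omega)
    obtain ⟨F, hF, h1, h2, _⟩ := hc1 E hE hEt
    refine Nat.find_min hex (m := t + d) (by omega) ⟨F, h.dm_eq F hF, ?_⟩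
    exact h.isQuasiCover_of_mem hF h1 h2
  have hsub : t + d - t = d := by omega
  rcases hm1.eq_or_lt with hm1 | hm1
  · have h1 := h.ncard_le_of_cover_succ (by omega) hkn (hS.trans hm1.symm) hSq.2.2 hc1 hc2
    rw [hsub] at h1
    have := hdom.star
    linarith
  rcases (Nat.succ_le_of_lt hm1).eq_or_lt with hm2 | hm2
  · have hm2 : m = t + 2 := hm2.symm
    rw [hm2] at hmin hS
    -- Since `dm (U₁ ⊓ U₂) ≤ t - 1`, the condition says that `Q` contains `U₁ ⊓ U₂` and that this
    -- intersection has dimension `t - 1`. A `Q` violating it is a transversal.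
    by_cases hall : ∀ Q, dm Q = t + 2 → IsQuasiCover t 𝓕 U₁ U₂ Q → t ≤ dm (Q ⊓ (U₁ ⊓ U₂)) + 1
    · have hW := h.lt
      have hcont : ∀ Q, dm Q = t + 2 → IsQuasiCover t 𝓕 U₁ U₂ Q → U₁ ⊓ U₂ ≤ Q := by
        intro Q hQ hQq
        have h1 := hall Q hQ hQq
        exact inf_eq_right.1 (eq_of_le_of_dm_le inf_le_right (by omega))
      have hW1 : dm (U₁ ⊓ U₂) + 1 = t := by
        have h1 := hall S hS hSq
        have h2 : dm (S ⊓ (U₁ ⊓ U₂)) ≤ dm (U₁ ⊓ U₂) := dm_mono inf_le_right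
        omega
      have h1 := h.ncard_le_of_covers_contain (by omega) hkn hS hSq hW1 hmin hcont
      rw [hsub] at h1
      have := hdom.contain
      linarith
    · push Not at hall
      obtain ⟨Q, hQ, hQq, hQW⟩ := hall
      have htr := h.isTransversal hQ hQq.1 hQq.2.1 (by omega)
      set 𝓐 := {F ∈ 𝓕 | (F ≠ U₁ ∧ F ≠ U₂) ∧ t ≤ dm (F ⊓ Q)} with h𝓐
      have hpow : ∀ j R, dm R + j = t + 2 → ({F ∈ 𝓐 | R ≤ F}.ncard : ℝ) ≤
          theta (Nat.card K) (t + d - t) ^ j *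
            cnt (Nat.card K) (Module.finrank K V) (t + d) (t + 2) :=
        ncard_above_le_pow h.dm_eq h.almost (fun F hF => hF.1) (by omega) (by omega) hkn
          (fun Q hQ _ => hmin Q hQ)
      have h1 := htr.ncard_le hkn (𝓐 := 𝓐) (fun F hF => h.dm_eq F hF.1)
        (fun F hF => h.le_dm_inf_left hF.1 hF.2.1.2) (fun F hF => h.le_dm_inf_right hF.1 hF.2.1.1)
        (fun F hF => hF.2.2) (fun T hT => hpow 2 T (by omega)) (fun R hR => hpow 1 R (by omega))
      rw [hsub, pow_one] at h1
      have h2 := hdom.transversal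
      have h3 := ncard_le_add_one hQq.2.2
      have h4 : ({F ∈ 𝓕 | t ≤ dm (F ⊓ Q)}.ncard : ℝ) ≤ 𝓐.ncard + 2 := by
        exact_mod_cast ncard_le_ncard_add_two (𝓕 := 𝓕) (U₁ := U₁) (U₂ := U₂) _
      linarith
  · have h1 := h.ncard_le_of_minimal_cover (by omega) hmk hkn hS hSq.2.2 hmin
    have h2 := minimal_cover_bound_le (two_le_card_field K) hm2 hmk hn
    rw [hsub] at h1 h2
    have := hdom.deep
    linarith

end IsBadPair

theorem exists_eq_familyH_of_add_two_le {k : ℕ} (ht : 2 ≤ t) (hk : t + 2 ≤ k)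
    (hn : 2 * k + t + (if Nat.card K = 2 then 1 else 0) ≤ Module.finrank K V)
    (hmax : IsMaximumProperAlmost k t 𝓕) :
    ∃ U₁ ∈ subspaces K V k, ∃ U₂ ∈ subspaces K V k, ∃ E ∈ subspacesOf U₁ t,
      U₁ ⊓ U₂ ∈ subspacesOf E (t - 1) ∧ 𝓕 = familyH k t U₁ U₂ E := by
  obtain ⟨d, rfl⟩ : ∃ d, k = t + d := ⟨k - t, by omega⟩
  have hd : 2 ≤ d := by omega
  obtain ⟨N, hN, hdom⟩ := exists_dominates ht hd hn hmax
  obtain ⟨U₁, U₂, h⟩ := hmax.1.exists_isBadPair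
  rcases h.exists_star_of_large hd (by omega) hN hdom with ⟨E, hEU, hE, hst⟩ | ⟨E, hEU, hE, hst⟩
  · exact ⟨U₁, mem_subspaces.2 h.dm_left, U₂, mem_subspaces.2 h.dm_right, E, ⟨hEU, hE⟩,
      h.eq_familyH hmax hE hEU
        (h.dm_inf_of_large_star hd (by omega) hN hdom hE hEU hst) hst⟩
  · have hst' : ∀ F ∈ 𝓕, F ≠ U₂ → F ≠ U₁ → E ≤ F := fun F hF h2 h1 => hst F hF h1 h2
    exact ⟨U₂, mem_subspaces.2 h.dm_right, U₁, mem_subspaces.2 h.dm_left, E, ⟨hEU, hE⟩,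
      h.symm.eq_familyH hmax hE hEU
        (h.symm.dm_inf_of_large_star hd (by omega) hN hdom hE hEU hst') hst'⟩

end LargeDimension

/-! ### The case `k = t + 1`. -/

section Grid

variable {K V : Type*} [Field K] [AddCommGroup V] [Module K V]
  {t : ℕ} {𝓕 : Set (Submodule K V)} {U₁ U₂ U₃ U₄ A A' B B' : Submodule K V}

lemma sup_inf_left_of_pts (hW : U₁ ⊓ U₂ ≤ A) (hA : A ≤ U₁) (hB : B ≤ U₂) :
    (A ⊔ B) ⊓ U₁ = A := by
  rw [sup_inf_assoc_of_le B hA]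
  exact sup_eq_left.2 ((le_inf inf_le_right (inf_le_left.trans hB)).trans hW)

lemma sup_inf_right_of_pts (hW : U₁ ⊓ U₂ ≤ B) (hA : A ≤ U₁) (hB : B ≤ U₂) :
    (A ⊔ B) ⊓ U₂ = B := by
  rw [sup_comm]
  exact sup_inf_left_of_pts (U₂ := U₁) (by rwa [inf_comm]) hB hA

lemma ncard_familyG_le : (familyG U₁ U₂ U₃ U₄).ncard ≤ 6 := by
  rw [familyG]
  have h1 := Set.ncard_insert_le U₁ {U₂, U₃, U₄, (U₃ ⊓ U₁) ⊔ (U₄ ⊓ U₂), (U₄ ⊓ U₁) ⊔ (U₃ ⊓ U₂)}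
  have h2 := Set.ncard_insert_le U₂ {U₃, U₄, (U₃ ⊓ U₁) ⊔ (U₄ ⊓ U₂), (U₄ ⊓ U₁) ⊔ (U₃ ⊓ U₂)}
  have h3 := Set.ncard_insert_le U₃ {U₄, (U₃ ⊓ U₁) ⊔ (U₄ ⊓ U₂), (U₄ ⊓ U₁) ⊔ (U₃ ⊓ U₂)}
  have h4 := Set.ncard_insert_le U₄ {(U₃ ⊓ U₁) ⊔ (U₄ ⊓ U₂), (U₄ ⊓ U₁) ⊔ (U₃ ⊓ U₂)}
  have h5 := Set.ncard_insert_le ((U₃ ⊓ U₁) ⊔ (U₄ ⊓ U₂)) {(U₄ ⊓ U₁) ⊔ (U₃ ⊓ U₂)}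
  rw [Set.ncard_singleton] at h5
  omega

lemma ncard_grid (h1 : dm U₁ = t + 1) (h2 : dm U₂ = t + 1) (hW : dm (U₁ ⊓ U₂) + 1 = t)
    (hA : A ∈ pts (U₁ ⊓ U₂) U₁) (hA' : A' ∈ pts (U₁ ⊓ U₂) U₁)
    (hB : B ∈ pts (U₁ ⊓ U₂) U₂) (hB' : B' ∈ pts (U₁ ⊓ U₂) U₂) (hAA' : A ≠ A') (hBB' : B ≠ B') :
    ({U₁, U₂, A ⊔ B, A' ⊔ B', A ⊔ B', A' ⊔ B} : Set (Submodule K V)).ncard = 6 := by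
  have key : ∀ X ∈ pts (U₁ ⊓ U₂) U₁, ∀ Y ∈ pts (U₁ ⊓ U₂) U₂,
      (X ⊔ Y) ⊓ U₁ = X ∧ (X ⊔ Y) ⊓ U₂ = Y ∧ U₁ ≠ X ⊔ Y ∧ U₂ ≠ X ⊔ Y := by
    intro X hX Y hY
    have h3 := sup_inf_left_of_pts hX.1 hX.2.1 hY.2.1
    have h4 := sup_inf_right_of_pts hY.1 hX.2.1 hY.2.1
    refine ⟨h3, h4, fun h => ?_, fun h => ?_⟩
    · have h5 := hY.2.2
      rw [← h4, ← h] at h5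
      omega
    · have h5 := hX.2.2
      rw [← h3, ← h, inf_comm] at h5
      omega
  have hne : U₁ ≠ U₂ := by
    rintro rfl
    rw [inf_idem] at hW
    omega
  obtain ⟨a1, a2, a3, a4⟩ := key A hA B hB
  obtain ⟨b1, b2, b3, b4⟩ := key A' hA' B' hB'
  obtain ⟨c1, c2, c3, c4⟩ := key A hA B' hB'
  obtain ⟨d1, d2, d3, d4⟩ := key A' hA' B hB
  have e1 : A ⊔ B ≠ A' ⊔ B' := fun h => hAA' (by rw [← a1, h, b1])
  have e2 : A ⊔ B ≠ A ⊔ B' := fun h => hBB' (by rw [← a2, h, c2])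
  have e3 : A ⊔ B ≠ A' ⊔ B := fun h => hAA' (by rw [← a1, h, d1])
  have e4 : A' ⊔ B' ≠ A ⊔ B' := fun h => hAA' (by rw [← c1, ← h, b1])
  have e5 : A' ⊔ B' ≠ A' ⊔ B := fun h => hBB' (by rw [← d2, ← h, b2])
  have e6 : A ⊔ B' ≠ A' ⊔ B := fun h => hAA' (by rw [← c1, h, d1])
  rw [Set.ncard_insert_of_notMem (by simp [*]), Set.ncard_insert_of_notMem (by simp [*]),
    Set.ncard_insert_of_notMem (by simp [*]), Set.ncard_insert_of_notMem (by simp [*]),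
    Set.ncard_insert_of_notMem (by simp [*]), Set.ncard_singleton]

variable [FiniteDimensional K V]

/-- Two `(t+1)`-spaces meeting in dimension `t - 1`, together with the four spans of two `t`-spaces
in the first and two `t`-spaces in the second, form an almost `t`-intersecting family. -/
lemma isProperAlmost_grid (h1 : dm U₁ = t + 1) (h2 : dm U₂ = t + 1) (hW : dm (U₁ ⊓ U₂) + 1 = t)
    (hA : A ∈ pts (U₁ ⊓ U₂) U₁) (hA' : A' ∈ pts (U₁ ⊓ U₂) U₁)
    (hB : B ∈ pts (U₁ ⊓ U₂) U₂) (hB' : B' ∈ pts (U₁ ⊓ U₂) U₂) :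
    IsProperAlmost (t + 1) t {U₁, U₂, A ⊔ B, A' ⊔ B', A ⊔ B', A' ⊔ B} := by
  have hdm : ∀ X ∈ pts (U₁ ⊓ U₂) U₁, ∀ Y ∈ pts (U₁ ⊓ U₂) U₂, dm (X ⊔ Y) = t + 1 := by
    intro X hX Y hY
    have h3 := dm_sup_add_inf X Y
    have h4 : X ⊓ Y = U₁ ⊓ U₂ := le_antisymm (inf_le_inf hX.2.1 hY.2.1) (le_inf hX.1 hY.1)
    rw [h4, hX.2.2, hY.2.2] at h3
    omega
  have hmeet : ∀ {X F F' : Submodule K V}, t ≤ dm X → X ≤ F → X ≤ F' → t ≤ dm (F ⊓ F') :=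
    fun hX hF hF' => hX.trans (dm_mono (le_inf hF hF'))
  have tA : t ≤ dm A := by rw [hA.2.2, hW]
  have tA' : t ≤ dm A' := by rw [hA'.2.2, hW]
  have tB : t ≤ dm B := by rw [hB.2.2, hW]
  have tB' : t ≤ dm B' := by rw [hB'.2.2, hW]
  have hall : ∀ F ∈ ({U₁, U₂, A ⊔ B, A' ⊔ B', A ⊔ B', A' ⊔ B} : Set (Submodule K V)),
      dm F = t + 1 := by
    rintro F (rfl | rfl | rfl | rfl | rfl | rfl)
    exacts [h1, h2, hdm A hA B hB, hdm A' hA' B' hB', hdm A hA B' hB', hdm A' hA' B hB]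
  have hself : ∀ F ∈ ({U₁, U₂, A ⊔ B, A' ⊔ B', A ⊔ B', A' ⊔ B} : Set (Submodule K V)),
      t ≤ dm (F ⊓ F) := by
    intro F hF
    rw [inf_idem, hall F hF]; omega
  refine ⟨fun F hF => mem_subspaces.2 (hall F hF), fun F hF => ?_, fun hint => ?_⟩
  -- The partner `P`, the only possible exception for `F`, is the other of `U₁, U₂`, or the opposite
  -- corner of the `2 × 2` square.
  · suffices hP : ∃ P, ∀ F' ∈ ({U₁, U₂, A ⊔ B, A' ⊔ B', A ⊔ B', A' ⊔ B} : Set (Submodule K V)),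
        F' = P ∨ t ≤ dm (F ⊓ F') by
      obtain ⟨P, hP⟩ := hP
      have : ∀ F' ∈ {F' ∈ ({U₁, U₂, A ⊔ B, A' ⊔ B', A ⊔ B', A' ⊔ B} : Set (Submodule K V)) |
          Module.finrank K ↥(F ⊓ F') < t}, F' = P :=
        fun F' hF' => (hP F' hF'.1).resolve_right (not_le.2 hF'.2)
      intro X hX Y hY
      rw [this X hX, this Y hY]
    have hs := hself F hF
    have lA := hA.2.1
    have lA' := hA'.2.1
    have lB := hB.2.1
    have lB' := hB'.2.1
    rcases hF with rfl | rfl | rfl | rfl | rfl | rfl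
    · refine ⟨U₂, ?_⟩
      rintro F (rfl | rfl | rfl | rfl | rfl | rfl)
      exacts [Or.inr hs, Or.inl rfl, Or.inr (hmeet tA lA le_sup_left),
        Or.inr (hmeet tA' lA' le_sup_left), Or.inr (hmeet tA lA le_sup_left),
        Or.inr (hmeet tA' lA' le_sup_left)]
    · refine ⟨U₁, ?_⟩
      rintro F (rfl | rfl | rfl | rfl | rfl | rfl)
      exacts [Or.inl rfl, Or.inr hs, Or.inr (hmeet tB lB le_sup_right),
        Or.inr (hmeet tB' lB' le_sup_right), Or.inr (hmeet tB' lB' le_sup_right),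
        Or.inr (hmeet tB lB le_sup_right)]
    · refine ⟨A' ⊔ B', ?_⟩
      rintro F (rfl | rfl | rfl | rfl | rfl | rfl)
      exacts [Or.inr (hmeet tA le_sup_left lA), Or.inr (hmeet tB le_sup_right lB), Or.inr hs,
        Or.inl rfl, Or.inr (hmeet tA le_sup_left le_sup_left),
        Or.inr (hmeet tB le_sup_right le_sup_right)]
    · refine ⟨A ⊔ B, ?_⟩
      rintro F (rfl | rfl | rfl | rfl | rfl | rfl)
      exacts [Or.inr (hmeet tA' le_sup_left lA'), Or.inr (hmeet tB' le_sup_right lB'), Or.inl rfl,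
        Or.inr hs, Or.inr (hmeet tB' le_sup_right le_sup_right),
        Or.inr (hmeet tA' le_sup_left le_sup_left)]
    · refine ⟨A' ⊔ B, ?_⟩
      rintro F (rfl | rfl | rfl | rfl | rfl | rfl)
      exacts [Or.inr (hmeet tA le_sup_left lA), Or.inr (hmeet tB' le_sup_right lB'),
        Or.inr (hmeet tA le_sup_left le_sup_left), Or.inr (hmeet tB' le_sup_right le_sup_right),
        Or.inr hs, Or.inl rfl]
    · refine ⟨A ⊔ B', ?_⟩
      rintro F (rfl | rfl | rfl | rfl | rfl | rfl)
      exacts [Or.inr (hmeet tA' le_sup_left lA'), Or.inr (hmeet tB le_sup_right lB),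
        Or.inr (hmeet tB le_sup_right le_sup_right), Or.inr (hmeet tA' le_sup_left le_sup_left),
        Or.inl rfl, Or.inr hs]
  · have h3 : t ≤ dm (U₁ ⊓ U₂) := hint U₁ (by simp) U₂ (by simp)
    omega

/-- `U₃` and `U₄` differ in both grid coordinates. Any further member shares a coordinate with each
of them, so it is one of the two remaining corners of their square. -/
lemma IsBadPair.subset_familyG (h : IsBadPair (t + 1) t 𝓕 U₁ U₂) (h' : IsBadPair (t + 1) t 𝓕 U₃ U₄)
    (h31 : U₃ ≠ U₁) (h32 : U₃ ≠ U₂) (h41 : U₄ ≠ U₁) (h42 : U₄ ≠ U₂) :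
    𝓕 ⊆ familyG U₁ U₂ U₃ U₄ := by
  have hcov : ∀ F ∈ 𝓕, F ≠ U₁ → F ≠ U₂ → t ≤ dm (F ⊓ U₁) ∧ t ≤ dm (F ⊓ U₂) := fun F hF h1 h2 =>
    ⟨h.le_dm_inf_left hF h2, h.le_dm_inf_right hF h1⟩
  obtain ⟨c31, c32⟩ := hcov U₃ h'.left_mem h31 h32
  obtain ⟨c41, c42⟩ := hcov U₄ h'.right_mem h41 h42
  have hlt := h'.lt
  have hA : U₃ ⊓ U₁ ≠ U₄ ⊓ U₁ := fun heq => by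
    have := dm_mono (le_inf inf_le_left (heq ▸ inf_le_left) : U₃ ⊓ U₁ ≤ U₃ ⊓ U₄)
    omega
  have hB : U₃ ⊓ U₂ ≠ U₄ ⊓ U₂ := fun heq => by
    have := dm_mono (le_inf inf_le_left (heq ▸ inf_le_left) : U₃ ⊓ U₂ ≤ U₃ ⊓ U₄)
    omega
  intro F hF
  by_cases h1 : F = U₁
  · exact Or.inl h1
  by_cases h2 : F = U₂
  · exact Or.inr (Or.inl h2)
  by_cases h3 : F = U₃
  · exact Or.inr (Or.inr (Or.inl h3))
  by_cases h4 : F = U₄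
  · exact Or.inr (Or.inr (Or.inr (Or.inl h4)))
  obtain ⟨c1, c2⟩ := hcov F hF h1 h2
  have hd := h.dm_eq F hF
  obtain ⟨_, _, _, _, hsup⟩ := structure_of_cover h.lt hd c1 c2
  have e3 := inf_eq_or_inf_eq_of_cover h.lt hd (h.dm_eq _ h'.left_mem) c1 c2 c31 c32
    (h'.le_dm_inf_left hF h4)
  have e4 := inf_eq_or_inf_eq_of_cover h.lt hd (h.dm_eq _ h'.right_mem) c1 c2 c41 c42
    (h'.le_dm_inf_right hF h3)
  rw [familyG]
  rcases e3 with e3 | e3 <;> rcases e4 with e4 | e4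
  · exact absurd (e3.symm.trans e4) hA
  · rw [e3, e4] at hsup
    simp [← hsup]
  · rw [e3, e4] at hsup
    simp [← hsup]
  · exact absurd (e3.symm.trans e4) hB

lemma exists_ne_of_pts [Finite K] {W U : Submodule K V} (hWU : W ≤ U) (hd : dm W + 2 = dm U) :
    ∃ A ∈ pts W U, ∃ A' ∈ pts W U, A ≠ A' := by
  have h1 := ncard_pts hWU
  rw [← hd, Nat.add_sub_cancel_left, qInt_two] at h1
  have := finite_submodule K V
  have h2 : 1 < (pts W U).ncard := by have := two_le_card_field K; omega
  obtain ⟨A, hA, A', hA', hne⟩ := (Set.one_lt_ncard (Set.toFinite _)).1 h2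
  exact ⟨A, hA, A', hA', hne⟩

variable [Finite K]

lemma IsMaximumProperAlmost.six_le_ncard (ht : 1 ≤ t) (hn : t + 3 ≤ Module.finrank K V)
    (hmax : IsMaximumProperAlmost (t + 1) t 𝓕) : 6 ≤ 𝓕.ncard := by
  obtain ⟨X₁, X₂, E, hX₁, hX₂, _, _, _, hX⟩ :=
    exists_familyH_triple (K := K) (V := V) (k := t + 1) (t := t) (by omega) (by omega) (by omega)
  obtain ⟨A, hA, A', hA', hAA'⟩ := exists_ne_of_pts (W := X₁ ⊓ X₂) (U := X₁) inf_le_left (by omega)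
  obtain ⟨B, hB, B', hB', hBB'⟩ := exists_ne_of_pts (W := X₁ ⊓ X₂) (U := X₂) inf_le_right (by omega)
  have hW : dm (X₁ ⊓ X₂) + 1 = t := by omega
  have h1 := hmax.2 _ (isProperAlmost_grid hX₁ hX₂ hW hA hA' hB hB')
  rwa [ncard_grid hX₁ hX₂ hW hA hA' hB hB' hAA' hBB'] at h1

lemma IsMaximumProperAlmost.card_add_three_le_ncard (ht : 1 ≤ t)
    (hn : t + 3 ≤ Module.finrank K V) (hmax : IsMaximumProperAlmost (t + 1) t 𝓕) :
    Nat.card K + 3 ≤ 𝓕.ncard := by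
  have := finite_submodule K V
  obtain ⟨X₁, X₂, E, hX₁, hX₂, hE, hEX, hXE, hX⟩ :=
    exists_familyH_triple (K := K) (V := V) (k := t + 1) (t := t) (by omega) (by omega) (by omega)
  have hEX₂ : E ⊓ X₂ = X₁ ⊓ X₂ :=
    le_antisymm (inf_le_inf_right _ hEX) (le_inf hXE inf_le_right)
  have h1 := hmax.2 _ (familyH_isProperAlmost (by omega) hX₁ hX₂ hE hEX hXE hX)
  rw [ncard_familyH hE hEX (by omega)] at h1
  have hs := dm_sup_add_inf E X₂
  rw [hEX₂] at hs
  have h2 := ncard_pts (le_sup_left : E ≤ E ⊔ X₂)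
  rw [show dm (E ⊔ X₂) - dm E = 2 by omega, qInt_two] at h2
  have h3 : (pts E (E ⊔ X₂)).ncard ≤
      {F ∈ subspaces K V (t + 1) | E ≤ F ∧ t ≤ dm (F ⊓ X₂)}.ncard := by
    refine Set.ncard_le_ncard (fun F hF => ?_) (Set.toFinite _)
    obtain ⟨hEF, hFE, hF⟩ := hF
    have h4 := dm_sup_add_inf F X₂
    have h5 : dm (F ⊔ X₂) ≤ dm (E ⊔ X₂) := dm_mono (sup_le hFE le_sup_right)
    exact ⟨mem_subspaces.2 (by omega), hEF, by omega⟩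
  omega

namespace IsBadPair

lemma ncard_le_of_star_succ (h : IsBadPair (t + 1) t 𝓕 U₁ U₂) {E : Submodule K V} (hE : dm E = t)
    (hEU : E ≤ U₁) (hEU₂ : dm (E ⊓ U₂) + 1 = t)
    (hstar : ∀ F ∈ 𝓕, F ≠ U₁ → F ≠ U₂ → E ≤ F) : 𝓕.ncard ≤ Nat.card K + 3 := by
  have := finite_submodule K V
  have hs := dm_sup_add_inf E U₂
  have hU₂ := h.dm_right
  have h1 := ncard_pts (le_sup_left : E ≤ E ⊔ U₂)
  rw [show dm (E ⊔ U₂) - dm E = 2 by omega, qInt_two] at h1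
  have h2 : 𝓕 ⊆ pts E (E ⊔ U₂) ∪ {U₁, U₂} := by
    intro F hF
    by_cases hF1 : F = U₁
    · exact Or.inr (Or.inl hF1)
    by_cases hF2 : F = U₂
    · exact Or.inr (Or.inr hF2)
    have hd := h.dm_eq F hF
    obtain ⟨_, _, hd1, _, hsup⟩ := structure_of_cover h.lt hd (h.le_dm_inf_left hF hF2)
      (h.le_dm_inf_right hF hF1)
    have hEF := hstar F hF hF1 hF2
    have hFE : E = F ⊓ U₁ := eq_of_le_of_dm_le (le_inf hEF hEU) (by omega)
    refine Or.inl ⟨hEF, ?_, by omega⟩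
    rw [← hsup, ← hFE]
    exact sup_le_sup_left inf_le_right E
  have h3 := Set.ncard_le_ncard h2 (Set.toFinite _)
  have h4 := Set.ncard_union_le (pts E (E ⊔ U₂)) {U₁, U₂}
  have h5 := Set.ncard_insert_le U₁ {U₂}
  rw [Set.ncard_singleton] at h5
  omega

lemma exists_familyH_of_inf_eq (h : IsBadPair (t + 1) t 𝓕 U₁ U₂)
    (hmax : IsMaximumProperAlmost (t + 1) t 𝓕) {F₀ : Submodule K V} (hF₀ : F₀ ∈ 𝓕)
    (h1 : F₀ ≠ U₁) (h2 : F₀ ≠ U₂)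
    (heq : ∀ F ∈ 𝓕, F ≠ U₁ → F ≠ U₂ → F ⊓ U₁ = F₀ ⊓ U₁) :
    𝓕.ncard ≤ Nat.card K + 3 ∧ ∃ E ∈ subspacesOf U₁ t,
      U₁ ⊓ U₂ ∈ subspacesOf E (t - 1) ∧ 𝓕 = familyH (t + 1) t U₁ U₂ E := by
  obtain ⟨hW, hWd, hd1, _, _⟩ := structure_of_cover h.lt (h.dm_eq F₀ hF₀) (h.le_dm_inf_left hF₀ h2)
    (h.le_dm_inf_right hF₀ h1)
  have hEU₂ : dm ((F₀ ⊓ U₁) ⊓ U₂) + 1 = t := by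
    rwa [inf_assoc, inf_eq_right.2 hW]
  have hstar : ∀ F ∈ 𝓕, F ≠ U₁ → F ≠ U₂ → F₀ ⊓ U₁ ≤ F := fun F hF hF1 hF2 =>
    heq F hF hF1 hF2 ▸ inf_le_left
  exact ⟨h.ncard_le_of_star_succ hd1 inf_le_right hEU₂ hstar, F₀ ⊓ U₁, ⟨inf_le_right, hd1⟩,
    h.eq_familyH hmax hd1 inf_le_right hEU₂ hstar⟩

end IsBadPair

/-- Both constructions are available, so `|𝓕|` is at least `6` and at least `q + 3`. A family on a
line has at most `q + 3` members, hence `q ≥ 3`; a family in a square has at most `6`, hence `q ≤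
3`. -/
theorem eq_familyH_or_eq_familyG (ht : 1 ≤ t) (hn : t + 3 ≤ Module.finrank K V)
    (hmax : IsMaximumProperAlmost (t + 1) t 𝓕) :
    (3 ≤ Nat.card K ∧
      ∃ U₁ ∈ subspaces K V (t + 1), ∃ U₂ ∈ subspaces K V (t + 1), ∃ E ∈ subspacesOf U₁ t,
        U₁ ⊓ U₂ ∈ subspacesOf E (t - 1) ∧ 𝓕 = familyH (t + 1) t U₁ U₂ E) ∨
    (Nat.card K ≤ 3 ∧
      ∃ U₁ ∈ subspaces K V (t + 1), ∃ U₂ ∈ subspaces K V (t + 1),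
      ∃ U₃ ∈ subspaces K V (t + 1), ∃ U₄ ∈ subspaces K V (t + 1),
        U₁ ⊓ U₂ = U₃ ⊓ U₄ ∧ U₁ ⊓ U₂ ∈ subspaces K V (t - 1) ∧
        dm (U₁ ⊓ U₃) = t ∧ dm (U₁ ⊓ U₄) = t ∧ dm (U₂ ⊓ U₃) = t ∧ dm (U₂ ⊓ U₄) = t ∧
        𝓕 = familyG U₁ U₂ U₃ U₄) := by
  have := finite_submodule K V
  have h6 := hmax.six_le_ncard ht hn
  have hq3 := hmax.card_add_three_le_ncard ht hn
  obtain ⟨U₁, U₂, h⟩ := hmax.1.exists_isBadPair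
  have hcov : ∀ F ∈ 𝓕, F ≠ U₁ → F ≠ U₂ → t ≤ dm (F ⊓ U₁) ∧ t ≤ dm (F ⊓ U₂) := fun F hF h1 h2 =>
    ⟨h.le_dm_inf_left hF h2, h.le_dm_inf_right hF h1⟩
  obtain ⟨F₀, hF₀, h01, h02⟩ : ∃ F ∈ 𝓕, F ≠ U₁ ∧ F ≠ U₂ := by
    by_contra! hcon
    have h1 : 𝓕 ⊆ {U₁, U₂} := fun F hF => by
      by_cases hF1 : F = U₁
      · exact Or.inl hF1
      · exact Or.inr (hcon F hF hF1)
    have h2 := Set.ncard_le_ncard h1 (Set.toFinite _)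
    have h3 := Set.ncard_insert_le U₁ {U₂}
    rw [Set.ncard_singleton] at h3
    omega
  by_cases hint : ∀ F ∈ {F ∈ 𝓕 | F ≠ U₁ ∧ F ≠ U₂}, ∀ F' ∈ {F ∈ 𝓕 | F ≠ U₁ ∧ F ≠ U₂},
      t ≤ dm (F ⊓ F')
  · left
    have hgrid := forall_eq_or_forall_eq (s := {F ∈ 𝓕 | F ≠ U₁ ∧ F ≠ U₂}) (f := (· ⊓ U₁))
      (g := (· ⊓ U₂)) fun F hF F' hF' => inf_eq_or_inf_eq_of_cover h.lt (h.dm_eq F hF.1)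
        (h.dm_eq F' hF'.1) (hcov F hF.1 hF.2.1 hF.2.2).1 (hcov F hF.1 hF.2.1 hF.2.2).2
        (hcov F' hF'.1 hF'.2.1 hF'.2.2).1 (hcov F' hF'.1 hF'.2.1 hF'.2.2).2 (hint F hF F' hF')
    rcases hgrid with heq | heq
    · obtain ⟨h1, h2⟩ := h.exists_familyH_of_inf_eq hmax hF₀ h01 h02
        fun F hF h1 h2 => heq F ⟨hF, h1, h2⟩ F₀ ⟨hF₀, h01, h02⟩
      exact ⟨by omega, U₁, mem_subspaces.2 h.dm_left, U₂, mem_subspaces.2 h.dm_right, h2⟩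
    · obtain ⟨h1, h2⟩ := h.symm.exists_familyH_of_inf_eq hmax hF₀ h02 h01
        fun F hF h2 h1 => heq F ⟨hF, h1, h2⟩ F₀ ⟨hF₀, h01, h02⟩
      exact ⟨by omega, U₂, mem_subspaces.2 h.dm_right, U₁, mem_subspaces.2 h.dm_left, h2⟩
  · right
    push Not at hint
    obtain ⟨U₃, ⟨hU₃, h31, h32⟩, U₄, ⟨hU₄, h41, h42⟩, hlt⟩ := hint
    have h' : IsBadPair (t + 1) t 𝓕 U₃ U₄ := ⟨h.dm_eq, h.almost, hU₃, hU₄, hlt⟩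
    have hsub := h.subset_familyG h' h31 h32 h41 h42
    have hle := Set.ncard_le_ncard hsub (Set.toFinite _)
    have hG : (familyG U₁ U₂ U₃ U₄).ncard ≤ 6 := ncard_familyG_le
    have heq := Set.eq_of_subset_of_ncard_le hsub (hG.trans h6) (Set.toFinite _)
    obtain ⟨w3, hW, d31, d32, _⟩ := structure_of_cover h.lt h'.dm_left (hcov U₃ hU₃ h31 h32).1
      (hcov U₃ hU₃ h31 h32).2
    obtain ⟨w4, _, d41, d42, _⟩ := structure_of_cover h.lt h'.dm_right (hcov U₄ hU₄ h41 h42).1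
      (hcov U₄ hU₄ h41 h42).2
    refine ⟨by omega, U₁, mem_subspaces.2 h.dm_left, U₂, mem_subspaces.2 h.dm_right,
      U₃, mem_subspaces.2 h'.dm_left, U₄, mem_subspaces.2 h'.dm_right,
      eq_of_le_of_dm_le (le_inf w3 w4) (by omega), mem_subspaces.2 (by omega), ?_, ?_, ?_, ?_, heq⟩
    · rwa [inf_comm]
    · rwa [inf_comm]
    · rwa [inf_comm]
    · rwa [inf_comm]

end Grid

end AlmostIntersecting

/-! ### Assembly of the two cases. -/

theorem theorem1p4 {K V : Type*} [Field K] [Finite K] [AddCommGroup V] [Module K V]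
    [FiniteDimensional K V] (q n k t : ℕ)
    (hq : Nat.card K = q) (hn : Module.finrank K V = n)
    (hkt : t + 1 ≤ k) (ht : 3 ≤ t + 1)
    (hbound : 2 * (k : ℤ) + t + AlmostIntersecting.delta 2 q
      + AlmostIntersecting.delta k (t + 1) * (1 - 2 * (t : ℤ) - AlmostIntersecting.delta 2 q)
        ≤ (n : ℤ))
    (𝓕 : Set (Submodule K V)) (h𝓕 : AlmostIntersecting.IsMaximumProperAlmost k t 𝓕) :
    ((k, q) ≠ (t + 1, 2) ∧
      ∃ U₁ ∈ AlmostIntersecting.subspaces K V k, ∃ U₂ ∈ AlmostIntersecting.subspaces K V k,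
      ∃ E ∈ AlmostIntersecting.subspacesOf U₁ t,
        U₁ ⊓ U₂ ∈ AlmostIntersecting.subspacesOf E (t - 1) ∧
        𝓕 = AlmostIntersecting.familyH k t U₁ U₂ E) ∨
    (((k, q) = (t + 1, 2) ∨ (k, q) = (t + 1, 3)) ∧
      ∃ U₁ ∈ AlmostIntersecting.subspaces K V (t + 1),
      ∃ U₂ ∈ AlmostIntersecting.subspaces K V (t + 1),
      ∃ U₃ ∈ AlmostIntersecting.subspaces K V (t + 1),
      ∃ U₄ ∈ AlmostIntersecting.subspaces K V (t + 1),
        U₁ ⊓ U₂ = U₃ ⊓ U₄ ∧ U₁ ⊓ U₂ ∈ AlmostIntersecting.subspaces K V (t - 1) ∧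
        Module.finrank K ↥(U₁ ⊓ U₃) = t ∧ Module.finrank K ↥(U₁ ⊓ U₄) = t ∧
        Module.finrank K ↥(U₂ ⊓ U₃) = t ∧ Module.finrank K ↥(U₂ ⊓ U₄) = t ∧
        𝓕 = AlmostIntersecting.familyG U₁ U₂ U₃ U₄) := by
  subst hq hn
  have hcard := AlmostIntersecting.two_le_card_field K
  rcases hkt.eq_or_lt with rfl | hk
  -- For `k = t + 1` the terms in `δ_{2,q}` cancel and the bound reads `n ≥ t + 3`, the dimension of
  -- `U₁ ⊔ U₂` when `U₁ ⊓ U₂` has dimension `t - 1`.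
  · have hn : t + 3 ≤ Module.finrank K V := by
      rw [AlmostIntersecting.delta, AlmostIntersecting.delta, if_pos rfl] at hbound
      push_cast at hbound
      omega
    rcases AlmostIntersecting.eq_familyH_or_eq_familyG (by omega) hn h𝓕 with ⟨hq, h⟩ | ⟨hq, h⟩
    · refine Or.inl ⟨fun heq => ?_, h⟩
      have := (Prod.ext_iff.1 heq).2
      dsimp only at this
      omega
    · refine Or.inr ⟨?_, h⟩
      rcases hcard.eq_or_lt with h2 | h2
      · exact Or.inl (by rw [← h2])
      · exact Or.inr (by rw [show Nat.card K = 3 by omega])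
  · have hn : 2 * k + t + (if Nat.card K = 2 then 1 else 0) ≤ Module.finrank K V := by
      rw [AlmostIntersecting.delta, AlmostIntersecting.delta,
        if_neg (by omega : k ≠ t + 1)] at hbound
      split_ifs at hbound ⊢ <;> omega
    refine Or.inl ⟨fun heq => ?_,
      AlmostIntersecting.exists_eq_familyH_of_add_two_le (by omega) hk hn h𝓕⟩
    have := (Prod.ext_iff.1 heq).1
    dsimp only at this
    omega
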